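/- **Theorem 456745645 (even reflection).** Let $n\ge 1$, $1<q<\infty$, and $\mathbb{R}^n_+=\{x\in\mathbb{R}^n : x_n>0\}$. For a (real- or complex-valued) function $u$ on $\mathbb{R}^n_+$ let $Ru$ be its even reflection, $Ru=u$ on $\mathbb{R}^n_+$ and $Ru(x',x_n)=u(x',-x_n)$ for $x_n<0$. *Spaces.* For $s=k+\sigma$ with $k\in\mathbb{N}_0$, $0\le\sigma<1$, $W^s_q(\mathbb{R}^n)$ is the Sobolev–Slobodeckij space with norm $$\sum_{|a|\le k}\|\partial^a u\|_{L_q}+\sum_{|a|=k}\Big(\iint\frac{|\partial^a u(x)-\partial^a u(y)|^q}{|x-y|^{n+\sigma q}}\,dx\,dy\Big)^{1/q},$$ where the $\partial^a u$ are weak derivatives and the second sum is dropped if $\sigma=0$. For $s=k+\sigma$ with $k\in\mathbb{N}_0$, $0<\sigma<1$, and $1<p<\infty$, $B^s_{qp}(\mathbb{R}^n)$ is the Besov space with norm $$\sum_{|a|\le k}\|\partial^a u\|_{L_q}+\sum_{|a|=k}\Big(\int_{\mathbb{R}^n}\big(|h|^{-\sigma}\|\partial^a u(\cdot+h)-\partial^a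 u\|_{L_q}\big)^p\frac{dh}{|h|^n}\Big)^{1/p}.$$ The spaces $W^s_q(\mathbb{R}^n_+)$ and $B^s_{qp}(\mathbb{R}^n_+)$ consist of the restrictions to $\mathbb{R}^n_+$ of the elements of $W^s_q(\mathbb{R}^n)$ and $B^s_{qp}(\mathbb{R}^n)$, with the infimum of the norms of all extensions as norm. The condition $\partial_{x_n}u|_{x_n=0}=0$ is understood in the sense of traces: there are $\varphi_j\in C_c^\infty(\mathbb{R}^n)$ with $\varphi_j|_{\mathbb{R}^n_+}\to u$ in the space on $\mathbb{R}^n_+$ under consideration and $\partial_{x_n}\varphi_j(\cdot,0)\to 0$ in $L_q(\mathbb{R}^{n-1})$. *Claim.* $R$ is well defined on classes of functions modulo equality almost everywhere, and it induces a bounded linear operator 1. from $W^{1+\alpha}_q(\mathbb{R}^n_+)$ to $W^{1+\alpha}_q(\mathbb{R}^n)$, for every $0\le\alpha<1/q$; 2. from $W^{1+\beta}_q(\mathbb{R}^n_+)\cap\{u:\partial_{x_n}u|_{x_n=0}=0\}$ to $W^{1+\beta}_q(\mathbb{R}^n)$, for every $\beta\in(1/q,1)$; 3. from $W^{3+\alpha}_q(\mathbb{R}^n_+)\cap\{u:\partial_{x_n}u|_{x_n=0}=0\}$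 to $W^{3+\alpha}_q(\mathbb{R}^n)$, for every $\alpha\in(0,1/q)$, if $q\in(3/2,2)$; 4. from $B^{4-1/q-3/p}_{qp}(\mathbb{R}^n_+)\cap\{u:\partial_{x_n}u|_{x_n=0}=0\}$ to $B^{4-1/q-3/p}_{qp}(\mathbb{R}^n)$, if $q\in(3/2,2)$ and $3/(2-3/q)<p<\infty$ (then $3<4-1/q-3/p<3+1/q$). -/

import Mathlib

open MeasureTheory Filter Topology
open scoped ENNReal NNReal ContDiff

noncomputable section

/-- `g` is the weak derivative `∂_{ι 0} ⋯ ∂_{ι (m-1)} u` of the locally integrable function `u`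
on `ℝ^d`: one has `∫ u ∂^ι φ = (-1)^m ∫ φ g` for all test functions `φ ∈ C_c^∞(ℝ^d)`.
A derivative of order `m` is labelled by the tuple `ι` of the `m` coordinate directions. -/
def IsWeakDeriv {𝕜 : Type*} [RCLike 𝕜] {d m : ℕ} (ι : Fin m → Fin d)
    (u g : EuclideanSpace ℝ (Fin d) → 𝕜) : Prop :=
  LocallyIntegrable u volume ∧ LocallyIntegrable g volume ∧
    ∀ φ : EuclideanSpace ℝ (Fin d) → ℝ, ContDiff ℝ ∞ φ → HasCompactSupport φ →
      ∫ x, (iteratedFDeriv ℝ m φ x fun j => EuclideanSpace.single (ι j) (1 : ℝ)) • u x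
        = (-1 : ℝ) ^ m • ∫ x, φ x • g x

/-- All weak derivatives of `u` of order at most `k` exist as locally integrable functions. -/
def HasWeakDerivs {𝕜 : Type*} [RCLike 𝕜] {d : ℕ} (k : ℕ)
    (u : EuclideanSpace ℝ (Fin d) → 𝕜) : Prop :=
  ∀ m ≤ k, ∀ ι : Fin m → Fin d, ∃ g, IsWeakDeriv ι u g

open Classical in
/-- A representative of the weak derivative (which is unique up to null sets);
`0` if there is none. -/
def weakDeriv {𝕜 : Type*} [RCLike 𝕜] {d m : ℕ} (ι : Fin m → Fin d)
    (u : EuclideanSpace ℝ (Fin d) → 𝕜) : EuclideanSpace ℝ (Fin d) → 𝕜 :=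
  if h : ∃ g, IsWeakDeriv ι u g then h.choose else 0

/-- `∑_{m ≤ k} ∑_{ι} ‖∂^ι u‖_{L_q(ℝ^d)}`, the sum over all derivatives of order at most `k`. -/
def integerSobolevNorm {𝕜 : Type*} [RCLike 𝕜] {d : ℕ} (k : ℕ) (q : ℝ)
    (u : EuclideanSpace ℝ (Fin d) → 𝕜) : ℝ≥0∞ :=
  ∑ m ∈ Finset.range (k + 1), ∑ ι : Fin m → Fin d,
    eLpNorm (weakDeriv ι u) (ENNReal.ofReal q) volume

/-- The Slobodeckij (Gagliardo) seminorm of order `σ ∈ (0,1)`,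
`(∫∫ |g x - g y|^q / |x - y|^{d + σ q} dx dy)^{1/q}`. -/
def slobodeckijSeminorm {𝕜 : Type*} [RCLike 𝕜] {d : ℕ} (σ q : ℝ)
    (g : EuclideanSpace ℝ (Fin d) → 𝕜) : ℝ≥0∞ :=
  (∫⁻ x, ∫⁻ y, ‖g x - g y‖ₑ ^ q / ‖x - y‖ₑ ^ ((d : ℝ) + σ * q)) ^ (1 / q)

open Classical in
/-- The norm of the Sobolev-Slobodeckij space `W^s_q(ℝ^d)`, `s ≥ 0`, `1 ≤ q < ∞`. Write
`s = k + σ` with `k = ⌊s⌋` and `0 ≤ σ < 1`: the norm consists of the `L_q` norms of all weak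
derivatives of order at most `k` and, if `σ ≠ 0`, of the Slobodeckij seminorms of order `σ` of
those of order `k`. It is `∞` if one of these derivatives fails to exist, so that
`W^s_q(ℝ^d)` is the set of all `u` with finite norm. -/
def sobolevNorm {𝕜 : Type*} [RCLike 𝕜] {d : ℕ} (s q : ℝ)
    (u : EuclideanSpace ℝ (Fin d) → 𝕜) : ℝ≥0∞ :=
  if HasWeakDerivs ⌊s⌋₊ u then
    integerSobolevNorm ⌊s⌋₊ q u +
      (if Int.fract s = 0 then 0
        else ∑ ι : Fin ⌊s⌋₊ → Fin d, slobodeckijSeminorm (Int.fract s) q (weakDeriv ι u))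
  else ⊤

/-- The Besov seminorm of order `σ ∈ (0,1]`,
`(∫ (|h|^{-σ} ‖Δ_h^M g‖_{L_q})^p dh / |h|^d)^{1/p}`, where `Δ_h g (x) = g (x + h) - g x` and
`M` is the smallest integer larger than `σ` (so `M = 1` for `σ < 1` and `M = 2` for `σ = 1`). -/
def besovSeminorm {𝕜 : Type*} [RCLike 𝕜] {d : ℕ} (σ q p : ℝ)
    (g : EuclideanSpace ℝ (Fin d) → 𝕜) : ℝ≥0∞ :=
  (∫⁻ h : EuclideanSpace ℝ (Fin d),
    (eLpNorm ((fwdDiff h)^[⌊σ⌋₊ + 1] g) (ENNReal.ofReal q) volume / ‖h‖ₑ ^ σ) ^ p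
      / ‖h‖ₑ ^ (d : ℝ)) ^ (1 / p)

open Classical in
/-- The norm of the Besov space `B^s_{qp}(ℝ^d)`, `s > 0`, `1 ≤ q, p < ∞` (`q` is the
integrability exponent and `p` the fine index). Write `s = k + σ` with an integer `k ≥ 0` and
`0 < σ ≤ 1`: the norm consists of the `L_q` norms of all weak derivatives of order at most `k`
and of the Besov seminorms of order `σ` of those of order `k`. It is `∞` if one of these
derivatives fails to exist, so that `B^s_{qp}(ℝ^d)` is the set of all `u` with finite norm. -/
def besovNorm {𝕜 : Type*} [RCLike 𝕜] {d : ℕ} (s q p : ℝ)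
    (u : EuclideanSpace ℝ (Fin d) → 𝕜) : ℝ≥0∞ :=
  if HasWeakDerivs (⌈s⌉₊ - 1) u then
    integerSobolevNorm (⌈s⌉₊ - 1) q u +
      ∑ ι : Fin (⌈s⌉₊ - 1) → Fin d,
        besovSeminorm (s - ((⌈s⌉₊ - 1 : ℕ) : ℝ)) q p (weakDeriv ι u)
  else ⊤

/-- The norm of the space of restrictions to `Ω` of the functions on `ℝ^d` with finite
norm `N`: the infimum of `N U` over all `U` with `U = u` almost everywhere on `Ω`.
A function `u` belongs to this space if and only if `normOn N Ω u < ∞`. -/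
def normOn {𝕜 : Type*} [RCLike 𝕜] {d : ℕ}
    (N : (EuclideanSpace ℝ (Fin d) → 𝕜) → ℝ≥0∞) (Ω : Set (EuclideanSpace ℝ (Fin d)))
    (u : EuclideanSpace ℝ (Fin d) → 𝕜) : ℝ≥0∞ :=
  ⨅ (U : EuclideanSpace ℝ (Fin d) → 𝕜) (_ : U =ᵐ[volume.restrict Ω] u), N U

/-- The open half space of `ℝ^{n+1}` where the last coordinate is positive. -/
def upperHalfSpace (n : ℕ) : Set (EuclideanSpace ℝ (Fin (n + 1))) :=
  {x | 0 < x (Fin.last n)}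

/-- The point of `ℝ^{n+1}` with the sign of the last coordinate changed. -/
def reflectLast {n : ℕ} (x : EuclideanSpace ℝ (Fin (n + 1))) :
    EuclideanSpace ℝ (Fin (n + 1)) :=
  WithLp.toLp 2 (Function.update x.ofLp (Fin.last n) (-x (Fin.last n)))

open Classical in
/-- The even reflection of functions on the half space, as a linear map: `Ru = u` on the half
space and `Ru (x', x_n) = u (x', -x_n)` otherwise. Only the values of `u` on the half space matter
(on the boundary, a null set, `Ru` equals `u`). -/
def evenReflection (𝕜 : Type*) [RCLike 𝕜] (n : ℕ) :
    (EuclideanSpace ℝ (Fin (n + 1)) → 𝕜) →ₗ[𝕜] (EuclideanSpace ℝ (Fin (n + 1)) → 𝕜) where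
  toFun u := fun x => if x ∈ upperHalfSpace n then u x else u (reflectLast x)
  map_add' u v := by
    ext x
    by_cases hx : x ∈ upperHalfSpace n <;> simp [hx]
  map_smul' c u := by
    ext x
    by_cases hx : x ∈ upperHalfSpace n <;> simp [hx]

/-- The point `(x', 0)` of the boundary of the half space. -/
def boundaryPoint {n : ℕ} (x' : EuclideanSpace ℝ (Fin n)) : EuclideanSpace ℝ (Fin (n + 1)) :=
  WithLp.toLp 2 (Fin.snoc (α := fun _ => ℝ) x'.ofLp 0)

/-- The derivative in the last coordinate direction at the points `(x', 0)`. -/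
def normalDerivOnBoundary {𝕜 : Type*} [RCLike 𝕜] {n : ℕ}
    (φ : EuclideanSpace ℝ (Fin (n + 1)) → 𝕜) (x' : EuclideanSpace ℝ (Fin n)) : 𝕜 :=
  fderiv ℝ φ (boundaryPoint x') (EuclideanSpace.single (Fin.last n) (1 : ℝ))

/-- `∂_{x_n} u |_{x_n = 0} = g` in the sense of traces, for `u` in the space on the half space
with norm `normOn N (upperHalfSpace n)`. The trace operator is the extension by continuity of
`φ ↦ ∂_{x_n} φ (·, 0)` from the (restrictions of) functions `φ ∈ C_c^∞(ℝ^{n+1})`, with values in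
`L_q(ℝ^n)`. -/
def HasNeumannTrace {𝕜 : Type*} [RCLike 𝕜] {n : ℕ}
    (N : (EuclideanSpace ℝ (Fin (n + 1)) → 𝕜) → ℝ≥0∞) (q : ℝ)
    (u : EuclideanSpace ℝ (Fin (n + 1)) → 𝕜) (g : EuclideanSpace ℝ (Fin n) → 𝕜) : Prop :=
  ∃ φ : ℕ → EuclideanSpace ℝ (Fin (n + 1)) → 𝕜,
    (∀ j, ContDiff ℝ ∞ (φ j) ∧ HasCompactSupport (φ j)) ∧
    Tendsto (fun j => normOn N (upperHalfSpace n) (φ j - u)) atTop (𝓝 0) ∧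
    Tendsto (fun j => eLpNorm (normalDerivOnBoundary (φ j) - g) (ENNReal.ofReal q) volume)
      atTop (𝓝 0)

end

/-! The even reflection depends only on the values on the half space, so it suffices to bound the
norm of `evenReflection 𝕜 n U` by that of `U` for every extension `U` of finite norm and then pass
to the infimum (`exists_bound_of_extension`). This needs the weak derivatives of the reflection and
a bound for their seminorms.

Derivatives: a derivative of the even reflection is the reflection of the same derivative of `U`,
even or odd according to the parity of the number of normal derivatives in it
(`isWeakDeriv_evenReflection`). Once the reflection is moved onto the test function, a normal
derivative of an even reflection is tested with functions vanishing at `x_n = 0`, so nothing is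
required of `U`. A normal derivative of an odd reflection leaves a boundary term, which disappears
if the reflected function has trace zero (`VanishesOnBoundary`). First derivatives never meet this
case. Up to order three only `∂_n U` and its tangential derivatives do, and for these the Neumann
condition suffices (`vanishesOnBoundary_of_tendsto`,
`VanishesOnBoundary.weakDeriv_of_reflectionSign`).

Seminorms: both kinds are compared with `averagedBesov`, a radial average of `|g x - g y|^q` over
pairs at distance less than `r`. It involves distances only and no translations, so it makes sense
on the half space. For even reflections, two points on the same side are at most as far apart as one
of them and the mirror image of the other. For odd reflections, a pair on opposite sides at distance
less than `r` lies, after reflection, in the slab `0 < x_n < r`; the additional term is a weighted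
integral of the slab masses, for `p = q` essentially `∫ |g|^q x_n^(-σ q)`. Bounding it by the
seminorm is a Hardy inequality.

Hardy's inequality: comparing the slabs of heights `r` and `c r` and rescaling gives `N(ε) ≤ C [g] +
c^(σ - 1/q) N(c ε)`, where `N(ε)` is the weighted norm over `r > ε` (`exists_slabNorm_rpow_le_add`).
If `σ < 1/q`, then `c = 2` makes the factor less than one, and the last term is absorbed
(`exists_slabNorm_le_of_lt`). If `σ > 1/q`, then `c = 1/2` does, but the recursion runs towards the
boundary; for smooth functions its iteration ends in a trace term (`slabNorm_le_add_trace`), which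
disappears when test functions with traces tending to zero approximate `g`
(`exists_slabNorm_le_of_gt`). -/

noncomputable section

/-- The Euclidean space `ℝ^d`. -/
abbrev Euc (d : ℕ) := EuclideanSpace ℝ (Fin d)

/-- The unit vector in the `i`-th coordinate direction. -/
abbrev unitVec {d : ℕ} (i : Fin d) : Euc d := EuclideanSpace.single i (1 : ℝ)

/-! ### The reflection as an isometry, and splitting integrals into two half spaces. -/

section HalfSpace

variable {n : ℕ}

theorem reflectLast_apply_last (x : Euc (n + 1)) :
    reflectLast x (Fin.last n) = -x (Fin.last n) := by
  simp [reflectLast]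

theorem reflectLast_apply_of_ne (x : Euc (n + 1)) {i : Fin (n + 1)} (hi : i ≠ Fin.last n) :
    reflectLast x i = x i := by
  simp [reflectLast, hi]

theorem reflectLast_reflectLast (x : Euc (n + 1)) : reflectLast (reflectLast x) = x := by
  ext i
  by_cases hi : i = Fin.last n
  · subst hi; simp [reflectLast_apply_last]
  · simp [reflectLast_apply_of_ne _ hi]

theorem reflectLast_add (x y : Euc (n + 1)) :
    reflectLast (x + y) = reflectLast x + reflectLast y := by
  ext i
  by_cases hi : i = Fin.last n
  · subst hi; simp [reflectLast_apply_last]; ring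
  · simp [reflectLast_apply_of_ne _ hi]

theorem reflectLast_smul (c : ℝ) (x : Euc (n + 1)) :
    reflectLast (c • x) = c • reflectLast x := by
  ext i
  by_cases hi : i = Fin.last n
  · subst hi; simp [reflectLast_apply_last]
  · simp [reflectLast_apply_of_ne _ hi]

theorem norm_reflectLast (x : Euc (n + 1)) : ‖reflectLast x‖ = ‖x‖ := by
  rw [EuclideanSpace.norm_eq, EuclideanSpace.norm_eq]
  congr 1
  refine Finset.sum_congr rfl fun i _ => ?_
  by_cases hi : i = Fin.last n
  · subst hi; simp [reflectLast_apply_last]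
  · simp [reflectLast_apply_of_ne _ hi]

/-- The reflection `reflectLast` as a linear isometric equivalence. -/
def reflectLastEquiv (n : ℕ) : Euc (n + 1) ≃ₗᵢ[ℝ] Euc (n + 1) where
  toFun := reflectLast
  invFun := reflectLast
  left_inv := reflectLast_reflectLast
  right_inv := reflectLast_reflectLast
  map_add' := reflectLast_add
  map_smul' := reflectLast_smul
  norm_map' := norm_reflectLast

theorem coe_reflectLastEquiv : ⇑(reflectLastEquiv n) = reflectLast := rfl

theorem measurePreserving_reflectLast :
    MeasurePreserving (reflectLast : Euc (n + 1) → Euc (n + 1)) volume volume :=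
  (reflectLastEquiv n).measurePreserving

theorem measurableEmbedding_reflectLast :
    MeasurableEmbedding (reflectLast : Euc (n + 1) → Euc (n + 1)) :=
  (reflectLastEquiv n).toHomeomorph.measurableEmbedding

theorem contDiff_reflectLast {m : ℕ∞ω} :
    ContDiff ℝ m (reflectLast : Euc (n + 1) → Euc (n + 1)) :=
  (reflectLastEquiv n).contDiff

theorem reflectLast_unitVec_last :
    reflectLast (unitVec (Fin.last n)) = -unitVec (Fin.last n) := by
  ext i
  by_cases hi : i = Fin.last n
  · subst hi; simp [reflectLast_apply_last]
  · simp [reflectLast_apply_of_ne _ hi, hi]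

theorem reflectLast_unitVec_of_ne {i : Fin (n + 1)} (hi : i ≠ Fin.last n) :
    reflectLast (unitVec i) = unitVec i := by
  ext j
  by_cases hj : j = Fin.last n
  · subst hj; simp [reflectLast_apply_last, hi.symm]
  · simp [reflectLast_apply_of_ne _ hj]

theorem continuous_coord {d : ℕ} (i : Fin d) : Continuous fun x : Euc d => x i :=
  (EuclideanSpace.proj i : Euc d →L[ℝ] ℝ).continuous

theorem isOpen_upperHalfSpace : IsOpen (upperHalfSpace n) :=
  isOpen_lt continuous_const (continuous_coord _)

theorem measurableSet_upperHalfSpace : MeasurableSet (upperHalfSpace n) :=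
  isOpen_upperHalfSpace.measurableSet

theorem mem_upperHalfSpace {x : Euc (n + 1)} : x ∈ upperHalfSpace n ↔ 0 < x (Fin.last n) :=
  Iff.rfl

theorem ae_coord_last_ne_zero : ∀ᵐ x : Euc (n + 1), x (Fin.last n) ≠ 0 := by
  let L : Submodule ℝ (Euc (n + 1)) :=
    LinearMap.ker (EuclideanSpace.proj (Fin.last n) : Euc (n + 1) →L[ℝ] ℝ).toLinearMap
  have hL : L ≠ ⊤ := by
    intro h
    have : unitVec (Fin.last n) ∈ L := h ▸ Submodule.mem_top
    simp [L] at this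
  have := Measure.addHaar_submodule (volume : Measure (Euc (n + 1))) L hL
  rw [ae_iff]
  convert this using 2
  ext x; simp [L]

/-- Lebesgue measure is the sum of its restriction to the half space and of the reflection of
this restriction. -/
theorem volume_eq_restrict_add_map_reflectLast :
    (volume : Measure (Euc (n + 1))) = volume.restrict (upperHalfSpace n) +
      (volume.restrict (upperHalfSpace n)).map reflectLast := by
  have h1 : (volume.restrict (upperHalfSpace n)).map reflectLast =
      (volume : Measure (Euc (n + 1))).restrict (upperHalfSpace n)ᶜ := by
    have h2 := (measurePreserving_reflectLast (n := n)).restrict_preimage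
      (s := {x | x (Fin.last n) < 0}) (isOpen_lt (continuous_coord _) continuous_const).measurableSet
    have h3 : reflectLast ⁻¹' {x : Euc (n + 1) | x (Fin.last n) < 0} = upperHalfSpace n := by
      ext x; simp [reflectLast_apply_last, mem_upperHalfSpace]
    rw [h3] at h2
    rw [h2.map_eq]
    -- The complement of the half space and the open lower half space differ by the boundary
    -- hyperplane, a null set.
    refine Measure.restrict_congr_set ?_
    filter_upwards [ae_coord_last_ne_zero (n := n)] with x hx
    refine propext ?_
    change x (Fin.last n) < 0 ↔ ¬ 0 < x (Fin.last n)
    rw [not_lt]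
    exact ⟨le_of_lt, fun h => lt_of_le_of_ne h hx⟩
  rw [h1, Measure.restrict_add_restrict_compl measurableSet_upperHalfSpace]

theorem lintegral_eq_add_reflectLast (F : Euc (n + 1) → ℝ≥0∞) :
    ∫⁻ x, F x = (∫⁻ x in upperHalfSpace n, F x) +
      ∫⁻ x in upperHalfSpace n, F (reflectLast x) := by
  conv_lhs => rw [volume_eq_restrict_add_map_reflectLast]
  rw [lintegral_add_measure, measurableEmbedding_reflectLast.lintegral_map]

theorem ae_of_ae_half {P : Euc (n + 1) → Prop}
    (h1 : ∀ᵐ x ∂volume.restrict (upperHalfSpace n), P x)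
    (h2 : ∀ᵐ x ∂volume.restrict (upperHalfSpace n), P (reflectLast x)) : ∀ᵐ x, P x := by
  rw [volume_eq_restrict_add_map_reflectLast, ae_add_measure_iff]
  exact ⟨h1, measurableEmbedding_reflectLast.ae_map_iff.2 h2⟩

theorem integral_eq_add_reflectLast {F : Type*} [NormedAddCommGroup F] [NormedSpace ℝ F]
    {f : Euc (n + 1) → F} (hf : Integrable f) :
    ∫ x, f x = (∫ x in upperHalfSpace n, f x) +
      ∫ x in upperHalfSpace n, f (reflectLast x) := by
  have hf' := hf
  rw [volume_eq_restrict_add_map_reflectLast, integrable_add_measure] at hf'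
  conv_lhs => rw [volume_eq_restrict_add_map_reflectLast]
  rw [integral_add_measure hf'.1 hf'.2, measurableEmbedding_reflectLast.integral_map]

end HalfSpace

/-! ### Even and odd reflections and their `L_q` norms. -/

section SignedReflection

variable {𝕜 : Type*} [RCLike 𝕜] {n : ℕ}

open Classical in
/-- The extension of `u` from the half space by `s` times its reflection. It is the even
reflection if `s = 1` and the odd reflection if `s = -1`. -/
def signedReflection (s : ℝ) (u : Euc (n + 1) → 𝕜) : Euc (n + 1) → 𝕜 :=
  fun x => if x ∈ upperHalfSpace n then u x else s • u (reflectLast x)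

theorem signedReflection_of_mem (s : ℝ) (u : Euc (n + 1) → 𝕜) {x : Euc (n + 1)}
    (hx : x ∈ upperHalfSpace n) : signedReflection s u x = u x := by
  simp [signedReflection, hx]

theorem reflectLast_notMem {x : Euc (n + 1)} (hx : x ∈ upperHalfSpace n) :
    reflectLast x ∉ upperHalfSpace n := by
  rw [mem_upperHalfSpace] at *
  rw [reflectLast_apply_last]; linarith

theorem signedReflection_reflectLast (s : ℝ) (u : Euc (n + 1) → 𝕜) {x : Euc (n + 1)}
    (hx : x ∈ upperHalfSpace n) : signedReflection s u (reflectLast x) = s • u x := by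
  simp [signedReflection, reflectLast_notMem hx, reflectLast_reflectLast]

theorem evenReflection_eq (u : Euc (n + 1) → 𝕜) :
    evenReflection 𝕜 n u = signedReflection 1 u := by
  ext x
  simp [evenReflection, signedReflection]

theorem signedReflection_eq_indicator (s : ℝ) (u : Euc (n + 1) → 𝕜) :
    signedReflection s u = (upperHalfSpace n).indicator u +
      (upperHalfSpace n)ᶜ.indicator (fun x => s • u (reflectLast x)) := by
  ext x
  by_cases hx : x ∈ upperHalfSpace n <;> simp [signedReflection, hx]

theorem signedReflection_congr_ae (s : ℝ) {u v : Euc (n + 1) → 𝕜}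
    (h : u =ᵐ[volume.restrict (upperHalfSpace n)] v) :
    signedReflection s u =ᵐ[volume] signedReflection s v := by
  have hm : ∀ᵐ x ∂(volume.restrict (upperHalfSpace n)), x ∈ upperHalfSpace n :=
    ae_restrict_mem measurableSet_upperHalfSpace
  refine ae_of_ae_half ?_ ?_
  · filter_upwards [h, hm] with x hx hxm
    simp [signedReflection_of_mem _ _ hxm, hx]
  · filter_upwards [h, hm] with x hx hxm
    simp [signedReflection_reflectLast _ _ hxm, hx]

theorem _root_.MeasureTheory.LocallyIntegrable.signedReflection {u : Euc (n + 1) → 𝕜}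
    (hu : LocallyIntegrable u) (s : ℝ) : LocallyIntegrable (signedReflection s u) := by
  rw [signedReflection_eq_indicator]
  refine (hu.indicator measurableSet_upperHalfSpace).add
    (LocallyIntegrable.indicator ?_ measurableSet_upperHalfSpace.compl)
  refine LocallyIntegrable.smul ?_ s
  rw [locallyIntegrable_iff] at hu ⊢
  intro K hK
  have h := hu _ (hK.image (reflectLastEquiv n).continuous)
  have h3 := (measurePreserving_reflectLast (n := n)).integrableOn_comp_preimage
    measurableEmbedding_reflectLast (f := u) (s := ⇑(reflectLastEquiv n) '' K)
  have h4 : reflectLast ⁻¹' (⇑(reflectLastEquiv n) '' K) = K := by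
    rw [coe_reflectLastEquiv]
    exact Set.preimage_image_eq _ (reflectLastEquiv n).injective
  rw [h4] at h3
  exact h3.2 h

theorem enorm_signedReflection_reflectLast {s : ℝ} (hs : |s| = 1) (u : Euc (n + 1) → 𝕜)
    {x : Euc (n + 1)} (hx : x ∈ upperHalfSpace n) :
    ‖signedReflection s u (reflectLast x)‖ₑ = ‖u x‖ₑ := by
  rw [signedReflection_reflectLast _ _ hx, enorm_smul]
  have : ‖s‖ₑ = 1 := by
    rw [← Real.enorm_abs, hs]; simp
  simp [this]

theorem lintegral_signedReflection_rpow_le {s : ℝ} (hs : |s| = 1) (q : ℝ)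
    (u : Euc (n + 1) → 𝕜) :
    ∫⁻ x, ‖signedReflection s u x‖ₑ ^ q ≤ 2 * ∫⁻ x, ‖u x‖ₑ ^ q := by
  rw [lintegral_eq_add_reflectLast, two_mul]
  refine add_le_add ?_ ?_
  · refine le_trans (le_of_eq ?_) (setLIntegral_le_lintegral (upperHalfSpace n) _)
    refine setLIntegral_congr_fun measurableSet_upperHalfSpace fun x hx => ?_
    simp [signedReflection_of_mem _ _ hx]
  · refine le_trans (le_of_eq ?_) (setLIntegral_le_lintegral (upperHalfSpace n) _)
    refine setLIntegral_congr_fun measurableSet_upperHalfSpace fun x hx => ?_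
    simp [enorm_signedReflection_reflectLast hs _ hx]

theorem eLpNorm_ofReal_eq {α F : Type*} [MeasurableSpace α] {μ : Measure α}
    [NormedAddCommGroup F] {q : ℝ} (hq : 0 < q) (f : α → F) :
    eLpNorm f (ENNReal.ofReal q) μ = (∫⁻ x, ‖f x‖ₑ ^ q ∂μ) ^ (1 / q) := by
  rw [eLpNorm_eq_lintegral_rpow_enorm_toReal (by simpa using hq) ENNReal.ofReal_ne_top,
    ENNReal.toReal_ofReal hq.le]

theorem eLpNorm_signedReflection_le {s : ℝ} (hs : |s| = 1) {q : ℝ} (hq : 1 ≤ q)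
    (u : Euc (n + 1) → 𝕜) :
    eLpNorm (signedReflection s u) (ENNReal.ofReal q) volume ≤
      2 * eLpNorm u (ENNReal.ofReal q) volume := by
  have hq0 : 0 < q := by linarith
  rw [eLpNorm_ofReal_eq hq0, eLpNorm_ofReal_eq hq0]
  calc _ ≤ (2 * ∫⁻ x, ‖u x‖ₑ ^ q) ^ (1 / q) := by
        gcongr; exact lintegral_signedReflection_rpow_le hs q u
    _ = 2 ^ (1 / q) * (∫⁻ x, ‖u x‖ₑ ^ q) ^ (1 / q) := by
        rw [ENNReal.mul_rpow_of_nonneg _ _ (by positivity)]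
    _ ≤ _ := by
        gcongr
        calc (2 : ℝ≥0∞) ^ (1 / q) ≤ 2 ^ (1 : ℝ) := by
              refine ENNReal.rpow_le_rpow_of_exponent_le (by norm_num) ?_
              rw [div_le_one hq0]; exact hq
          _ = 2 := by simp

end SignedReflection

/-! ### Calculus of weak derivatives. -/

section WeakDerivative

variable {𝕜 : Type*} [RCLike 𝕜] {d m : ℕ}

/-- The classical derivative of `φ` in the direction of the `i`-th coordinate. -/
def partialDeriv {F : Type*} [NormedAddCommGroup F] [NormedSpace ℝ F] (i : Fin d)
    (φ : Euc d → F) : Euc d → F :=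
  fun x => fderiv ℝ φ x (unitVec i)

section Classical

variable {F : Type*} [NormedAddCommGroup F] [NormedSpace ℝ F] {φ : Euc d → F}

theorem ContDiff.partialDeriv (hφ : ContDiff ℝ ∞ φ) (i : Fin d) :
    ContDiff ℝ ∞ (partialDeriv i φ) :=
  (hφ.fderiv_right (m := ∞) (by simp)).clm_apply contDiff_const

theorem HasCompactSupport.partialDeriv (hφ : HasCompactSupport φ) (i : Fin d) :
    HasCompactSupport (partialDeriv i φ) :=
  hφ.fderiv_apply ℝ _

theorem partialDeriv_comm (hφ : ContDiff ℝ ∞ φ) (i j : Fin d) :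
    partialDeriv i (partialDeriv j φ) = partialDeriv j (partialDeriv i φ) := by
  ext x
  have h2 : DifferentiableAt ℝ (fderiv ℝ φ) x :=
    ((hφ.fderiv_right (m := ∞) (by simp)).differentiable (by simp)).differentiableAt
  have hs : IsSymmSndFDerivAt ℝ φ x := hφ.contDiffAt.isSymmSndFDerivAt
    (by simpa using WithTop.coe_le_coe.2 (le_top : (2 : ℕ∞) ≤ ⊤))
  have key : ∀ a b : Fin d, _root_.partialDeriv a (_root_.partialDeriv b φ) x =
      fderiv ℝ (fderiv ℝ φ) x (unitVec a) (unitVec b) := by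
    intro a b
    unfold _root_.partialDeriv
    rw [fderiv_clm_apply h2 (differentiableAt_const _)]
    simp
  rw [key, key]
  exact hs.eq _ _

theorem iteratedFDeriv_one_unitVec (φ : Euc d → F) (i : Fin d) (x : Euc d) :
    (iteratedFDeriv ℝ 1 φ x fun j => unitVec ((![i] : Fin 1 → Fin d) j)) = partialDeriv i φ x := by
  rw [iteratedFDeriv_one_apply]
  simp [partialDeriv]

/-- Peeling off the last slot makes the `i`-th derivative the innermost one. Since `∂_i φ` is again
a test function, the definition of a weak derivative of order `m` applies to it, which reduces
higher derivatives to single ones. -/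
theorem iteratedFDeriv_snoc_unitVec (hφ : ContDiff ℝ ∞ φ) (ι : Fin m → Fin d) (i : Fin d)
    (x : Euc d) :
    (iteratedFDeriv ℝ (m + 1) φ x fun j => unitVec ((Fin.snoc ι i : Fin (m + 1) → Fin d) j)) =
      iteratedFDeriv ℝ m (partialDeriv i φ) x fun j => unitVec (ι j) := by
  rw [iteratedFDeriv_succ_apply_right]
  have h1 : ContDiffAt ℝ m (fderiv ℝ φ) x :=
    ((hφ.fderiv_right (m := ∞) (by simp)).of_le (by exact_mod_cast le_top)).contDiffAt
  have h2 := (ContinuousLinearMap.apply ℝ F (unitVec i)).iteratedFDeriv_comp_left h1 le_rfl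
  have h3 : (⇑(ContinuousLinearMap.apply ℝ F (unitVec i)) ∘ fderiv ℝ φ) = partialDeriv i φ := by
    ext y; simp [partialDeriv]
  rw [h3] at h2
  have h4 : (Fin.init fun j => unitVec ((Fin.snoc ι i : Fin (m + 1) → Fin d) j)) =
      fun j => unitVec (ι j) := by
    ext1 j; simp [Fin.init]
  rw [h2, h4]
  simp

end Classical

theorem IsWeakDeriv.congr_ae {ι : Fin m → Fin d} {u u' g g' : Euc d → 𝕜}
    (h : IsWeakDeriv ι u g) (hu : u =ᵐ[volume] u') (hg : g =ᵐ[volume] g') :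
    IsWeakDeriv ι u' g' := by
  refine ⟨h.1.congr hu, h.2.1.congr hg, fun φ hφ hc => ?_⟩
  refine (integral_congr_ae ?_).trans ((h.2.2 φ hφ hc).trans ?_)
  · exact hu.mono fun x hx => by simp [hx]
  · congr 1
    exact integral_congr_ae (hg.mono fun x hx => by simp [hx])

theorem integral_smul_eq_of_eqOn {Ω : Set (Euc d)} {φ : Euc d → ℝ} {u v : Euc d → 𝕜}
    (hΩ : MeasurableSet Ω) (hφ : ∀ x ∉ Ω, φ x = 0) (h : u =ᵐ[volume.restrict Ω] v) :
    ∫ x, φ x • u x = ∫ x, φ x • v x := by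
  refine integral_congr_ae ?_
  have := (ae_restrict_iff' hΩ).1 h
  filter_upwards [this] with x hx
  by_cases hxΩ : x ∈ Ω
  · rw [hx hxΩ]
  · simp [hφ x hxΩ]

theorem iteratedFDeriv_eq_zero_of_notMem_tsupport {φ : Euc d → ℝ} {x : Euc d}
    (hx : x ∉ tsupport φ) (v : Fin m → Euc d) : iteratedFDeriv ℝ m φ x v = 0 := by
  have : iteratedFDeriv ℝ m φ x = 0 := by
    by_contra h
    exact hx (support_iteratedFDeriv_subset m h)
  simp [this]

/-- Weak derivatives are local: they agree almost everywhere on an open set on which the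
functions agree almost everywhere. -/
theorem IsWeakDeriv.ae_eq_of_isOpen {ι : Fin m → Fin d} {u u' g g' : Euc d → 𝕜} {Ω : Set (Euc d)}
    (hΩ : IsOpen Ω) (h : IsWeakDeriv ι u g) (h' : IsWeakDeriv ι u' g')
    (hu : u =ᵐ[volume.restrict Ω] u') : g =ᵐ[volume.restrict Ω] g' := by
  -- The fundamental lemma of the calculus of variations on `Ω`: test functions supported in `Ω` do
  -- not see where `u` and `u'` differ.
  have key := hΩ.ae_eq_zero_of_integral_contDiff_smul_eq_zero (μ := volume) (f := g - g')
    ((h.2.1.sub h'.2.1).locallyIntegrableOn Ω) ?_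
  · refine (ae_restrict_iff' hΩ.measurableSet).2 ?_
    filter_upwards [key] with x hx hxΩ
    exact sub_eq_zero.1 (hx hxΩ)
  · intro φ hφ hc hs
    simp only [Pi.sub_apply, smul_sub]
    rw [integral_sub (h.2.1.integrable_smul_left_of_hasCompactSupport hφ.continuous hc)
      (h'.2.1.integrable_smul_left_of_hasCompactSupport hφ.continuous hc), sub_eq_zero]
    have h1 := h.2.2 φ hφ hc
    have h2 := h'.2.2 φ hφ hc
    rw [integral_smul_eq_of_eqOn hΩ.measurableSet (fun x hx =>
      iteratedFDeriv_eq_zero_of_notMem_tsupport (fun hx' => hx (hs hx')) _) hu, h2] at h1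
    exact (smul_right_injective _ (by positivity : ((-1 : ℝ) ^ m) ≠ 0) h1).symm

theorem IsWeakDeriv.ae_eq {ι : Fin m → Fin d} {u g g' : Euc d → 𝕜}
    (h : IsWeakDeriv ι u g) (h' : IsWeakDeriv ι u g') : g =ᵐ[volume] g' := by
  have := h.ae_eq_of_isOpen isOpen_univ h' (ae_eq_refl _)
  rwa [Measure.restrict_univ] at this

theorem isWeakDeriv_weakDeriv {ι : Fin m → Fin d} {u : Euc d → 𝕜}
    (h : ∃ g, IsWeakDeriv ι u g) : IsWeakDeriv ι u (weakDeriv ι u) := by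
  rw [weakDeriv, dif_pos h]
  exact h.choose_spec

theorem IsWeakDeriv.weakDeriv_ae_eq {ι : Fin m → Fin d} {u g : Euc d → 𝕜}
    (h : IsWeakDeriv ι u g) : weakDeriv ι u =ᵐ[volume] g :=
  (isWeakDeriv_weakDeriv ⟨g, h⟩).ae_eq h

theorem HasWeakDerivs.isWeakDeriv {k : ℕ} {u : Euc d → 𝕜} (h : HasWeakDerivs k u) (hm : m ≤ k)
    (ι : Fin m → Fin d) : IsWeakDeriv ι u (weakDeriv ι u) :=
  isWeakDeriv_weakDeriv (h m hm ι)

theorem isWeakDeriv_iff_of_ae_eq {ι : Fin m → Fin d} {u u' g : Euc d → 𝕜}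
    (hu : u =ᵐ[volume] u') : IsWeakDeriv ι u g ↔ IsWeakDeriv ι u' g :=
  ⟨fun h => h.congr_ae hu (ae_eq_refl _), fun h => h.congr_ae hu.symm (ae_eq_refl _)⟩

theorem weakDeriv_congr_ae {ι : Fin m → Fin d} {u u' : Euc d → 𝕜} (hu : u =ᵐ[volume] u') :
    weakDeriv ι u = weakDeriv ι u' := by
  have : IsWeakDeriv ι u = IsWeakDeriv ι u' := by
    ext g; exact isWeakDeriv_iff_of_ae_eq hu
  unfold weakDeriv
  rw [this]

theorem hasWeakDerivs_congr_ae {k : ℕ} {u u' : Euc d → 𝕜} (hu : u =ᵐ[volume] u') :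
    HasWeakDerivs k u ↔ HasWeakDerivs k u' := by
  simp only [HasWeakDerivs, isWeakDeriv_iff_of_ae_eq hu]

theorem isWeakDeriv_zero {u : Euc d → 𝕜} (hu : LocallyIntegrable u) (ι : Fin 0 → Fin d) :
    IsWeakDeriv ι u u :=
  ⟨hu, hu, fun φ _ _ => by simp⟩

theorem hasCompactSupport_iteratedFDeriv_apply {φ : Euc d → ℝ} (hφ : HasCompactSupport φ)
    (v : Fin m → Euc d) : HasCompactSupport fun x => iteratedFDeriv ℝ m φ x v :=
  hφ.mono' fun x hx => by
    by_contra h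
    exact hx (iteratedFDeriv_eq_zero_of_notMem_tsupport h v)

theorem ContDiff.continuous_iteratedFDeriv_apply {φ : Euc d → ℝ} (hφ : ContDiff ℝ ∞ φ)
    (v : Fin m → Euc d) : Continuous fun x => iteratedFDeriv ℝ m φ x v :=
  (ContinuousMultilinearMap.apply ℝ (fun _ : Fin m => Euc d) ℝ v).continuous.comp
    (hφ.continuous_iteratedFDeriv (by exact_mod_cast le_top))

theorem IsWeakDeriv.sub {ι : Fin m → Fin d} {u u' g g' : Euc d → 𝕜}
    (h : IsWeakDeriv ι u g) (h' : IsWeakDeriv ι u' g') : IsWeakDeriv ι (u - u') (g - g') := by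
  refine ⟨h.1.sub h'.1, h.2.1.sub h'.2.1, fun φ hφ hc => ?_⟩
  simp only [Pi.sub_apply, smul_sub]
  have hd : Continuous fun x => iteratedFDeriv ℝ m φ x fun j => unitVec (ι j) :=
    hφ.continuous_iteratedFDeriv_apply _
  rw [integral_sub, integral_sub, h.2.2 φ hφ hc, h'.2.2 φ hφ hc, smul_sub]
  · exact h.2.1.integrable_smul_left_of_hasCompactSupport hφ.continuous hc
  · exact h'.2.1.integrable_smul_left_of_hasCompactSupport hφ.continuous hc
  · exact h.1.integrable_smul_left_of_hasCompactSupport hd (hasCompactSupport_iteratedFDeriv_apply hc _)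
  · exact h'.1.integrable_smul_left_of_hasCompactSupport hd (hasCompactSupport_iteratedFDeriv_apply hc _)

theorem isWeakDeriv_one_iff {i : Fin d} {u g : Euc d → 𝕜} :
    IsWeakDeriv ![i] u g ↔ LocallyIntegrable u ∧ LocallyIntegrable g ∧
      ∀ φ : Euc d → ℝ, ContDiff ℝ ∞ φ → HasCompactSupport φ →
        ∫ x, partialDeriv i φ x • u x = -∫ x, φ x • g x := by
  unfold IsWeakDeriv
  simp only [iteratedFDeriv_one_unitVec, pow_one, neg_smul, one_smul]

theorem IsWeakDeriv.integral_partialDeriv {i : Fin d} {u g : Euc d → 𝕜}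
    (h : IsWeakDeriv ![i] u g) {φ : Euc d → ℝ} (hφ : ContDiff ℝ ∞ φ) (hc : HasCompactSupport φ) :
    ∫ x, partialDeriv i φ x • u x = -∫ x, φ x • g x :=
  (isWeakDeriv_one_iff.1 h).2.2 φ hφ hc

/-- Derivatives of order `m + 1` are derivatives of derivatives of order `m`. -/
theorem IsWeakDeriv.snoc_iff {ι : Fin m → Fin d} {i : Fin d} {u g h : Euc d → 𝕜}
    (hg : IsWeakDeriv ι u g) :
    IsWeakDeriv (Fin.snoc ι i : Fin (m + 1) → Fin d) u h ↔ IsWeakDeriv ![i] g h := by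
  have key : ∀ φ : Euc d → ℝ, ContDiff ℝ ∞ φ → HasCompactSupport φ →
      ∫ x, (iteratedFDeriv ℝ (m + 1) φ x fun j =>
        unitVec ((Fin.snoc ι i : Fin (m + 1) → Fin d) j)) • u x =
      (-1 : ℝ) ^ m • ∫ x, partialDeriv i φ x • g x := by
    intro φ hφ hc
    simp only [iteratedFDeriv_snoc_unitVec hφ]
    exact hg.2.2 _ (hφ.partialDeriv i) (hc.partialDeriv i)
  rw [isWeakDeriv_one_iff]
  constructor
  · rintro ⟨-, h2, h3⟩
    refine ⟨hg.2.1, h2, fun φ hφ hc => ?_⟩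
    have h4 := h3 φ hφ hc
    rw [key φ hφ hc, pow_succ, mul_smul] at h4
    have := smul_right_injective _ (by positivity : ((-1 : ℝ) ^ m) ≠ 0) h4
    simpa using this
  · rintro ⟨-, h2, h3⟩
    refine ⟨hg.1, h2, fun φ hφ hc => ?_⟩
    rw [key φ hφ hc, h3 φ hφ hc, pow_succ, mul_smul]
    simp

/-- If `∂_i w₀ = w₁`, `∂_j w₀ = h₀` and `∂_j w₁ = h`, then `∂_i h₀ = h`. -/
theorem IsWeakDeriv.comm {i j : Fin d} {w₀ w₁ h₀ h : Euc d → 𝕜} (h1 : IsWeakDeriv ![i] w₀ w₁)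
    (h2 : IsWeakDeriv ![j] w₀ h₀) (h3 : IsWeakDeriv ![j] w₁ h) : IsWeakDeriv ![i] h₀ h := by
  refine isWeakDeriv_one_iff.2 ⟨h2.2.1, h3.2.1, fun φ hφ hc => ?_⟩
  have e1 := h2.integral_partialDeriv (hφ.partialDeriv i) (hc.partialDeriv i)
  have e2 := h1.integral_partialDeriv (hφ.partialDeriv j) (hc.partialDeriv j)
  have e3 := h3.integral_partialDeriv hφ hc
  rw [partialDeriv_comm hφ j i, e2, e3] at e1
  rw [← neg_neg (∫ x, partialDeriv i φ x • h₀ x), ← e1, neg_neg]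

theorem isWeakDeriv_partialDeriv {φ : Euc d → 𝕜} (hφ : ContDiff ℝ ∞ φ)
    (hc : HasCompactSupport φ) (i : Fin d) : IsWeakDeriv ![i] φ (partialDeriv i φ) := by
  have c1 := (hφ.partialDeriv i).continuous
  have hc1 := hc.partialDeriv i
  refine isWeakDeriv_one_iff.2 ⟨hφ.continuous.locallyIntegrable, c1.locallyIntegrable,
    fun ψ hψ hcψ => ?_⟩
  have c2 := (hψ.partialDeriv i).continuous
  have := integral_bilinear_hasFDerivAt_right_eq_neg_left_of_integrable
    (μ := (volume : Measure (Euc d))) (B := ContinuousLinearMap.lsmul ℝ ℝ (E := 𝕜))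
    (f := ψ) (g := φ) (f' := fderiv ℝ ψ) (g' := fderiv ℝ φ) (v := unitVec i)
    ?_ ?_ ?_ (fun x _ => ((hψ.differentiable (by simp)) x).hasFDerivAt)
    (fun x _ => ((hφ.differentiable (by simp)) x).hasFDerivAt)
  · rw [← neg_inj, neg_neg]
    exact this.symm
  · exact (Continuous.integrable_of_hasCompactSupport (c2.smul hφ.continuous)
      (HasCompactSupport.smul_left hc))
  · exact (Continuous.integrable_of_hasCompactSupport (hψ.continuous.smul c1)
      (HasCompactSupport.smul_left hc1))
  · exact (Continuous.integrable_of_hasCompactSupport (hψ.continuous.smul hφ.continuous)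
      (HasCompactSupport.smul_left hc))

end WeakDerivative

/-! ### Integration by parts on the half space by cutting off at the boundary. -/

section HalfSpaceIntegration

variable {𝕜 : Type*} [RCLike 𝕜] {n : ℕ}

theorem deriv_smoothTransition_of_neg {t : ℝ} (ht : t < 0) : deriv Real.smoothTransition t = 0 := by
  have : Real.smoothTransition =ᶠ[𝓝 t] fun _ => 0 := by
    filter_upwards [Iio_mem_nhds ht] with s hs
    exact Real.smoothTransition.zero_of_nonpos (le_of_lt hs)
  rw [this.deriv_eq]; simp

theorem deriv_smoothTransition_of_one_lt {t : ℝ} (ht : 1 < t) :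
    deriv Real.smoothTransition t = 0 := by
  have : Real.smoothTransition =ᶠ[𝓝 t] fun _ => 1 := by
    filter_upwards [Ioi_mem_nhds ht] with s hs
    exact Real.smoothTransition.one_of_one_le (le_of_lt hs)
  rw [this.deriv_eq]; simp

/-- The derivative of the transition function is supported in `[0, 1]`. Consequently the normal
derivative of the cutoff `halfSpaceCutoff n c` is `O(1 / |x_n|)` uniformly in `c`, and its product
with a function that vanishes linearly at the boundary stays bounded. -/
theorem exists_deriv_smoothTransition_mul_le :
    ∃ M : ℝ, 0 ≤ M ∧ ∀ t : ℝ, |deriv Real.smoothTransition t * t| ≤ M := by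
  have hc : Continuous fun t : ℝ => deriv Real.smoothTransition t * t :=
    ((Real.smoothTransition.contDiff (n := 1)).continuous_deriv le_rfl).mul continuous_id
  obtain ⟨M, hM⟩ := (isCompact_Icc (a := (0 : ℝ)) (b := 1)).exists_bound_of_continuousOn
    hc.continuousOn
  refine ⟨max M 0, le_max_right _ _, fun t => ?_⟩
  rcases lt_or_ge t 0 with h | h
  · simp [deriv_smoothTransition_of_neg h]
  rcases lt_or_ge 1 t with h' | h'
  · simp [deriv_smoothTransition_of_one_lt h']
  exact (hM t ⟨h, h'⟩).trans (le_max_left _ _)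

/-- A smooth cutoff function vanishing for `x_n ≤ 0` and equal to one for `x_n ≥ 1 / c`. -/
def halfSpaceCutoff (n : ℕ) (c : ℝ) (x : Euc (n + 1)) : ℝ :=
  Real.smoothTransition (c * x (Fin.last n))

theorem contDiff_halfSpaceCutoff (c : ℝ) : ContDiff ℝ ∞ (halfSpaceCutoff n c) :=
  Real.smoothTransition.contDiff.comp
    (contDiff_const.mul (EuclideanSpace.proj (Fin.last n) : Euc (n + 1) →L[ℝ] ℝ).contDiff)

theorem partialDeriv_halfSpaceCutoff (c : ℝ) (i : Fin (n + 1)) (x : Euc (n + 1)) :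
    partialDeriv i (halfSpaceCutoff n c) x =
      deriv Real.smoothTransition (c * x (Fin.last n)) * (c * unitVec i (Fin.last n)) := by
  have h1 : HasFDerivAt (fun y : Euc (n + 1) => c * y (Fin.last n))
      (c • (EuclideanSpace.proj (Fin.last n) : Euc (n + 1) →L[ℝ] ℝ)) x :=
    ((EuclideanSpace.proj (Fin.last n) : Euc (n + 1) →L[ℝ] ℝ).hasFDerivAt).const_mul c
  have h2 : HasDerivAt Real.smoothTransition
      (deriv Real.smoothTransition (c * x (Fin.last n))) (c * x (Fin.last n)) :=
    ((Real.smoothTransition.contDiff (n := 1)).differentiable (by simp) _).hasDerivAt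
  have h3 := h2.comp_hasFDerivAt x h1
  have h4 : halfSpaceCutoff n c = Real.smoothTransition ∘ fun y : Euc (n + 1) =>
    c * y (Fin.last n) := rfl
  unfold partialDeriv
  rw [h4, h3.fderiv]
  simp

theorem partialDeriv_mul {d : ℕ} {φ ψ : Euc d → ℝ} (hφ : ContDiff ℝ ∞ φ) (hψ : ContDiff ℝ ∞ ψ)
    (i : Fin d) (x : Euc d) : partialDeriv i (fun y => φ y * ψ y) x =
      φ x * partialDeriv i ψ x + partialDeriv i φ x * ψ x := by
  unfold partialDeriv
  rw [fderiv_fun_mul (hφ.differentiable (by simp) x) (hψ.differentiable (by simp) x)]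
  simp; ring

/-- A compactly supported smooth function is Lipschitz; compare `x` with its orthogonal projection
onto the hyperplane `x_n = 0`. -/
theorem exists_abs_le_mul_coord_last {ψ : Euc (n + 1) → ℝ} (hψ : ContDiff ℝ ∞ ψ)
    (hc : HasCompactSupport ψ) (h0 : ∀ x : Euc (n + 1), x (Fin.last n) = 0 → ψ x = 0) :
    ∃ L : ℝ, 0 ≤ L ∧ ∀ x, |ψ x| ≤ L * |x (Fin.last n)| := by
  obtain ⟨L, hL⟩ := ContDiff.lipschitzWith_of_hasCompactSupport hc hψ (by simp)
  refine ⟨L, L.2, fun x => ?_⟩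
  have h1 := hL.dist_le_mul x (x - x (Fin.last n) • unitVec (Fin.last n))
  rw [h0 (x - x (Fin.last n) • unitVec (Fin.last n)) (by simp)] at h1
  simpa [Real.dist_eq, dist_eq_norm, norm_smul] using h1

/-- Integration by parts on the half space, for tangential derivatives or for test functions
vanishing on the boundary. -/
theorem IsWeakDeriv.setIntegral_upperHalfSpace {i : Fin (n + 1)} {w h : Euc (n + 1) → 𝕜}
    (hw : IsWeakDeriv ![i] w h) {ψ : Euc (n + 1) → ℝ} (hψ : ContDiff ℝ ∞ ψ)
    (hc : HasCompactSupport ψ)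
    (hi : i ≠ Fin.last n ∨ ∀ x : Euc (n + 1), x (Fin.last n) = 0 → ψ x = 0) :
    ∫ x in upperHalfSpace n, partialDeriv i ψ x • w x = -∫ x in upperHalfSpace n, ψ x • h x := by
  -- The products `η k * ψ` are admissible on the whole space, and `η k` tends to the indicator
  -- function of the half space. It remains to pass to the limit, the critical term being `∂_i (η k)
  -- * ψ`.
  set η : ℕ → Euc (n + 1) → ℝ := fun k => halfSpaceCutoff n (k + 1) with hη
  have hηc : ∀ k, ContDiff ℝ ∞ (η k) := fun k => contDiff_halfSpaceCutoff _
  have hηle : ∀ k x, |η k x| ≤ 1 := fun k x => by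
    rw [abs_of_nonneg (show 0 ≤ η k x from Real.smoothTransition.nonneg _)]
    exact Real.smoothTransition.le_one _
  have hηneg : ∀ k (x : Euc (n + 1)), x (Fin.last n) ≤ 0 → η k x = 0 := fun k x hx =>
    Real.smoothTransition.zero_of_nonpos (mul_nonpos_of_nonneg_of_nonpos (by positivity) hx)
  have hlarge : ∀ x : Euc (n + 1), 0 < x (Fin.last n) →
      ∀ᶠ k : ℕ in atTop, 1 < ((k : ℝ) + 1) * x (Fin.last n) := by
    intro x hx
    have := (tendsto_natCast_atTop_atTop (R := ℝ)).atTop_add (tendsto_const_nhds (x := (1 : ℝ)))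
    exact (this.atTop_mul_const hx).eventually_gt_atTop 1
  have hηpos : ∀ x : Euc (n + 1), 0 < x (Fin.last n) → ∀ᶠ k in atTop, η k x = 1 := by
    intro x hx
    filter_upwards [hlarge x hx] with k hk
    exact Real.smoothTransition.one_of_one_le hk.le
  have key : ∀ k, ∫ x, (η k x * partialDeriv i ψ x + partialDeriv i (η k) x * ψ x) • w x =
      -∫ x, (η k x * ψ x) • h x := by
    intro k
    rw [← hw.integral_partialDeriv ((hηc k).mul hψ) hc.mul_left]
    simp only [partialDeriv_mul (hηc k) hψ]
  -- A bound uniform in `k`, for dominated convergence. For tangential `i` the cutoff has zero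
  -- derivative; for the normal direction its growth is compensated by the linear vanishing of `ψ`.
  obtain ⟨A, hA0, hA⟩ : ∃ A : ℝ, 0 ≤ A ∧ ∀ k x,
      |η k x * partialDeriv i ψ x + partialDeriv i (η k) x * ψ x| ≤ A := by
    obtain ⟨B, hB⟩ := (hc.partialDeriv i).exists_bound_of_continuous (hψ.partialDeriv i).continuous
    have hB0 : 0 ≤ B := (norm_nonneg _).trans (hB 0)
    have h1 : ∀ k x, |η k x * partialDeriv i ψ x| ≤ B := by
      intro k x
      rw [abs_mul]
      calc _ ≤ 1 * B := mul_le_mul (hηle k x) (hB x) (abs_nonneg _) zero_le_one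
        _ = B := one_mul B
    by_cases hil : i = Fin.last n
    · have h0 := hi.resolve_left (not_not.2 hil)
      obtain ⟨L, hL0, hL⟩ := exists_abs_le_mul_coord_last hψ hc h0
      obtain ⟨M, hM0, hM⟩ := exists_deriv_smoothTransition_mul_le
      refine ⟨B + M * L, by positivity, fun k x => (abs_add_le _ _).trans (add_le_add (h1 k x) ?_)⟩
      rw [hη]
      simp only
      rw [partialDeriv_halfSpaceCutoff, hil]
      simp only [PiLp.single_apply, if_true, mul_one]
      calc |deriv Real.smoothTransition ((k + 1) * x (Fin.last n)) * (k + 1) * ψ x|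
          = |deriv Real.smoothTransition ((k + 1) * x (Fin.last n)) * (k + 1)| * |ψ x| :=
            abs_mul _ _
        _ ≤ |deriv Real.smoothTransition ((k + 1) * x (Fin.last n)) * (k + 1)| *
            (L * |x (Fin.last n)|) := by gcongr; exact hL x
        _ = |deriv Real.smoothTransition ((k + 1) * x (Fin.last n)) *
            ((k + 1) * x (Fin.last n))| * L := by
            simp only [abs_mul]; ring
        _ ≤ M * L := by gcongr; exact hM _
    · refine ⟨B, hB0, fun k x => ?_⟩
      have : partialDeriv i (η k) x = 0 := by
        rw [hη]
        simp only
        rw [partialDeriv_halfSpaceCutoff]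
        simp [Ne.symm hil]
      rw [this, zero_mul, add_zero]
      exact h1 k x
  have hK : ∀ (g : Euc (n + 1) → 𝕜), LocallyIntegrable g → ∀ B : ℝ,
      Integrable ((tsupport ψ).indicator fun x => B * ‖g x‖) := by
    intro g hg B
    rw [integrable_indicator_iff hc.measurableSet]
    exact (((locallyIntegrable_iff.1 hg) _ hc).norm).const_mul B
  have lim1 : Tendsto (fun k => ∫ x, (η k x * ψ x) • h x) atTop
      (𝓝 (∫ x in upperHalfSpace n, ψ x • h x)) := by
    obtain ⟨B, hB⟩ := hc.exists_bound_of_continuous hψ.continuous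
    rw [← integral_indicator measurableSet_upperHalfSpace]
    refine tendsto_integral_of_dominated_convergence _ (fun k => ?_) (hK h hw.2.1 B) (fun k => ?_) ?_
    · exact (((hηc k).mul hψ).continuous.aestronglyMeasurable).smul hw.2.1.aestronglyMeasurable
    · refine Eventually.of_forall fun x => ?_
      by_cases hx : x ∈ tsupport ψ
      · rw [Set.indicator_of_mem hx, norm_smul]
        gcongr
        rw [norm_mul]
        calc _ ≤ 1 * B := mul_le_mul (hηle k x) (hB x) (norm_nonneg _) zero_le_one
          _ = B := one_mul B
      · simp [image_eq_zero_of_notMem_tsupport hx, hx]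
    · refine Eventually.of_forall fun x => ?_
      by_cases hx : x ∈ upperHalfSpace n
      · rw [Set.indicator_of_mem hx]
        refine tendsto_const_nhds.congr' ?_
        filter_upwards [hηpos x hx] with k hk
        simp [hk]
      · have := fun k => hηneg k x (not_lt.1 hx)
        simp [Set.indicator_of_notMem hx, this]
  have lim2 : Tendsto (fun k => ∫ x, (η k x * partialDeriv i ψ x +
      partialDeriv i (η k) x * ψ x) • w x) atTop
      (𝓝 (∫ x in upperHalfSpace n, partialDeriv i ψ x • w x)) := by
    rw [← integral_indicator measurableSet_upperHalfSpace]
    refine tendsto_integral_of_dominated_convergence _ (fun k => ?_) (hK w hw.1 A) (fun k => ?_) ?_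
    · exact ((((hηc k).continuous.mul (hψ.partialDeriv i).continuous).add
        (((hηc k).partialDeriv i).continuous.mul hψ.continuous)).aestronglyMeasurable).smul
        hw.1.aestronglyMeasurable
    · refine Eventually.of_forall fun x => ?_
      by_cases hx : x ∈ tsupport ψ
      · rw [Set.indicator_of_mem hx, norm_smul]
        gcongr
        exact hA k x
      · have h1 : partialDeriv i ψ x = 0 :=
          image_eq_zero_of_notMem_tsupport fun h' => hx (tsupport_fderiv_apply_subset ℝ _ h')
        simp [image_eq_zero_of_notMem_tsupport hx, hx, h1]
    · filter_upwards [ae_coord_last_ne_zero] with x hx0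
      by_cases hx : x ∈ upperHalfSpace n
      · rw [Set.indicator_of_mem hx]
        refine tendsto_const_nhds.congr' ?_
        filter_upwards [hηpos x hx, hlarge x hx] with k hk hk'
        rw [hk, hη]
        simp only
        rw [partialDeriv_halfSpaceCutoff, deriv_smoothTransition_of_one_lt hk']
        simp
      · have hx' : x (Fin.last n) < 0 := lt_of_le_of_ne (not_lt.1 hx) hx0
        rw [Set.indicator_of_notMem hx]
        refine tendsto_const_nhds.congr fun k => ?_
        rw [hηneg k x hx'.le, hη]
        simp only
        rw [partialDeriv_halfSpaceCutoff, deriv_smoothTransition_of_neg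
          (mul_neg_of_pos_of_neg (by positivity) hx')]
        simp
  refine tendsto_nhds_unique lim2 ?_
  simp only [key]
  exact lim1.neg

end HalfSpaceIntegration

/-! ### Weak derivatives of even and odd reflections. -/

section ReflectionOfDerivatives

variable {𝕜 : Type*} [RCLike 𝕜] {n : ℕ}

/-- A change of variables in the lower half space moves the reflection from `w` to the test
function, so that reflections are tested on the half space by the folded function `φ + s φ ∘
reflectLast`. -/
theorem integral_smul_signedReflection {φ : Euc (n + 1) → ℝ} (hφ : Continuous φ)
    (hc : HasCompactSupport φ) {w : Euc (n + 1) → 𝕜} (hw : LocallyIntegrable w) (s : ℝ) :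
    ∫ x, φ x • signedReflection s w x =
      ∫ x in upperHalfSpace n, (φ x + s * φ (reflectLast x)) • w x := by
  have hcr : HasCompactSupport fun x => φ (reflectLast x) :=
    hc.comp_homeomorph (reflectLastEquiv n).toHomeomorph
  have hφr : Continuous fun x => φ (reflectLast x) := hφ.comp (reflectLastEquiv n).continuous
  have i1 := (hw.integrable_smul_left_of_hasCompactSupport hφ hc).integrableOn
    (s := upperHalfSpace n)
  have i2 : IntegrableOn (fun x => s • φ (reflectLast x) • w x) (upperHalfSpace n) :=
    ((hw.integrable_smul_left_of_hasCompactSupport hφr hcr).integrableOn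
      (s := upperHalfSpace n)).smul s
  rw [integral_eq_add_reflectLast
    ((hw.signedReflection s).integrable_smul_left_of_hasCompactSupport hφ hc)]
  have e1 : ∫ x in upperHalfSpace n, φ x • signedReflection s w x =
      ∫ x in upperHalfSpace n, φ x • w x :=
    setIntegral_congr_fun measurableSet_upperHalfSpace fun x hx => by
      simp [signedReflection_of_mem _ _ hx]
  have e2 : ∫ x in upperHalfSpace n, φ (reflectLast x) • signedReflection s w (reflectLast x) =
      ∫ x in upperHalfSpace n, s • φ (reflectLast x) • w x :=
    setIntegral_congr_fun measurableSet_upperHalfSpace fun x hx => by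
      simp [signedReflection_reflectLast _ _ hx, smul_comm s]
  rw [e1, e2, ← integral_add i1 i2]
  simp only [add_smul, mul_smul]

theorem partialDeriv_comp_reflectLast {φ : Euc (n + 1) → ℝ} (hφ : ContDiff ℝ ∞ φ)
    (i : Fin (n + 1)) (x : Euc (n + 1)) :
    partialDeriv i (fun y => φ (reflectLast y)) x =
      (if i = Fin.last n then -1 else 1) * partialDeriv i φ (reflectLast x) := by
  have h1 : HasFDerivAt (reflectLast : Euc (n + 1) → Euc (n + 1))
      ((reflectLastEquiv n).toContinuousLinearEquiv : Euc (n + 1) →L[ℝ] Euc (n + 1)) x :=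
    (reflectLastEquiv n).toContinuousLinearEquiv.hasFDerivAt
  have h2 := ((hφ.differentiable (by simp) (reflectLast x)).hasFDerivAt).comp x h1
  unfold partialDeriv
  have h3 : (fun y => φ (reflectLast y)) = φ ∘ reflectLast := rfl
  rw [h3, h2.fderiv]
  have h4 : ∀ v, (((reflectLastEquiv n).toContinuousLinearEquiv :
      Euc (n + 1) →L[ℝ] Euc (n + 1))) v = reflectLast v := fun v => rfl
  rw [ContinuousLinearMap.comp_apply, h4]
  by_cases hi : i = Fin.last n
  · subst hi
    rw [reflectLast_unitVec_last]; simp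
  · rw [reflectLast_unitVec_of_ne hi]; simp [hi]

theorem partialDeriv_add_const_mul {d : ℕ} {φ ψ : Euc d → ℝ} (hφ : ContDiff ℝ ∞ φ)
    (hψ : ContDiff ℝ ∞ ψ) (c : ℝ) (i : Fin d) (x : Euc d) :
    partialDeriv i (fun y => φ y + c * ψ y) x = partialDeriv i φ x + c * partialDeriv i ψ x := by
  have h1 := (hφ.differentiable (by simp) x)
  have h2 := (hψ.differentiable (by simp) x)
  unfold partialDeriv
  rw [fderiv_fun_add h1 (h2.const_mul c), fderiv_const_mul h2]
  simp

/-- The integration by parts formula `∫ w ∂_n ψ = -∫ h ψ` on the half space, for all test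
functions `ψ` on the full space: `h` is the derivative of `w` in the normal direction and `w`
vanishes on the boundary. -/
def VanishesOnBoundary (w h : Euc (n + 1) → 𝕜) : Prop :=
  ∀ ψ : Euc (n + 1) → ℝ, ContDiff ℝ ∞ ψ → HasCompactSupport ψ →
    ∫ x in upperHalfSpace n, partialDeriv (Fin.last n) ψ x • w x =
      -∫ x in upperHalfSpace n, ψ x • h x

/-- The chain rule changes the sign of the reflected part under a normal derivative; hence the
folded function with factor `-s` has as normal derivative the folded derivative with factor `s`. For
`s = 1` the folded function `φ - φ ∘ reflectLast` is zero on the boundary and integration by parts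
is free. Otherwise it need not vanish there, and the boundary condition on `w` takes over. -/
theorem IsWeakDeriv.signedReflection {i : Fin (n + 1)} {w h : Euc (n + 1) → 𝕜}
    (hw : IsWeakDeriv ![i] w h) {s : ℝ} (hi : i = Fin.last n → s ≠ 1 → VanishesOnBoundary w h) :
    IsWeakDeriv ![i] (signedReflection s w)
      (signedReflection (if i = Fin.last n then -s else s) h) := by
  refine isWeakDeriv_one_iff.2 ⟨hw.1.signedReflection s, hw.2.1.signedReflection _,
    fun φ hφ hc => ?_⟩
  rw [integral_smul_signedReflection (hφ.partialDeriv i).continuous (hc.partialDeriv i) hw.1,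
    integral_smul_signedReflection hφ.continuous hc hw.2.1]
  set c : ℝ := if i = Fin.last n then -s else s with hcs
  have hφr : ContDiff ℝ ∞ fun x => φ (reflectLast x) := hφ.comp contDiff_reflectLast
  have hcr : HasCompactSupport fun x => φ (reflectLast x) :=
    hc.comp_homeomorph (reflectLastEquiv n).toHomeomorph
  set ψ : Euc (n + 1) → ℝ := fun x => φ x + c * φ (reflectLast x) with hψd
  have hψ : ContDiff ℝ ∞ ψ := hφ.add (contDiff_const.mul hφr)
  have hcψ : HasCompactSupport ψ := hc.add hcr.mul_left
  have hd : ∀ x, partialDeriv i ψ x = partialDeriv i φ x + s * partialDeriv i φ (reflectLast x) := by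
    intro x
    rw [hψd, partialDeriv_add_const_mul hφ hφr, partialDeriv_comp_reflectLast hφ, ← mul_assoc]
    congr 2
    rw [hcs]; split_ifs <;> ring
  simp only [← hd]
  by_cases hil : i = Fin.last n
  · by_cases hs : s = 1
    · refine hw.setIntegral_upperHalfSpace hψ hcψ (Or.inr fun x hx => ?_)
      have : reflectLast x = x := by
        ext j
        by_cases hj : j = Fin.last n
        · subst hj; simp [reflectLast_apply_last, hx]
        · simp [reflectLast_apply_of_ne _ hj]
      simp [hψd, hcs, this, hil, hs]
    · have := hi hil hs ψ hψ hcψ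
      rwa [← hil] at this
  · exact hw.setIntegral_upperHalfSpace hψ hcψ (Or.inl hil)

/-- Tangential derivatives of functions vanishing on the boundary vanish on the boundary. -/
theorem VanishesOnBoundary.tangential {i : Fin (n + 1)} (hi : i ≠ Fin.last n)
    {w₀ w₁ h₀ h : Euc (n + 1) → 𝕜} (hv : VanishesOnBoundary w₀ h₀)
    (h1 : IsWeakDeriv ![i] w₀ w₁) (h2 : IsWeakDeriv ![i] h₀ h) : VanishesOnBoundary w₁ h := by
  intro ψ hψ hc
  -- Tangential integration by parts leaves no boundary term, so the derivative `∂_i` can be shifted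
  -- to the test function and back; in between, `hv` is applied with `∂_i ψ`.
  have e1 := h1.setIntegral_upperHalfSpace (hψ.partialDeriv (Fin.last n))
    (hc.partialDeriv _) (Or.inl hi)
  have e2 := hv _ (hψ.partialDeriv i) (hc.partialDeriv i)
  have e3 := h2.setIntegral_upperHalfSpace hψ hc (Or.inl hi)
  rw [partialDeriv_comm hψ, e2, e3] at e1
  rw [← neg_neg (∫ x in upperHalfSpace n, partialDeriv (Fin.last n) ψ x • w₁ x), ← e1, neg_neg]

/-- The sign by which the derivative `∂^ι` of an even function is reflected. -/
def reflectionSign {m : ℕ} (ι : Fin m → Fin (n + 1)) : ℝ :=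
  ∏ j, if ι j = Fin.last n then -1 else 1

theorem reflectionSign_snoc {m : ℕ} (ι : Fin m → Fin (n + 1)) (i : Fin (n + 1)) :
    reflectionSign (Fin.snoc ι i : Fin (m + 1) → Fin (n + 1)) =
      if i = Fin.last n then -reflectionSign ι else reflectionSign ι := by
  unfold reflectionSign
  rw [Fin.prod_univ_castSucc]
  simp only [Fin.snoc_castSucc, Fin.snoc_last]
  split_ifs <;> simp

theorem reflectionSign_eq_or {m : ℕ} (ι : Fin m → Fin (n + 1)) :
    reflectionSign ι = 1 ∨ reflectionSign ι = -1 := by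
  unfold reflectionSign
  refine Finset.prod_induction _ (fun x : ℝ => x = 1 ∨ x = -1) ?_ (Or.inl rfl) ?_
  · rintro a b (rfl | rfl) (rfl | rfl) <;> simp
  · intro j _; split_ifs <;> simp

theorem abs_reflectionSign {m : ℕ} (ι : Fin m → Fin (n + 1)) : |reflectionSign ι| = 1 := by
  rcases reflectionSign_eq_or ι with h | h <;> simp [h]

/-- The weak derivatives of the even reflection of `u` are reflections of those of `u`, provided
that the derivatives which are to be reflected oddly vanish on the boundary if they are
differentiated in the normal direction once more. -/
theorem isWeakDeriv_evenReflection {k : ℕ} {u : Euc (n + 1) → 𝕜} (hu : HasWeakDerivs k u)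
    (hv : ∀ m < k, ∀ ι : Fin m → Fin (n + 1), reflectionSign ι = -1 →
      VanishesOnBoundary (weakDeriv ι u)
        (weakDeriv (Fin.snoc ι (Fin.last n) : Fin (m + 1) → Fin (n + 1)) u))
    {m : ℕ} (hm : m ≤ k) (ι : Fin m → Fin (n + 1)) :
    IsWeakDeriv ι (evenReflection 𝕜 n u) (signedReflection (reflectionSign ι) (weakDeriv ι u)) := by
  induction m with
  | zero =>
    have h := hu.isWeakDeriv hm ι
    have h0 := (isWeakDeriv_zero h.1 ι).ae_eq h
    have h1 : reflectionSign ι = 1 := by simp [reflectionSign]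
    rw [h1, evenReflection_eq]
    exact (isWeakDeriv_zero (h.1.signedReflection 1) ι).congr_ae (ae_eq_refl _)
      (signedReflection_congr_ae 1 (ae_restrict_of_ae h0))
  | succ m ih =>
    obtain ⟨ι', i, rfl⟩ : ∃ (ι' : Fin m → Fin (n + 1)) (i : Fin (n + 1)),
        ι = (Fin.snoc ι' i : Fin (m + 1) → Fin (n + 1)) :=
      ⟨Fin.init ι, ι (Fin.last m), (Fin.snoc_init_self ι).symm⟩
    have h1 := ih (by omega) ι'
    have h2 := hu.isWeakDeriv (by omega : m ≤ k) ι'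
    have h3 := hu.isWeakDeriv hm (Fin.snoc ι' i : Fin (m + 1) → Fin (n + 1))
    rw [h1.snoc_iff, reflectionSign_snoc]
    refine (h2.snoc_iff.1 h3).signedReflection fun hi hs => ?_
    subst hi
    exact hv m (by omega) ι' ((reflectionSign_eq_or ι').resolve_left hs)

end ReflectionOfDerivatives

/-! ### Fubini's theorem in normal and tangential coordinates. -/

section Slices

variable {n : ℕ}

/-- The point of `ℝ^{n+1}` with tangential coordinates `x'` and last coordinate `t`. -/
def slicePoint (t : ℝ) (x' : Euc n) : Euc (n + 1) :=
  WithLp.toLp 2 (Fin.snoc (α := fun _ => ℝ) x'.ofLp t)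

theorem slicePoint_zero (x' : Euc n) : slicePoint 0 x' = boundaryPoint x' := rfl

@[simp] theorem slicePoint_last (t : ℝ) (x' : Euc n) : slicePoint t x' (Fin.last n) = t := by
  simp [slicePoint]

@[simp] theorem slicePoint_castSucc (t : ℝ) (x' : Euc n) (i : Fin n) :
    slicePoint t x' i.castSucc = x' i := by
  simp [slicePoint]

/-- The decomposition of `ℝ^{n+1}` into the last coordinate and the tangential coordinates. -/
def sliceEquiv (n : ℕ) : Euc (n + 1) ≃ᵐ ℝ × Euc n :=
  ((MeasurableEquiv.toLp 2 (Fin (n + 1) → ℝ)).symm.trans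
    (MeasurableEquiv.piFinSuccAbove (fun _ => ℝ) (Fin.last n))).trans
    ((MeasurableEquiv.refl ℝ).prodCongr (MeasurableEquiv.toLp 2 (Fin n → ℝ)))

theorem sliceEquiv_symm_apply (z : ℝ × Euc n) :
    (sliceEquiv n).symm z = slicePoint z.1 z.2 := by
  rw [MeasurableEquiv.symm_apply_eq]
  ext i
  · exact (slicePoint_last z.1 z.2).symm
  · change z.2 i = Fin.removeNth (Fin.last n) (slicePoint z.1 z.2).ofLp i
    simp [Fin.removeNth]

theorem measurePreserving_sliceEquiv :
    MeasurePreserving (sliceEquiv n) volume ((volume : Measure ℝ).prod volume) := by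
  have h1 := EuclideanSpace.volume_preserving_symm_measurableEquiv_toLp (Fin (n + 1))
  have h2 := volume_preserving_piFinSuccAbove (fun _ : Fin (n + 1) => ℝ) (Fin.last n)
  have h3 := (EuclideanSpace.volume_preserving_symm_measurableEquiv_toLp (Fin n)).symm
  exact ((MeasurePreserving.id (volume : Measure ℝ)).prod h3).comp (h2.comp h1)

theorem measurePreserving_slicePoint :
    MeasurePreserving (fun z : ℝ × Euc n => slicePoint z.1 z.2)
      ((volume : Measure ℝ).prod volume) volume := by
  have := (measurePreserving_sliceEquiv (n := n)).symm
  rwa [show ⇑(sliceEquiv n).symm = fun z : ℝ × Euc n => slicePoint z.1 z.2 from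
    funext sliceEquiv_symm_apply] at this

theorem measurableEmbedding_slicePoint :
    MeasurableEmbedding (fun z : ℝ × Euc n => slicePoint z.1 z.2) := by
  have := (sliceEquiv n).symm.measurableEmbedding
  rwa [show ⇑(sliceEquiv n).symm = fun z : ℝ × Euc n => slicePoint z.1 z.2 from
    funext sliceEquiv_symm_apply] at this

theorem slicePoint_eq_add (t : ℝ) (x' : Euc n) :
    slicePoint t x' = boundaryPoint x' + t • unitVec (Fin.last n) := by
  ext i
  induction i using Fin.lastCases with
  | last => simp [← slicePoint_zero]
  | cast i => simp [← slicePoint_zero]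

theorem norm_slicePoint_sq (t : ℝ) (x' : Euc n) : ‖slicePoint t x'‖ ^ 2 = ‖x'‖ ^ 2 + t ^ 2 := by
  rw [EuclideanSpace.norm_sq_eq, EuclideanSpace.norm_sq_eq, Fin.sum_univ_castSucc]
  simp

theorem norm_le_norm_slicePoint (t : ℝ) (x' : Euc n) : ‖x'‖ ≤ ‖slicePoint t x'‖ := by
  refine le_of_sq_le_sq ?_ (norm_nonneg _)
  rw [norm_slicePoint_sq]; nlinarith [sq_nonneg t]

theorem isometry_boundaryPoint : Isometry (boundaryPoint : Euc n → Euc (n + 1)) := by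
  refine Isometry.of_dist_eq fun x y => ?_
  have h : boundaryPoint x - boundaryPoint y = boundaryPoint (x - y) := by
    ext i
    induction i using Fin.lastCases with
    | last => simp [← slicePoint_zero]
    | cast i => simp [← slicePoint_zero]
  rw [dist_eq_norm, dist_eq_norm, h, ← sq_eq_sq₀ (norm_nonneg _) (norm_nonneg _),
    ← slicePoint_zero, norm_slicePoint_sq]
  simp

theorem hasDerivAt_slicePoint {F : Type*} [NormedAddCommGroup F] [NormedSpace ℝ F]
    {f : Euc (n + 1) → F} (hf : Differentiable ℝ f) (x' : Euc n) (t : ℝ) :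
    HasDerivAt (fun t => f (slicePoint t x')) (partialDeriv (Fin.last n) f (slicePoint t x')) t := by
  have h1 : HasDerivAt (fun t : ℝ => slicePoint t x') (unitVec (Fin.last n)) t := by
    simp only [slicePoint_eq_add]
    simpa using ((hasDerivAt_id t).smul_const (unitVec (Fin.last n))).const_add (boundaryPoint x')
  exact (hf _).hasFDerivAt.comp_hasDerivAt t h1

/-- Fubini's theorem, and the fundamental theorem of calculus on each ray `t ↦ (x', t)`, `t > 0`. -/
theorem setIntegral_partialDeriv_last {F : Type*} [NormedAddCommGroup F] [NormedSpace ℝ F]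
    [CompleteSpace F] {f : Euc (n + 1) → F} (hf : ContDiff ℝ ∞ f) (hc : HasCompactSupport f) :
    ∫ x in upperHalfSpace n, partialDeriv (Fin.last n) f x = -∫ x', f (boundaryPoint x') := by
  have hint : Integrable (partialDeriv (Fin.last n) f) :=
    (hf.partialDeriv _).continuous.integrable_of_hasCompactSupport (hc.partialDeriv _)
  have hint2 := hint.indicator (measurableSet_upperHalfSpace (n := n))
  rw [← integral_indicator measurableSet_upperHalfSpace,
    ← measurePreserving_slicePoint.integral_comp measurableEmbedding_slicePoint]
  have hint3 := (measurePreserving_slicePoint.integrable_comp_emb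
    measurableEmbedding_slicePoint).2 hint2
  have hint4 := integral_prod_symm _ hint3
  simp only [Function.comp_apply] at hint4
  rw [hint4, ← integral_neg]
  refine integral_congr_ae (Eventually.of_forall fun x' => ?_)
  have h1 : ∀ t, (upperHalfSpace n).indicator (partialDeriv (Fin.last n) f) (slicePoint t x') =
      (Set.Ioi (0 : ℝ)).indicator (fun t => deriv (fun t => f (slicePoint t x')) t) t := by
    intro t
    have hd := (hasDerivAt_slicePoint (hf.differentiable (by simp)) x' t).deriv
    by_cases ht : 0 < t
    · rw [Set.indicator_of_mem (by simpa [mem_upperHalfSpace] using ht),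
        Set.indicator_of_mem (by simpa using ht), hd]
    · rw [Set.indicator_of_notMem (by simpa [mem_upperHalfSpace] using ht),
        Set.indicator_of_notMem (by simpa using ht)]
  simp only [h1]
  rw [integral_indicator measurableSet_Ioi]
  have hsm : ContDiff ℝ 1 fun t => slicePoint t x' := by
    simp only [slicePoint_eq_add]
    exact contDiff_const.add (contDiff_id.smul contDiff_const)
  have hcl : Topology.IsClosedEmbedding fun t => slicePoint t x' := by
    refine Isometry.isClosedEmbedding (Isometry.of_dist_eq fun s t => ?_)
    simp only [slicePoint_eq_add, dist_add_left]
    rw [dist_eq_norm, ← sub_smul, norm_smul]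
    simp [Real.dist_eq]
  exact HasCompactSupport.integral_Ioi_deriv_eq ((hf.of_le (by simp)).comp hsm)
    (hc.comp_isClosedEmbedding hcl) 0

end Slices

/-! ### From the Neumann trace to integration by parts without a boundary term. -/

section NeumannTrace

variable {𝕜 : Type*} [RCLike 𝕜] {n : ℕ}

theorem enorm_integral_smul_le {α : Type*} [MeasurableSpace α] {μ : Measure α} {q q' : ℝ}
    (hq : q'.HolderConjugate q) {ψ : α → ℝ} {f : α → 𝕜} (hψ : AEStronglyMeasurable ψ μ)
    (hf : AEStronglyMeasurable f μ) :
    ‖∫ x, ψ x • f x ∂μ‖ₑ ≤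
      eLpNorm ψ (ENNReal.ofReal q') μ * eLpNorm f (ENNReal.ofReal q) μ := by
  refine (enorm_integral_le_lintegral_enorm _).trans ?_
  rw [eLpNorm_ofReal_eq hq.pos, eLpNorm_ofReal_eq hq.symm.pos]
  simp only [enorm_smul]
  exact ENNReal.lintegral_mul_le_Lp_mul_Lq μ hq hψ.enorm hf.enorm

/-- Hölder's inequality against a fixed test function. It is used both on the half space and on its
boundary. -/
theorem tendsto_integral_smul_zero {X : Type*} [TopologicalSpace X] [MeasurableSpace X]
    [BorelSpace X] [T2Space X] [SecondCountableTopologyEither X ℝ]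
    {μ : Measure X} [IsFiniteMeasureOnCompacts μ] {q : ℝ}
    (hq : 1 < q) {ψ : X → ℝ} (hψ : Continuous ψ) (hc : HasCompactSupport ψ) {f : ℕ → X → 𝕜}
    (hf : ∀ j, AEStronglyMeasurable (f j) μ)
    (h0 : Tendsto (fun j => eLpNorm (f j) (ENNReal.ofReal q) μ) atTop (𝓝 0)) :
    Tendsto (fun j => ∫ x, ψ x • f j x ∂μ) atTop (𝓝 0) := by
  have hq' := (Real.HolderConjugate.conjExponent hq).symm
  have hm : eLpNorm ψ (ENNReal.ofReal q.conjExponent) μ ≠ ⊤ :=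
    (hψ.memLp_of_hasCompactSupport hc).eLpNorm_ne_top
  rw [tendsto_iff_enorm_sub_tendsto_zero]
  simp only [sub_zero]
  refine tendsto_of_tendsto_of_tendsto_of_le_of_le tendsto_const_nhds
    (?_ : Tendsto (fun j => eLpNorm ψ (ENNReal.ofReal q.conjExponent) μ *
      eLpNorm (f j) (ENNReal.ofReal q) μ) atTop (𝓝 0)) (fun _ => zero_le) fun j =>
      enorm_integral_smul_le hq' hψ.aestronglyMeasurable (hf j)
  simpa using ENNReal.Tendsto.const_mul h0 (Or.inr hm)

theorem exists_le_normOn_add {d : ℕ} (N : (Euc d → 𝕜) → ℝ≥0∞) (Ω : Set (Euc d))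
    (u : Euc d → 𝕜) {ε : ℝ≥0∞} (hε : ε ≠ 0) :
    ∃ U : Euc d → 𝕜, U =ᵐ[volume.restrict Ω] u ∧ N U ≤ normOn N Ω u + ε := by
  by_cases hN : normOn N Ω u = ⊤
  · exact ⟨u, ae_eq_refl _, by simp [hN]⟩
  · have h1 : normOn N Ω u < normOn N Ω u + ε := ENNReal.lt_add_right hN hε
    obtain ⟨U, hU⟩ := iInf_lt_iff.1 h1
    obtain ⟨hU1, hU2⟩ := iInf_lt_iff.1 hU
    exact ⟨U, hU1, hU2.le⟩

/-- The approximation of a function with vanishing Neumann trace by test functions, in terms of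
extensions of the differences to the full space. -/
theorem HasNeumannTrace.exists_seq {N : (Euc (n + 1) → 𝕜) → ℝ≥0∞} {q : ℝ}
    {u U : Euc (n + 1) → 𝕜} (hu : HasNeumannTrace N q u 0)
    (hU : U =ᵐ[volume.restrict (upperHalfSpace n)] u) :
    ∃ φ V : ℕ → Euc (n + 1) → 𝕜, (∀ j, ContDiff ℝ ∞ (φ j)) ∧ (∀ j, HasCompactSupport (φ j)) ∧
      (∀ j, V j =ᵐ[volume.restrict (upperHalfSpace n)] φ j - U) ∧ (∀ j, N (V j) < ⊤) ∧
      Tendsto (fun j => N (V j)) atTop (𝓝 0) ∧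
      Tendsto (fun j => eLpNorm (fun x' => partialDeriv (Fin.last n) (φ j) (boundaryPoint x'))
        (ENNReal.ofReal q) volume) atTop (𝓝 0) := by
  obtain ⟨φ, h1, h2, h3⟩ := hu
  -- The infimum in `normOn` need not be attained, so an extension is chosen that is optimal up to
  -- `1 / (j + 1)`.
  have h4 : ∀ j : ℕ, ∃ V : Euc (n + 1) → 𝕜,
      V =ᵐ[volume.restrict (upperHalfSpace n)] φ j - U ∧
      N V ≤ normOn N (upperHalfSpace n) (φ j - u) + ((j : ℝ≥0∞) + 1)⁻¹ := by
    intro j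
    obtain ⟨V, hV, hV'⟩ := exists_le_normOn_add N (upperHalfSpace n) (φ j - u)
      (ε := ((j : ℝ≥0∞) + 1)⁻¹) (by simp)
    exact ⟨V, hV.trans ((ae_eq_refl _).sub hU.symm), hV'⟩
  choose V hV hV' using h4
  have h5 : Tendsto (fun j => N (V j)) atTop (𝓝 0) := by
    refine tendsto_of_tendsto_of_tendsto_of_le_of_le tendsto_const_nhds ?_
      (fun _ => zero_le) hV'
    have h6 : Tendsto (fun j : ℕ => ((j : ℝ≥0∞) + 1)⁻¹) atTop (𝓝 0) := by
      have := (tendsto_add_atTop_iff_nat 1).2 ENNReal.tendsto_inv_nat_nhds_zero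
      simpa using this
    simpa using h2.add h6
  -- The first `J` terms are dropped so that every `V j` has finite norm, hence weak derivatives.
  obtain ⟨J, hJ⟩ := eventually_atTop.1 (h5.eventually_lt_const (by simp : (0 : ℝ≥0∞) < ⊤))
  refine ⟨fun j => φ (j + J), fun j => V (j + J), fun j => (h1 _).1, fun j => (h1 _).2,
    fun j => hV _, fun j => hJ _ (by omega), (tendsto_add_atTop_iff_nat J).2 h5, ?_⟩
  have := (tendsto_add_atTop_iff_nat J).2 h3
  simp only [sub_zero] at this
  exact this

theorem isWeakDeriv_snoc_partialDeriv {φ : Euc (n + 1) → 𝕜} (hφ : ContDiff ℝ ∞ φ)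
    (hc : HasCompactSupport φ) (i j : Fin (n + 1)) :
    IsWeakDeriv (Fin.snoc ![i] j : Fin 2 → Fin (n + 1)) φ (partialDeriv j (partialDeriv i φ)) :=
  (isWeakDeriv_partialDeriv hφ hc i).snoc_iff.2
    (isWeakDeriv_partialDeriv (hφ.partialDeriv i) (hc.partialDeriv i) j)

/-- If `U` is approximated by test functions in `W^2_q` of the half space whose normal derivatives
on the boundary tend to zero, then `∂_n U` vanishes on the boundary. -/
theorem vanishesOnBoundary_of_tendsto {q : ℝ} (hq : 1 < q) {U : Euc (n + 1) → 𝕜}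
    {φ V : ℕ → Euc (n + 1) → 𝕜} (hφ : ∀ j, ContDiff ℝ ∞ (φ j))
    (hc : ∀ j, HasCompactSupport (φ j))
    (hVU : ∀ j, V j =ᵐ[volume.restrict (upperHalfSpace n)] φ j - U)
    (hU : HasWeakDerivs 2 U) (hV : ∀ j, HasWeakDerivs 2 (V j))
    (hV0 : ∀ m ≤ 2, ∀ ι : Fin m → Fin (n + 1),
      Tendsto (fun j => eLpNorm (weakDeriv ι (V j)) (ENNReal.ofReal q) volume) atTop (𝓝 0))
    (htr : Tendsto (fun j => eLpNorm (fun x' => partialDeriv (Fin.last n) (φ j) (boundaryPoint x'))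
        (ENNReal.ofReal q) volume) atTop (𝓝 0)) :
    VanishesOnBoundary (weakDeriv ![Fin.last n] U)
      (weakDeriv (Fin.snoc ![Fin.last n] (Fin.last n) : Fin 2 → Fin (n + 1)) U) := by
  intro ψ hψ hcψ
  set e := Fin.last n
  -- Weak derivatives are local, so on the half space those of `U` are those of `φ j` minus those of
  -- `V j`, and the latter tend to zero in `L_q`.
  have split : ∀ {m : ℕ} (hm : m ≤ 2) (ι : Fin m → Fin (n + 1)) (j : ℕ) (g : Euc (n + 1) → 𝕜),
      IsWeakDeriv ι (φ j) g → ∀ θ : Euc (n + 1) → ℝ, Continuous θ → HasCompactSupport θ →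
      ∫ x in upperHalfSpace n, θ x • weakDeriv ι U x =
        (∫ x in upperHalfSpace n, θ x • g x) -
          ∫ x in upperHalfSpace n, θ x • weakDeriv ι (V j) x := by
    intro m hm ι j g hg θ hθ hcθ
    have h1 := ((hV j).isWeakDeriv hm ι).ae_eq_of_isOpen isOpen_upperHalfSpace
      (hg.sub (hU.isWeakDeriv hm ι)) (hVU j)
    rw [← integral_sub
      (hg.2.1.integrable_smul_left_of_hasCompactSupport hθ hcθ).integrableOn
      (((hV j).isWeakDeriv hm ι).2.1.integrable_smul_left_of_hasCompactSupport hθ hcθ).integrableOn]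
    refine integral_congr_ae ?_
    filter_upwards [h1] with x hx
    rw [hx, Pi.sub_apply, smul_sub, sub_sub_cancel]
  have lim : ∀ {m : ℕ} (hm : m ≤ 2) (ι : Fin m → Fin (n + 1)) (θ : Euc (n + 1) → ℝ),
      Continuous θ → HasCompactSupport θ →
      Tendsto (fun j => ∫ x in upperHalfSpace n, θ x • weakDeriv ι (V j) x) atTop (𝓝 0) := by
    intro m hm ι θ hθ hcθ
    refine tendsto_integral_smul_zero hq hθ hcθ
      (fun j => ((hV j).isWeakDeriv hm ι).2.1.aestronglyMeasurable.restrict) ?_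
    exact tendsto_of_tendsto_of_tendsto_of_le_of_le tendsto_const_nhds (hV0 m hm ι)
      (fun _ => zero_le) fun j => eLpNorm_mono_measure _ Measure.restrict_le_self
  -- The classical formula for the smooth `φ j`: integrate the normal derivative of `ψ ∂_n (φ j)`.
  -- The boundary term tends to zero because the Neumann traces do.
  have bdry : ∀ j, (∫ x in upperHalfSpace n, partialDeriv e ψ x • partialDeriv e (φ j) x) +
      ∫ x in upperHalfSpace n, ψ x • partialDeriv e (partialDeriv e (φ j)) x =
      -∫ x', ψ (boundaryPoint x') • partialDeriv e (φ j) (boundaryPoint x') := by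
    intro j
    have hs : ContDiff ℝ ∞ fun x => ψ x • partialDeriv e (φ j) x := hψ.smul ((hφ j).partialDeriv e)
    have hcs : HasCompactSupport fun x => ψ x • partialDeriv e (φ j) x := hcψ.smul_right
    rw [← setIntegral_partialDeriv_last hs hcs, ← integral_add]
    · refine integral_congr_ae (Eventually.of_forall fun x => ?_)
      have h1 := hψ.differentiable (by simp) x
      have h2 := ((hφ j).partialDeriv e).differentiable (by simp) x
      change _ = fderiv ℝ (fun x => ψ x • partialDeriv e (φ j) x) x (unitVec e)
      rw [fderiv_fun_smul h1 h2]
      simp [partialDeriv, add_comm]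
    · exact (Continuous.integrable_of_hasCompactSupport
        ((hψ.partialDeriv e).continuous.smul ((hφ j).partialDeriv e).continuous)
        (hcψ.partialDeriv e).smul_right).integrableOn
    · exact (Continuous.integrable_of_hasCompactSupport
        (hψ.continuous.smul (((hφ j).partialDeriv e).partialDeriv e).continuous)
        hcψ.smul_right).integrableOn
  have lim3 : Tendsto (fun j => ∫ x', ψ (boundaryPoint x') •
      partialDeriv e (φ j) (boundaryPoint x')) atTop (𝓝 0) :=
    tendsto_integral_smul_zero hq (hψ.continuous.comp isometry_boundaryPoint.continuous)
      (hcψ.comp_isClosedEmbedding isometry_boundaryPoint.isClosedEmbedding)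
      (fun j => (((hφ j).partialDeriv e).continuous.comp
        isometry_boundaryPoint.continuous).aestronglyMeasurable) htr
  have lim1 := lim (by norm_num) ![e] (partialDeriv e ψ) (hψ.partialDeriv e).continuous
    (hcψ.partialDeriv e)
  have lim2 := lim le_rfl (Fin.snoc ![e] e : Fin 2 → Fin (n + 1)) ψ hψ.continuous hcψ
  have s1 := fun j => split (by norm_num) ![e] j _ (isWeakDeriv_partialDeriv (hφ j) (hc j) e)
    (partialDeriv e ψ) (hψ.partialDeriv e).continuous (hcψ.partialDeriv e)
  have s2 := fun j => split le_rfl (Fin.snoc ![e] e : Fin 2 → Fin (n + 1)) j _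
    (isWeakDeriv_snoc_partialDeriv (hφ j) (hc j) e e) ψ hψ.continuous hcψ
  rw [← add_eq_zero_iff_eq_neg]
  refine tendsto_nhds_unique (a := (∫ x in upperHalfSpace n, partialDeriv e ψ x • weakDeriv ![e] U x) +
      ∫ x in upperHalfSpace n, ψ x • weakDeriv (Fin.snoc ![e] e : Fin 2 → Fin (n + 1)) U x)
    (tendsto_const_nhds (f := (atTop : Filter ℕ))) ?_
  have h := (lim3.neg.sub lim1).sub lim2
  simp only [neg_zero, sub_zero] at h
  refine h.congr fun j => ?_
  rw [s1 j, s2 j, ← bdry j]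
  abel

end NeumannTrace

/-! ### Power weights, scaling, and the layer cake formula. -/

section LintegralTools

theorem lintegral_Ioi_rpow {a s : ℝ} (ha : 0 < a) (hs : 0 < s) :
    ∫⁻ r in Set.Ioi a, ENNReal.ofReal (r ^ (-s - 1)) = ENNReal.ofReal (a ^ (-s) / s) := by
  rw [← ofReal_integral_eq_lintegral_ofReal (integrableOn_Ioi_rpow_of_lt (by linarith) ha),
    integral_Ioi_rpow_of_lt (by linarith) ha]
  · congr 1
    rw [sub_add_cancel, neg_div_neg_eq]
  · filter_upwards [ae_restrict_mem measurableSet_Ioi] with r hr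
    exact Real.rpow_nonneg (ha.trans hr).le _

theorem lintegral_Ioi_comp_mul_left (F : ℝ → ℝ≥0∞) {c : ℝ} (hc : 0 < c) (a : ℝ) :
    ∫⁻ r in Set.Ioi a, F (c * r) = ENNReal.ofReal c⁻¹ * ∫⁻ r in Set.Ioi (c * a), F r := by
  have he : MeasurableEmbedding fun r : ℝ => c * r :=
    (Homeomorph.mulLeft₀ c hc.ne').measurableEmbedding
  have h1 : (volume : Measure ℝ).map (fun r => c * r) = ENNReal.ofReal c⁻¹ • volume := by
    rw [Real.map_volume_mul_left hc.ne', abs_of_pos (inv_pos.2 hc)]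
  have h2 : Set.Ioi a = (fun r => c * r) ⁻¹' Set.Ioi (c * a) := by
    ext r; exact (mul_lt_mul_iff_right₀ hc).symm
  rw [h2, ← he.lintegral_map (μ := volume.restrict _) (f := F), ← he.restrict_map, h1,
    Measure.restrict_smul, lintegral_smul_measure, smul_eq_mul]

theorem lintegral_Ioi_rpow_mul_comp_mul_left (F : ℝ → ℝ≥0∞) {c : ℝ} (hc : 0 < c) {a : ℝ}
    (ha : 0 ≤ a) (s : ℝ) :
    ∫⁻ r in Set.Ioi a, ENNReal.ofReal (r ^ (-s - 1)) * F (c * r) =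
      ENNReal.ofReal (c ^ s) *
        ∫⁻ r in Set.Ioi (c * a), ENNReal.ofReal (r ^ (-s - 1)) * F r := by
  have h1 : ∫⁻ r in Set.Ioi a, ENNReal.ofReal (r ^ (-s - 1)) * F (c * r) =
      ENNReal.ofReal (c ^ (s + 1)) *
        ∫⁻ r in Set.Ioi a, ENNReal.ofReal ((c * r) ^ (-s - 1)) * F (c * r) := by
    rw [← lintegral_const_mul' _ _ ENNReal.ofReal_ne_top]
    refine setLIntegral_congr_fun measurableSet_Ioi fun r hr => ?_
    have hr' : 0 < r := lt_of_le_of_lt ha hr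
    rw [← mul_assoc, ← ENNReal.ofReal_mul (by positivity), Real.mul_rpow hc.le hr'.le,
      ← mul_assoc, ← Real.rpow_add hc]
    simp
  rw [h1, lintegral_Ioi_comp_mul_left (fun r => ENNReal.ofReal (r ^ (-s - 1)) * F r) hc,
    ← mul_assoc, ← ENNReal.ofReal_mul (by positivity), Real.rpow_add_one hc.ne']
  congr 2
  field_simp

/-- Hölder's inequality against the constant function one. -/
theorem lintegral_rpow_le_measure_mul {α : Type*} [MeasurableSpace α] {μ : Measure α} {θ : ℝ}
    (hθ : 1 ≤ θ) {f : α → ℝ≥0∞} (hf : AEMeasurable f μ) :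
    (∫⁻ x, f x ∂μ) ^ θ ≤ μ Set.univ ^ (θ - 1) * ∫⁻ x, f x ^ θ ∂μ := by
  rcases hθ.eq_or_lt with rfl | hθ1
  · simp
  have hpq := Real.HolderConjugate.conjExponent hθ1
  have h := ENNReal.lintegral_mul_le_Lp_mul_Lq μ hpq hf (aemeasurable_const (b := (1 : ℝ≥0∞)))
  simp only [Pi.mul_apply, mul_one, ENNReal.one_rpow, lintegral_const, one_mul] at h
  calc (∫⁻ x, f x ∂μ) ^ θ
      ≤ ((∫⁻ x, f x ^ θ ∂μ) ^ (1 / θ) * μ Set.univ ^ (1 / θ.conjExponent)) ^ θ := by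
        gcongr
    _ = μ Set.univ ^ (θ - 1) * ∫⁻ x, f x ^ θ ∂μ := by
        rw [ENNReal.mul_rpow_of_nonneg _ _ (by positivity), ← ENNReal.rpow_mul,
          ← ENNReal.rpow_mul, one_div_mul_cancel (by positivity), ENNReal.rpow_one, mul_comm]
        congr 2
        have := hpq.symm.one_sub_inv
        have h2 : (1 : ℝ) / θ.conjExponent = 1 - θ⁻¹ := by
          rw [one_div]; linarith [hpq.inv_add_inv_eq_one]
        rw [h2]; field_simp

/-- The layer cake formula. -/
theorem lintegral_mul_lintegral_setOf_lt {α : Type*} [MeasurableSpace α] {μ : Measure α}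
    [SFinite μ] {w : ℝ → ℝ≥0∞} (hw : Measurable w) {ρ : α → ℝ} (hρ : Measurable ρ)
    (hρ0 : ∀ z, 0 ≤ ρ z) {f : α → ℝ≥0∞} (hf : Measurable f) :
    ∫⁻ r in Set.Ioi 0, w r * ∫⁻ z in {z | ρ z < r}, f z ∂μ =
      ∫⁻ z, f z * (∫⁻ r in Set.Ioi (ρ z), w r) ∂μ := by
  have hm : MeasurableSet {y : ℝ × α | ρ y.2 < y.1} :=
    measurableSet_lt (hρ.comp measurable_snd) measurable_fst
  have e1 : ∀ r, w r * ∫⁻ z in {z | ρ z < r}, f z ∂μ =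
      ∫⁻ z, {y : ℝ × α | ρ y.2 < y.1}.indicator (fun y => w y.1 * f y.2) (r, z) ∂μ := by
    intro r
    have hr : MeasurableSet {z | ρ z < r} := hρ measurableSet_Iio
    rw [← lintegral_const_mul _ hf, ← lintegral_indicator hr]
    rfl
  simp only [e1]
  rw [lintegral_lintegral_swap]
  · refine lintegral_congr fun z => ?_
    have e2 : ∀ r, {y : ℝ × α | ρ y.2 < y.1}.indicator (fun y => w y.1 * f y.2) (r, z) =
        (Set.Ioi (ρ z)).indicator (fun r => f z * w r) r := by
      intro r
      simp only [Set.indicator, Set.mem_ofPred_eq, Set.mem_Ioi, mul_comm]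
    simp only [e2]
    rw [lintegral_indicator measurableSet_Ioi, Measure.restrict_restrict measurableSet_Ioi,
      Set.inter_eq_left.2 (Set.Ioi_subset_Ioi (hρ0 z)), lintegral_const_mul _ hw]
  · exact (((hw.comp measurable_fst).mul (hf.comp measurable_snd)).indicator hm).aemeasurable

end LintegralTools

/-! ### Slobodeckij and Besov seminorms as radial averages. -/

section AveragedDifferences

variable {𝕜 : Type*} [RCLike 𝕜] {d : ℕ}

/-- The integral of `|g x - g y|^q` over all pairs of points of `Ω` of distance less than `r`. -/
def localDiff (q : ℝ) (Ω : Set (Euc d)) (g : Euc d → 𝕜) (r : ℝ) : ℝ≥0∞ :=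
  ∫⁻ x in Ω, ∫⁻ y in Ω, if ‖x - y‖ < r then ‖g x - g y‖ₑ ^ q else 0

theorem localDiff_mono_radius (q : ℝ) (Ω : Set (Euc d)) (g : Euc d → 𝕜) :
    Monotone (localDiff q Ω g) := by
  intro r r' h
  refine lintegral_mono fun x => lintegral_mono fun y => ?_
  by_cases h1 : ‖x - y‖ < r
  · simp [h1, h1.trans_le h]
  · simp [h1]

theorem localDiff_mono_set (q : ℝ) {Ω Ω' : Set (Euc d)} (h : Ω ⊆ Ω') (g : Euc d → 𝕜) (r : ℝ) :
    localDiff q Ω g r ≤ localDiff q Ω' g r :=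
  (lintegral_mono fun _ => lintegral_mono_set h).trans (lintegral_mono_set h)

theorem measurable_localDiff (q : ℝ) (Ω : Set (Euc d)) (g : Euc d → 𝕜) :
    Measurable (localDiff q Ω g) :=
  (localDiff_mono_radius q Ω g).measurable

theorem measurable_enorm_sub_rpow {g : Euc d → 𝕜} (hg : Measurable g) (q : ℝ) :
    Measurable fun z : Euc d × Euc d => ‖g z.1 - g z.2‖ₑ ^ q :=
  (((hg.comp measurable_fst).sub (hg.comp measurable_snd)).enorm).pow_const q

theorem measurable_localDiff_integrand {g : Euc d → 𝕜} (hg : Measurable g) (q r : ℝ) :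
    Measurable fun z : Euc d × Euc d =>
      if ‖z.1 - z.2‖ < r then ‖g z.1 - g z.2‖ₑ ^ q else (0 : ℝ≥0∞) :=
  Measurable.ite (measurableSet_lt (measurable_fst.sub measurable_snd).norm measurable_const)
    (measurable_enorm_sub_rpow hg q) measurable_const

theorem localDiff_eq_lintegral_prod {g : Euc d → 𝕜} (hg : Measurable g) (q : ℝ)
    (Ω : Set (Euc d)) (r : ℝ) :
    localDiff q Ω g r = ∫⁻ z in {z : Euc d × Euc d | ‖z.1 - z.2‖ < r}, ‖g z.1 - g z.2‖ₑ ^ q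
      ∂((volume.restrict Ω).prod (volume.restrict Ω)) := by
  have hm : MeasurableSet {z : Euc d × Euc d | ‖z.1 - z.2‖ < r} :=
    measurableSet_lt (measurable_fst.sub measurable_snd).norm measurable_const
  rw [← lintegral_indicator hm, lintegral_prod _
    ((measurable_enorm_sub_rpow hg q).indicator hm).aemeasurable]
  rfl

/-- A seminorm (to the power `p`) of Besov type, on an arbitrary set. -/
def averagedBesov (σ q p : ℝ) (Ω : Set (Euc d)) (g : Euc d → 𝕜) : ℝ≥0∞ :=
  ∫⁻ r in Set.Ioi 0, ENNReal.ofReal (r ^ (-(σ * p + d * (p / q)) - 1)) *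
    localDiff q Ω g r ^ (p / q)

theorem averagedBesov_mono_set {σ q p : ℝ} (hp : 0 ≤ p / q) {Ω Ω' : Set (Euc d)} (h : Ω ⊆ Ω')
    (g : Euc d → 𝕜) : averagedBesov σ q p Ω g ≤ averagedBesov σ q p Ω' g := by
  refine lintegral_mono fun r => ?_
  gcongr
  exact localDiff_mono_set q h g r

theorem enorm_rpow_eq_ofReal {E : Type*} [NormedAddCommGroup E] (x : E) {a : ℝ} (ha : 0 ≤ a) :
    ‖x‖ₑ ^ a = ENNReal.ofReal (‖x‖ ^ a) := by
  rw [← ofReal_norm, ENNReal.ofReal_rpow_of_nonneg (norm_nonneg _) ha]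

/-- The layer cake formula with `ρ = |x - y|`: integrating `r^(-(d + σ q) - 1)` over `r > ρ` returns
the kernel `ρ^(-(d + σ q))` divided by `d + σ q`. For `p = q` the radial average is thus the
seminorm itself, up to this factor. -/
theorem slobodeckijSeminorm_eq {σ q : ℝ} (hσ : 0 < σ) (hq : 0 < q) {g : Euc d → 𝕜}
    (hg : Measurable g) :
    slobodeckijSeminorm σ q g =
      (ENNReal.ofReal (d + σ * q) * averagedBesov σ q q Set.univ g) ^ (1 / q) := by
  unfold slobodeckijSeminorm averagedBesov
  congr 1
  have ha : 0 < d + σ * q := by positivity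
  rw [div_self hq.ne', mul_one, add_comm (σ * q)]
  simp only [ENNReal.rpow_one, localDiff_eq_lintegral_prod hg, Measure.restrict_univ]
  have hρ : Measurable fun z : Euc d × Euc d => ‖z.1 - z.2‖ :=
    (measurable_fst.sub measurable_snd).norm
  rw [lintegral_mul_lintegral_setOf_lt (by fun_prop) hρ (fun _ => norm_nonneg _)
    (measurable_enorm_sub_rpow hg q)]
  have hm : Measurable fun a : ℝ => ∫⁻ r in Set.Ioi a, ENNReal.ofReal (r ^ (-(d + σ * q) - 1)) :=
    Antitone.measurable fun a b hab => lintegral_mono_set (Set.Ioi_subset_Ioi hab)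
  have hm2 : Measurable fun z : Euc d × Euc d => ‖g z.1 - g z.2‖ₑ ^ q *
      ∫⁻ r in Set.Ioi ‖z.1 - z.2‖, ENNReal.ofReal (r ^ (-(d + σ * q) - 1)) :=
    (measurable_enorm_sub_rpow hg q).mul (hm.comp hρ)
  rw [lintegral_prod _ hm2.aemeasurable, ← lintegral_const_mul' _ _ ENNReal.ofReal_ne_top]
  refine lintegral_congr fun x => ?_
  rw [← lintegral_const_mul' _ _ ENNReal.ofReal_ne_top]
  refine lintegral_congr fun y => ?_
  -- On the diagonal the kernel is singular, but the difference is zero and both sides are zero by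
  -- the convention `0 * ⊤ = 0`.
  by_cases hxy : x = y
  · simp [hxy, hq]
  · have h0 : 0 < ‖x - y‖ := norm_pos_iff.2 (sub_ne_zero.2 hxy)
    simp only
    rw [lintegral_Ioi_rpow h0 ha, enorm_rpow_eq_ofReal (x - y) ha.le, div_eq_mul_inv,
      ← ENNReal.ofReal_inv_of_pos (by positivity), mul_left_comm,
      ← ENNReal.ofReal_mul ha.le, Real.rpow_neg h0.le]
    congr 2
    field_simp

/-- The `q`-th power of the `L_q` norm of the difference `g (· + h) - g`. -/
def translationDiff (q : ℝ) (g : Euc d → 𝕜) (h : Euc d) : ℝ≥0∞ :=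
  ∫⁻ x, ‖g (x + h) - g x‖ₑ ^ q

theorem measurable_translationDiff {g : Euc d → 𝕜} (hg : Measurable g) (q : ℝ) :
    Measurable (translationDiff q g) := by
  refine Measurable.lintegral_prod_right' (f := fun z : Euc d × Euc d =>
    ‖g (z.2 + z.1) - g z.2‖ₑ ^ q) ?_
  exact (((hg.comp (measurable_snd.add measurable_fst)).sub (hg.comp measurable_snd)).enorm).pow_const q

theorem besovSeminorm_eq {σ q p : ℝ} (hσ : 0 < σ) (hσ1 : σ < 1) (hq : 0 < q) (hp : 0 < p)
    (g : Euc d → 𝕜) :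
    besovSeminorm σ q p g = (∫⁻ h : Euc d, translationDiff q g h ^ (p / q) *
      ENNReal.ofReal (‖h‖ ^ (-(σ * p + d)))) ^ (1 / p) := by
  unfold besovSeminorm
  congr 1
  refine lintegral_congr fun h => ?_
  -- As `σ < 1`, the seminorm is built from first differences.
  have hfl : ⌊σ⌋₊ = 0 := Nat.floor_eq_zero.2 hσ1
  have h1 : (fwdDiff h)^[⌊σ⌋₊ + 1] g = fun x => g (x + h) - g x := by
    rw [hfl]; rfl
  rw [h1, eLpNorm_ofReal_eq hq]
  change ((translationDiff q g h) ^ (1 / q) / _) ^ p / _ = _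
  by_cases hh : h = 0
  · have : translationDiff q g h = 0 := by simp [translationDiff, hh, hq]
    rw [this]
    simp [hq, hp, hh]
  have h0 : 0 < ‖h‖ := norm_pos_iff.2 hh
  rw [ENNReal.div_rpow_of_nonneg _ _ hp.le, ← ENNReal.rpow_mul, one_div_mul_eq_div,
    ← ENNReal.rpow_mul, enorm_rpow_eq_ofReal h (by positivity), enorm_rpow_eq_ofReal h (by positivity),
    div_eq_mul_inv, div_eq_mul_inv, ← ENNReal.ofReal_inv_of_pos (by positivity),
    ← ENNReal.ofReal_inv_of_pos (by positivity), mul_assoc, ← ENNReal.ofReal_mul (by positivity),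
    neg_add, Real.rpow_add h0, Real.rpow_neg h0.le, Real.rpow_neg h0.le]

/-- Substitute `y = x + h` and exchange the integrals. -/
theorem localDiff_univ_eq {g : Euc d → 𝕜} (hg : Measurable g) (q r : ℝ) :
    localDiff q Set.univ g r = ∫⁻ h in {h : Euc d | ‖h‖ < r}, translationDiff q g h := by
  unfold localDiff translationDiff
  simp only [Measure.restrict_univ]
  have e1 : ∀ x : Euc d, ∫⁻ y, (if ‖x - y‖ < r then ‖g x - g y‖ₑ ^ q else 0) =
      ∫⁻ h in {h : Euc d | ‖h‖ < r}, ‖g (x + h) - g x‖ₑ ^ q := by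
    intro x
    rw [← lintegral_add_left_eq_self _ x, ← lintegral_indicator
      (measurableSet_lt measurable_norm measurable_const)]
    refine lintegral_congr fun h => ?_
    simp only [Set.indicator, Set.mem_ofPred_eq, sub_add_cancel_left, norm_neg,
      ← enorm_neg (g x - g (x + h)), neg_sub]
  simp only [e1]
  rw [lintegral_lintegral_swap]
  exact ((((hg.comp (measurable_fst.add measurable_snd)).sub
    (hg.comp measurable_fst)).enorm).pow_const q).aemeasurable

theorem volume_setOf_norm_lt {r : ℝ} (hr : 0 < r) :
    volume {h : Euc d | ‖h‖ < r} = ENNReal.ofReal (r ^ (d : ℝ)) * volume (Metric.ball (0 : Euc d) 1) := by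
  have h1 : {h : Euc d | ‖h‖ < r} = Metric.ball 0 r := by ext; simp
  rw [h1, Measure.addHaar_ball_of_pos _ _ hr]
  simp

/-- `localDiff` is the integral of `translationDiff` over the ball `|h| < r`. Hölder's inequality
with exponent `p / q ≥ 1` moves the power inside, at the cost of a power of the volume of the ball,
and the layer cake formula evaluates the integral over `r`. -/
theorem averagedBesov_univ_le {σ q p : ℝ} (hσ : 0 < σ) (hq : 0 < q) (hqp : q ≤ p)
    {g : Euc d → 𝕜} (hg : Measurable g) :
    averagedBesov σ q p Set.univ g ≤
      (volume (Metric.ball (0 : Euc d) 1) ^ (p / q - 1) * ENNReal.ofReal (σ * p + d)⁻¹) *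
      ∫⁻ h : Euc d, translationDiff q g h ^ (p / q) * ENNReal.ofReal (‖h‖ ^ (-(σ * p + d))) := by
  have hp : 0 < p := hq.trans_le hqp
  have hθ : 1 ≤ p / q := (one_le_div hq).2 hqp
  set c := volume (Metric.ball (0 : Euc d) 1)
  have hc : c ≠ ⊤ := measure_ball_lt_top.ne
  have ha : 0 < σ * p + d := by positivity
  have step : averagedBesov σ q p Set.univ g ≤
      ∫⁻ r in Set.Ioi 0, (c ^ (p / q - 1) * ENNReal.ofReal (r ^ (-(σ * p + d) - 1))) *
        ∫⁻ h in {h : Euc d | ‖h‖ < r}, translationDiff q g h ^ (p / q) := by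
    unfold averagedBesov
    refine setLIntegral_mono' measurableSet_Ioi fun r hr => ?_
    have hr : 0 < r := hr
    rw [localDiff_univ_eq hg]
    refine (mul_le_mul_right (lintegral_rpow_le_measure_mul hθ
      (measurable_translationDiff hg q).aemeasurable) _).trans (le_of_eq ?_)
    rw [← mul_assoc, Measure.restrict_apply_univ, volume_setOf_norm_lt hr,
      ENNReal.mul_rpow_of_nonneg _ _ (by linarith),
      ENNReal.ofReal_rpow_of_nonneg (by positivity) (by linarith), ← mul_assoc,
      ← ENNReal.ofReal_mul (by positivity), ← Real.rpow_mul hr.le, ← Real.rpow_add hr, mul_comm _ (c ^ _)]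
    congr 4
    ring
  refine step.trans ?_
  rw [lintegral_mul_lintegral_setOf_lt (by fun_prop) measurable_norm (fun _ => norm_nonneg _)
    ((measurable_translationDiff hg q).pow_const _)]
  rw [← lintegral_const_mul' _ _ (ENNReal.mul_ne_top (ENNReal.rpow_ne_top_of_nonneg (by linarith) hc)
    ENNReal.ofReal_ne_top)]
  refine lintegral_mono fun h => ?_
  by_cases hh : h = 0
  · have h0 : translationDiff q g h = 0 := by simp [translationDiff, hh, hq]
    simp only [h0]
    rw [ENNReal.zero_rpow_of_pos (by positivity)]
    simp
  have h0 : 0 < ‖h‖ := norm_pos_iff.2 hh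
  rw [lintegral_const_mul' _ _ (ENNReal.rpow_ne_top_of_nonneg (by linarith) hc),
    lintegral_Ioi_rpow h0 ha, div_eq_mul_inv (‖h‖ ^ _), ENNReal.ofReal_mul (by positivity)]
  refine le_of_eq ?_
  ring

theorem add_rpow_le {q : ℝ} (hq : 1 ≤ q) (a b : ℝ≥0∞) :
    (a + b) ^ q ≤ 2 ^ q * (a ^ q + b ^ q) := by
  refine (ENNReal.rpow_add_le_mul_rpow_add_rpow a b hq).trans ?_
  gcongr
  · norm_num
  · linarith

theorem volume_setOf_norm_sub_lt (x : Euc d) (r : ℝ) :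
    volume {z : Euc d | ‖x - z‖ < r} = volume {z : Euc d | ‖z‖ < r} := by
  have e1 : {z : Euc d | ‖x - z‖ < r} = Metric.ball x r := by
    ext z; simp [dist_eq_norm, norm_sub_rev]
  have e2 : {z : Euc d | ‖z‖ < r} = Metric.ball 0 r := by ext z; simp
  rw [e1, e2, Measure.addHaar_ball_center]

/-- Insert an intermediate value `g z` into `g (x + h) - g x` and integrate over all `z` in the ball
of radius `r` about `x`. -/
theorem volume_mul_translationDiff_le {q : ℝ} (hq : 1 ≤ q) {g : Euc d → 𝕜} (hg : Measurable g)
    (h : Euc d) (r : ℝ) :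
    volume {z : Euc d | ‖z‖ < r} * translationDiff q g h ≤
      2 ^ q * ((∫⁻ x, ∫⁻ z, if ‖x - z‖ < r then ‖g (x + h) - g z‖ₑ ^ q else 0) +
        ∫⁻ x, ∫⁻ z, if ‖x - z‖ < r then ‖g x - g z‖ₑ ^ q else 0) := by
  have hS : ∀ x : Euc d, MeasurableSet {z : Euc d | ‖x - z‖ < r} := fun x =>
    measurableSet_lt (measurable_const.sub measurable_id).norm measurable_const
  have m1 : Measurable fun z : Euc d × Euc d =>
      if ‖z.1 - z.2‖ < r then ‖g (z.1 + h) - g z.2‖ₑ ^ q else 0 :=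
    Measurable.ite (measurableSet_lt (measurable_fst.sub measurable_snd).norm measurable_const)
      ((((hg.comp (measurable_fst.add_const h)).sub
        (hg.comp measurable_snd)).enorm).pow_const q) measurable_const
  have m3 : Measurable fun x => ‖g (x + h) - g x‖ₑ ^ q :=
    (((hg.comp (measurable_add_const h)).sub hg).enorm).pow_const q
  have m5 : Measurable fun x => ∫⁻ z, if ‖x - z‖ < r then ‖g (x + h) - g z‖ₑ ^ q else 0 :=
    Measurable.lintegral_prod_right' (f := fun z : Euc d × Euc d =>
      if ‖z.1 - z.2‖ < r then ‖g (z.1 + h) - g z.2‖ₑ ^ q else 0) m1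
  have h2q : (2 : ℝ≥0∞) ^ q ≠ ⊤ := ENNReal.rpow_ne_top_of_nonneg (by linarith) (by simp)
  have key : ∀ x, volume {z : Euc d | ‖z‖ < r} * ‖g (x + h) - g x‖ₑ ^ q ≤
      2 ^ q * ((∫⁻ z, if ‖x - z‖ < r then ‖g (x + h) - g z‖ₑ ^ q else 0) +
        ∫⁻ z, if ‖x - z‖ < r then ‖g x - g z‖ₑ ^ q else 0) := by
    intro x
    have m4 : Measurable fun z => if ‖x - z‖ < r then ‖g (x + h) - g z‖ₑ ^ q else 0 :=
      Measurable.ite (hS x) ((measurable_const.sub hg).enorm.pow_const q) measurable_const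
    have e1 : volume {z : Euc d | ‖z‖ < r} * ‖g (x + h) - g x‖ₑ ^ q =
        ∫⁻ z, {z : Euc d | ‖x - z‖ < r}.indicator (fun _ => ‖g (x + h) - g x‖ₑ ^ q) z := by
      rw [lintegral_indicator (hS x), setLIntegral_const, volume_setOf_norm_sub_lt, mul_comm]
    have e2 := lintegral_add_left (μ := volume) m4
      (fun z => if ‖x - z‖ < r then ‖g x - g z‖ₑ ^ q else 0)
    rw [e1, ← e2, ← lintegral_const_mul' _ _ h2q]
    refine lintegral_mono fun z => ?_
    by_cases hz : ‖x - z‖ < r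
    · simp only [Set.indicator, Set.mem_ofPred_eq, hz, if_true]
      refine le_trans ?_ (add_rpow_le hq _ _)
      gcongr
      have : g (x + h) - g x = (g (x + h) - g z) - (g x - g z) := by abel
      rw [this]
      exact enorm_sub_le
    · simp [hz]
  calc volume {z : Euc d | ‖z‖ < r} * translationDiff q g h
      = ∫⁻ x, volume {z : Euc d | ‖z‖ < r} * ‖g (x + h) - g x‖ₑ ^ q :=
        (lintegral_const_mul _ m3).symm
    _ ≤ ∫⁻ x, 2 ^ q * ((∫⁻ z, if ‖x - z‖ < r then ‖g (x + h) - g z‖ₑ ^ q else 0) +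
        ∫⁻ z, if ‖x - z‖ < r then ‖g x - g z‖ₑ ^ q else 0) := lintegral_mono key
    _ = 2 ^ q * ∫⁻ x, ((∫⁻ z, if ‖x - z‖ < r then ‖g (x + h) - g z‖ₑ ^ q else 0) +
        ∫⁻ z, if ‖x - z‖ < r then ‖g x - g z‖ₑ ^ q else 0) := lintegral_const_mul' _ _ h2q
    _ = _ := by rw [lintegral_add_left m5]

/-- With intermediate points `z` at distance less than `‖h‖` from `x`, both `x` and `x + h` are at
distance less than `2 ‖h‖` from `z`. A single translation is thereby controlled by an average over
pairs. -/
theorem translationDiff_mul_le {q : ℝ} (hq : 1 ≤ q) {g : Euc d → 𝕜} (hg : Measurable g)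
    (h : Euc d) :
    volume {z : Euc d | ‖z‖ < ‖h‖} * translationDiff q g h ≤
      2 ^ q * 2 * localDiff q Set.univ g (2 * ‖h‖) := by
  refine (volume_mul_translationDiff_le hq hg h ‖h‖).trans ?_
  have hA : ∫⁻ x, ∫⁻ z, (if ‖x - z‖ < ‖h‖ then ‖g (x + h) - g z‖ₑ ^ q else 0) ≤
      localDiff q Set.univ g (2 * ‖h‖) := by
    unfold localDiff
    simp only [Measure.restrict_univ]
    rw [← lintegral_add_right_eq_self (fun x => ∫⁻ y, if ‖x - y‖ < 2 * ‖h‖ then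
      ‖g x - g y‖ₑ ^ q else 0) h]
    refine lintegral_mono fun x => lintegral_mono fun z => ?_
    by_cases hz : ‖x - z‖ < ‖h‖
    · have : ‖x + h - z‖ < 2 * ‖h‖ := by
        calc ‖x + h - z‖ = ‖(x - z) + h‖ := by congr 1; abel
          _ ≤ ‖x - z‖ + ‖h‖ := norm_add_le _ _
          _ < 2 * ‖h‖ := by linarith
      simp [hz, this]
    · simp [hz]
  have hB : ∫⁻ x, ∫⁻ z, (if ‖x - z‖ < ‖h‖ then ‖g x - g z‖ₑ ^ q else 0) ≤
      localDiff q Set.univ g (2 * ‖h‖) := by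
    have := localDiff_mono_radius q Set.univ g (by linarith [norm_nonneg h] : ‖h‖ ≤ 2 * ‖h‖)
    simpa only [localDiff, Measure.restrict_univ] using this
  rw [mul_assoc, two_mul (localDiff q Set.univ g (2 * ‖h‖))]
  gcongr

theorem ennreal_le_inv_mul_of_mul_le {a b c : ℝ≥0∞} (hc : c ≠ 0) (hc' : c ≠ ⊤) (h : c * a ≤ b) :
    a ≤ c⁻¹ * b := by
  rw [← ENNReal.mul_le_mul_iff_right hc hc', ← mul_assoc, ENNReal.mul_inv_cancel hc hc', one_mul]
  exact h

/-- The Besov seminorm is bounded by the averaged one. -/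
theorem exists_lintegral_translationDiff_le (d : ℕ) {σ q p : ℝ} (hσ : 0 < σ) (hq : 1 ≤ q)
    (hp : 0 < p) : ∃ C : ℝ≥0∞, C ≠ ⊤ ∧ ∀ g : Euc d → 𝕜, Measurable g →
      ∫⁻ h : Euc d, translationDiff q g h ^ (p / q) * ENNReal.ofReal (‖h‖ ^ (-(σ * p + d))) ≤
        C * averagedBesov σ q p Set.univ g := by
  have hq0 : 0 < q := by linarith
  have hpq : 0 < p / q := by positivity
  set c := volume (Metric.ball (0 : Euc d) 1)
  have hc : c ≠ ⊤ := measure_ball_lt_top.ne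
  have hc0 : c ≠ 0 := (Metric.measure_ball_pos _ _ one_pos).ne'
  -- The last summand `d` exceeds the exponent in `averagedBesov`; the final integration over all
  -- `h` with `2 ‖h‖ < r` gives a factor `r^d` that compensates it.
  set s : ℝ := σ * p + d * (p / q) + d with hs
  have hs0 : 0 < s := by positivity
  set A : ℝ≥0∞ := (c⁻¹ * (2 ^ q * 2)) ^ (p / q) * ENNReal.ofReal (2 ^ s * s) with hA
  have hA' : A ≠ ⊤ := by
    refine ENNReal.mul_ne_top (ENNReal.rpow_ne_top_of_nonneg hpq.le ?_) ENNReal.ofReal_ne_top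
    exact ENNReal.mul_ne_top (ENNReal.inv_ne_top.2 hc0)
      (ENNReal.mul_ne_top (ENNReal.rpow_ne_top_of_nonneg hq0.le (by simp)) (by simp))
  refine ⟨A * (ENNReal.ofReal ((2⁻¹ : ℝ) ^ (d : ℝ)) * c), ENNReal.mul_ne_top hA'
    (ENNReal.mul_ne_top ENNReal.ofReal_ne_top hc), fun g hg => ?_⟩
  have hw : Measurable fun r : ℝ => ENNReal.ofReal (r ^ (-s - 1)) *
      localDiff q Set.univ g r ^ (p / q) :=
    (by fun_prop : Measurable fun r : ℝ => ENNReal.ofReal (r ^ (-s - 1))).mul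
      ((measurable_localDiff q _ g).pow_const _)
  have key : ∀ h : Euc d, translationDiff q g h ^ (p / q) *
      ENNReal.ofReal (‖h‖ ^ (-(σ * p + d))) ≤
      A * (1 * ∫⁻ r in Set.Ioi (2 * ‖h‖), ENNReal.ofReal (r ^ (-s - 1)) *
        localDiff q Set.univ g r ^ (p / q)) := by
    intro h
    by_cases hh : h = 0
    · have h0 : translationDiff q g h = 0 := by simp [translationDiff, hh, hq0]
      rw [h0, ENNReal.zero_rpow_of_pos hpq]
      simp
    have h0 : 0 < ‖h‖ := norm_pos_iff.2 hh
    -- Since `localDiff` increases with the radius, its value at `2 ‖h‖` is bounded by a weighted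
    -- average over larger radii.
    have h1 : ENNReal.ofReal ((2 * ‖h‖) ^ (-s) / s) * localDiff q Set.univ g (2 * ‖h‖) ^ (p / q) ≤
        ∫⁻ r in Set.Ioi (2 * ‖h‖), ENNReal.ofReal (r ^ (-s - 1)) *
          localDiff q Set.univ g r ^ (p / q) := by
      rw [← lintegral_Ioi_rpow (by positivity) hs0,
        ← lintegral_mul_const _ (by fun_prop)]
      refine setLIntegral_mono' measurableSet_Ioi fun r hr => ?_
      gcongr
      exact localDiff_mono_radius q _ g (le_of_lt hr)
    have h2 := ennreal_le_inv_mul_of_mul_le ?_ ?_ (translationDiff_mul_le hq hg h)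
    rotate_left
    · rw [volume_setOf_norm_lt h0]
      exact mul_ne_zero (ENNReal.ofReal_pos.2 (Real.rpow_pos_of_pos h0 _)).ne' hc0
    · rw [volume_setOf_norm_lt h0]
      exact ENNReal.mul_ne_top ENNReal.ofReal_ne_top hc
    rw [volume_setOf_norm_lt h0, ENNReal.mul_inv (Or.inr hc) (Or.inl ENNReal.ofReal_ne_top),
      ← ENNReal.ofReal_inv_of_pos (by positivity)] at h2
    calc translationDiff q g h ^ (p / q) * ENNReal.ofReal (‖h‖ ^ (-(σ * p + d)))
        ≤ (ENNReal.ofReal ((‖h‖ ^ (d : ℝ))⁻¹) * c⁻¹ *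
            (2 ^ q * 2 * localDiff q Set.univ g (2 * ‖h‖))) ^ (p / q) *
            ENNReal.ofReal (‖h‖ ^ (-(σ * p + d))) := by gcongr
      _ = (c⁻¹ * (2 ^ q * 2)) ^ (p / q) * (ENNReal.ofReal (((‖h‖ ^ (d : ℝ))⁻¹) ^ (p / q) *
            ‖h‖ ^ (-(σ * p + d))) * localDiff q Set.univ g (2 * ‖h‖) ^ (p / q)) := by
          rw [show ENNReal.ofReal ((‖h‖ ^ (d : ℝ))⁻¹) * c⁻¹ *
            (2 ^ q * 2 * localDiff q Set.univ g (2 * ‖h‖)) = c⁻¹ * (2 ^ q * 2) *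
            (ENNReal.ofReal ((‖h‖ ^ (d : ℝ))⁻¹) * localDiff q Set.univ g (2 * ‖h‖)) by ring,
            ENNReal.mul_rpow_of_nonneg (c⁻¹ * (2 ^ q * 2)) _ hpq.le,
            ENNReal.mul_rpow_of_nonneg _ (localDiff _ _ _ _) hpq.le,
            ENNReal.ofReal_rpow_of_nonneg (by positivity) hpq.le,
            ENNReal.ofReal_mul (by positivity)]
          ring
      _ = A * (ENNReal.ofReal ((2 * ‖h‖) ^ (-s) / s) *
            localDiff q Set.univ g (2 * ‖h‖) ^ (p / q)) := by
          rw [hA, mul_assoc, ← mul_assoc (ENNReal.ofReal _) (ENNReal.ofReal _),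
            ← ENNReal.ofReal_mul (by positivity)]
          congr 3
          rw [Real.mul_rpow (by norm_num) h0.le, Real.rpow_neg (by norm_num : (0 : ℝ) ≤ 2),
            ← Real.rpow_neg h0.le, ← Real.rpow_mul h0.le, ← Real.rpow_add h0]
          have : -(d : ℝ) * (p / q) + -(σ * p + d) = -s := by rw [hs]; ring
          rw [this]
          field_simp
      _ ≤ _ := by rw [one_mul]; gcongr
  refine (lintegral_mono key).trans ?_
  rw [lintegral_const_mul' _ _ hA', mul_assoc A]
  refine mul_le_mul_right ?_ A
  rw [← lintegral_mul_lintegral_setOf_lt hw (by fun_prop) (fun _ => by positivity)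
    measurable_const, averagedBesov, ← lintegral_const_mul' _ _
    (ENNReal.mul_ne_top ENNReal.ofReal_ne_top hc)]
  refine le_of_eq (setLIntegral_congr_fun measurableSet_Ioi fun r hr => ?_)
  have hr : 0 < r := hr
  have h3 : {z : Euc d | 2 * ‖z‖ < r} = {z : Euc d | ‖z‖ < 2⁻¹ * r} := by
    ext z
    change 2 * ‖z‖ < r ↔ ‖z‖ < 2⁻¹ * r
    constructor <;> intro h <;> linarith
  simp only [lintegral_one, Measure.restrict_apply_univ]
  rw [h3, volume_setOf_norm_lt (by positivity), Real.mul_rpow (by norm_num) hr.le,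
    ENNReal.ofReal_mul (by positivity)]
  have h4 : ENNReal.ofReal (r ^ (-(σ * p + d * (p / q)) - 1)) =
      ENNReal.ofReal (r ^ (-s - 1)) * ENNReal.ofReal (r ^ (d : ℝ)) := by
    rw [← ENNReal.ofReal_mul (by positivity), ← Real.rpow_add hr]
    congr 2; rw [hs]; ring
  rw [h4]
  ring

end AveragedDifferences

/-! ### The averaged seminorm of even and odd reflections. -/

section ReflectionEstimates

variable {𝕜 : Type*} [RCLike 𝕜] {n : ℕ}

theorem measurable_signedReflection {g : Euc (n + 1) → 𝕜} (hg : Measurable g) (s : ℝ) :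
    Measurable (signedReflection s g) :=
  Measurable.ite measurableSet_upperHalfSpace hg
    ((hg.comp measurePreserving_reflectLast.measurable).const_smul s)

theorem reflectLast_sub (x y : Euc (n + 1)) :
    reflectLast (x - y) = reflectLast x - reflectLast y :=
  map_sub (reflectLastEquiv n) x y

theorem norm_reflectLast_sub (x y : Euc (n + 1)) :
    ‖reflectLast x - y‖ = ‖x - reflectLast y‖ := by
  rw [← norm_reflectLast (x - reflectLast y), reflectLast_sub, reflectLast_reflectLast]

theorem enorm_smul_sub_eq {s : ℝ} (hs : s = 1 ∨ s = -1) (a b : 𝕜) :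
    ‖s • a - b‖ₑ = ‖a - s • b‖ₑ := by
  rcases hs with rfl | rfl
  · simp
  · rw [← enorm_neg]; congr 1; simp; ring

/-- Split both variables according to the side of the boundary. The two blocks with points on the
same side agree because the reflection is an isometry and `|s| = 1`; the two mixed blocks agree
because the reflection can be moved from one point to the other. -/
theorem localDiff_signedReflection_le {s : ℝ} (hs : s = 1 ∨ s = -1) (q : ℝ)
    {g : Euc (n + 1) → 𝕜} (hg : Measurable g) (r : ℝ) :
    localDiff q Set.univ (signedReflection s g) r ≤
      2 * localDiff q (upperHalfSpace n) g r +
      2 * ∫⁻ x in upperHalfSpace n, ∫⁻ y in upperHalfSpace n,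
        if ‖x - reflectLast y‖ < r then ‖g x - s • g y‖ₑ ^ q else 0 := by
  set G := signedReflection s g
  have hG : Measurable G := measurable_signedReflection hg s
  set k : Euc (n + 1) → Euc (n + 1) → ℝ≥0∞ := fun x y =>
    if ‖x - y‖ < r then ‖G x - G y‖ₑ ^ q else 0 with hk
  have mk : Measurable fun z : Euc (n + 1) × Euc (n + 1) => k z.1 z.2 :=
    measurable_localDiff_integrand hG q r
  have m1 : Measurable fun x => ∫⁻ y in upperHalfSpace n, k x y :=
    Measurable.lintegral_prod_right' (f := fun z : Euc (n + 1) × Euc (n + 1) => k z.1 z.2) mk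
  have m2 : Measurable fun x => ∫⁻ y in upperHalfSpace n, k (reflectLast x) y :=
    m1.comp measurePreserving_reflectLast.measurable
  have e0 : localDiff q Set.univ G r = ∫⁻ x, ∫⁻ y, k x y := by
    simp only [localDiff, Measure.restrict_univ, hk]
  have hss : s • s • (1 : 𝕜) = 1 := by rcases hs with rfl | rfl <;> simp
  rw [e0]
  simp only [lintegral_eq_add_reflectLast (fun y => k _ y)]
  rw [lintegral_add_left m1, lintegral_eq_add_reflectLast (fun x => ∫⁻ y in upperHalfSpace n, k x y),
    lintegral_eq_add_reflectLast (fun x => ∫⁻ y in upperHalfSpace n, k x (reflectLast y))]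
  have t1 : ∫⁻ x in upperHalfSpace n, ∫⁻ y in upperHalfSpace n, k x y =
      localDiff q (upperHalfSpace n) g r := by
    refine setLIntegral_congr_fun measurableSet_upperHalfSpace fun x hx => ?_
    refine setLIntegral_congr_fun measurableSet_upperHalfSpace fun y hy => ?_
    simp only [hk, G, signedReflection_of_mem _ _ hx, signedReflection_of_mem _ _ hy]
  have t2 : ∫⁻ x in upperHalfSpace n, ∫⁻ y in upperHalfSpace n, k (reflectLast x) (reflectLast y) =
      localDiff q (upperHalfSpace n) g r := by
    refine setLIntegral_congr_fun measurableSet_upperHalfSpace fun x hx => ?_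
    refine setLIntegral_congr_fun measurableSet_upperHalfSpace fun y hy => ?_
    simp only [hk, G, signedReflection_reflectLast _ _ hx, signedReflection_reflectLast _ _ hy,
      ← reflectLast_sub, norm_reflectLast]
    rcases hs with rfl | rfl
    · simp
    · rw [← enorm_neg (g x - g y)]
      simp only [neg_smul, one_smul, neg_sub, neg_sub_neg]
  have t3 : ∫⁻ x in upperHalfSpace n, ∫⁻ y in upperHalfSpace n, k (reflectLast x) y =
      ∫⁻ x in upperHalfSpace n, ∫⁻ y in upperHalfSpace n,
        if ‖x - reflectLast y‖ < r then ‖g x - s • g y‖ₑ ^ q else 0 := by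
    refine setLIntegral_congr_fun measurableSet_upperHalfSpace fun x hx => ?_
    refine setLIntegral_congr_fun measurableSet_upperHalfSpace fun y hy => ?_
    simp only [hk, G, signedReflection_reflectLast _ _ hx, signedReflection_of_mem _ _ hy,
      norm_reflectLast_sub, enorm_smul_sub_eq hs]
  have t4 : ∫⁻ x in upperHalfSpace n, ∫⁻ y in upperHalfSpace n, k x (reflectLast y) =
      ∫⁻ x in upperHalfSpace n, ∫⁻ y in upperHalfSpace n,
        if ‖x - reflectLast y‖ < r then ‖g x - s • g y‖ₑ ^ q else 0 := by
    refine setLIntegral_congr_fun measurableSet_upperHalfSpace fun x hx => ?_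
    refine setLIntegral_congr_fun measurableSet_upperHalfSpace fun y hy => ?_
    simp only [hk, G, signedReflection_reflectLast _ _ hy, signedReflection_of_mem _ _ hx]
  rw [t1, t2, t3, t4]
  refine le_of_eq ?_
  ring

theorem norm_sub_le_norm_sub_reflectLast {x y : Euc (n + 1)} (hx : x ∈ upperHalfSpace n)
    (hy : y ∈ upperHalfSpace n) : ‖x - y‖ ≤ ‖x - reflectLast y‖ := by
  rw [mem_upperHalfSpace] at hx hy
  rw [EuclideanSpace.norm_eq, EuclideanSpace.norm_eq]
  refine Real.sqrt_le_sqrt (Finset.sum_le_sum fun i _ => ?_)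
  by_cases hi : i = Fin.last n
  · subst hi
    simp only [PiLp.sub_apply, reflectLast_apply_last, Real.norm_eq_abs, sq_abs]
    nlinarith [mul_pos hx hy]
  · simp [reflectLast_apply_of_ne _ hi]

theorem coord_last_lt_of_norm_sub_reflectLast_lt {x y : Euc (n + 1)} (hx : x ∈ upperHalfSpace n)
    (hy : y ∈ upperHalfSpace n) {r : ℝ} (h : ‖x - reflectLast y‖ < r) :
    x (Fin.last n) < r ∧ y (Fin.last n) < r := by
  rw [mem_upperHalfSpace] at hx hy
  have h1 := PiLp.norm_apply_le (x - reflectLast y) (Fin.last n)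
  simp only [PiLp.sub_apply, reflectLast_apply_last, Real.norm_eq_abs] at h1
  have h2 := le_abs_self (x (Fin.last n) - -y (Fin.last n))
  constructor <;> linarith

/-- For `s = 1` the mixed blocks contain the same differences of `g`, but over fewer pairs, since
`|x - y| ≤ |x - reflectLast y|` on the half space. -/
theorem localDiff_evenReflection_le (q : ℝ) {g : Euc (n + 1) → 𝕜} (hg : Measurable g) (r : ℝ) :
    localDiff q Set.univ (signedReflection 1 g) r ≤ 4 * localDiff q (upperHalfSpace n) g r := by
  refine (localDiff_signedReflection_le (Or.inl rfl) q hg r).trans ?_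
  have : ∫⁻ x in upperHalfSpace n, ∫⁻ y in upperHalfSpace n,
        (if ‖x - reflectLast y‖ < r then ‖g x - (1 : ℝ) • g y‖ₑ ^ q else 0) ≤
      localDiff q (upperHalfSpace n) g r := by
    refine setLIntegral_mono' measurableSet_upperHalfSpace fun x hx => ?_
    refine setLIntegral_mono' measurableSet_upperHalfSpace fun y hy => ?_
    by_cases h : ‖x - reflectLast y‖ < r
    · simp [h, (norm_sub_le_norm_sub_reflectLast hx hy).trans_lt h]
    · simp [h]
  calc _ ≤ 2 * localDiff q (upperHalfSpace n) g r + 2 * localDiff q (upperHalfSpace n) g r := by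
        gcongr
    _ = _ := by ring

/-- The slab of all points of distance less than `r` from the boundary of the half space. -/
def slab (n : ℕ) (r : ℝ) : Set (Euc (n + 1)) := {x | 0 < x (Fin.last n) ∧ x (Fin.last n) < r}

theorem measurableSet_slab (r : ℝ) : MeasurableSet (slab n r) :=
  (isOpen_upperHalfSpace.inter (isOpen_lt (continuous_coord _) continuous_const)).measurableSet

/-- The integral of `|g|^q` over a slab at the boundary of the half space. -/
def slabMass (q : ℝ) (g : Euc (n + 1) → 𝕜) (r : ℝ) : ℝ≥0∞ := ∫⁻ x in slab n r, ‖g x‖ₑ ^ q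

theorem slab_mono {r r' : ℝ} (h : r ≤ r') : slab n r ⊆ slab n r' := fun _ hx => ⟨hx.1, hx.2.trans_le h⟩

theorem measurable_slabMass (q : ℝ) (g : Euc (n + 1) → 𝕜) : Measurable (slabMass q g) :=
  Monotone.measurable fun _ _ h => lintegral_mono_set (slab_mono h)

/-- The mixed blocks now contain sums `g x + g y`, in which there is no cancellation to use. The
condition `|x - reflectLast y| < r` forces `x_n + y_n < r`, so both points lie in the slab of height
`r`; for one of them fixed, the other ranges over a set of the volume of a ball of radius `r`. -/
theorem localDiff_oddReflection_le {q : ℝ} (hq : 1 ≤ q) {g : Euc (n + 1) → 𝕜}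
    (hg : Measurable g) {r : ℝ} (hr : 0 < r) :
    localDiff q Set.univ (signedReflection (-1) g) r ≤
      2 * localDiff q (upperHalfSpace n) g r + 2 * (2 ^ q * (2 *
        (ENNReal.ofReal (r ^ ((n + 1 : ℕ) : ℝ)) * volume (Metric.ball (0 : Euc (n + 1)) 1) *
          slabMass q g r))) := by
  refine (localDiff_signedReflection_le (Or.inr rfl) q hg r).trans ?_
  gcongr 2 * localDiff q (upperHalfSpace n) g r + 2 * ?_
  have h2q : (2 : ℝ≥0∞) ^ q ≠ ⊤ := ENNReal.rpow_ne_top_of_nonneg (by linarith) (by simp)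
  set F : Euc (n + 1) → ℝ≥0∞ := (slab n r).indicator fun x => ‖g x‖ₑ ^ q with hF
  have mF : Measurable F := (hg.enorm.pow_const q).indicator (measurableSet_slab r)
  have mset : MeasurableSet {z : Euc (n + 1) × Euc (n + 1) | ‖z.1 - reflectLast z.2‖ < r} :=
    measurableSet_lt (measurable_fst.sub
      (measurePreserving_reflectLast.measurable.comp measurable_snd)).norm measurable_const
  set T1 : Euc (n + 1) × Euc (n + 1) → ℝ≥0∞ :=
    {z | ‖z.1 - reflectLast z.2‖ < r}.indicator fun z => F z.1 with hT1
  set T2 : Euc (n + 1) × Euc (n + 1) → ℝ≥0∞ :=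
    {z | ‖z.1 - reflectLast z.2‖ < r}.indicator fun z => F z.2 with hT2
  have mT1 : Measurable T1 := (mF.comp measurable_fst).indicator mset
  have mT2 : Measurable T2 := (mF.comp measurable_snd).indicator mset
  have key : ∫⁻ x in upperHalfSpace n, ∫⁻ y in upperHalfSpace n,
        (if ‖x - reflectLast y‖ < r then ‖g x - (-1 : ℝ) • g y‖ₑ ^ q else 0) ≤
      ∫⁻ x, ∫⁻ y, 2 ^ q * (T1 (x, y) + T2 (x, y)) := by
    refine le_trans (setLIntegral_mono' measurableSet_upperHalfSpace fun x hx => ?_)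
      (setLIntegral_le_lintegral (upperHalfSpace n) _)
    refine le_trans (setLIntegral_mono' measurableSet_upperHalfSpace fun y hy => ?_)
      (setLIntegral_le_lintegral (upperHalfSpace n) _)
    by_cases h : ‖x - reflectLast y‖ < r
    · have hz : (x, y) ∈ {z : Euc (n + 1) × Euc (n + 1) | ‖z.1 - reflectLast z.2‖ < r} := h
      obtain ⟨hxr, hyr⟩ := coord_last_lt_of_norm_sub_reflectLast_lt hx hy h
      have hx' : x ∈ slab n r := ⟨hx, hxr⟩
      have hy' : y ∈ slab n r := ⟨hy, hyr⟩
      have e1 : T1 (x, y) = ‖g x‖ₑ ^ q := by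
        rw [hT1, Set.indicator_of_mem hz, hF, Set.indicator_of_mem hx']
      have e2 : T2 (x, y) = ‖g y‖ₑ ^ q := by
        rw [hT2, Set.indicator_of_mem hz, hF, Set.indicator_of_mem hy']
      rw [if_pos h, e1, e2]
      refine le_trans ?_ (add_rpow_le hq _ _)
      gcongr
      refine enorm_sub_le.trans ?_
      simp
    · rw [if_neg h]
      exact zero_le
  refine key.trans ?_
  rw [← lintegral_prod (fun z => 2 ^ q * (T1 z + T2 z)) ((mT1.add mT2).const_mul _).aemeasurable,
    lintegral_const_mul' _ _ h2q, lintegral_add_left mT1]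
  refine mul_le_mul_right ?_ _
  have hv : ∀ x : Euc (n + 1), volume {y : Euc (n + 1) | ‖x - y‖ < r} =
      ENNReal.ofReal (r ^ ((n + 1 : ℕ) : ℝ)) * volume (Metric.ball (0 : Euc (n + 1)) 1) := by
    intro x
    rw [volume_setOf_norm_sub_lt, volume_setOf_norm_lt hr]
  have hS : ∀ x : Euc (n + 1), MeasurableSet {z : Euc (n + 1) | ‖x - z‖ < r} := fun x =>
    measurableSet_lt (measurable_const.sub measurable_id).norm measurable_const
  have hmass : ∫⁻ x, F x = slabMass q g r := lintegral_indicator (measurableSet_slab r) _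
  have i1 : ∫⁻ z, T1 z ∂(volume.prod volume) = ENNReal.ofReal (r ^ ((n + 1 : ℕ) : ℝ)) *
      volume (Metric.ball (0 : Euc (n + 1)) 1) * slabMass q g r := by
    rw [lintegral_prod _ mT1.aemeasurable, ← hmass, ← lintegral_const_mul _ mF]
    refine lintegral_congr fun x => ?_
    have e1 : ∀ y, T1 (x, y) = (reflectLast ⁻¹' {y | ‖x - y‖ < r}).indicator (fun _ => F x) y :=
      fun y => rfl
    simp only [e1]
    rw [lintegral_indicator (measurePreserving_reflectLast.measurable (hS x)), setLIntegral_const,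
      measurePreserving_reflectLast.measure_preimage (hS x).nullMeasurableSet, hv, mul_comm]
  have i2 : ∫⁻ z, T2 z ∂(volume.prod volume) = ENNReal.ofReal (r ^ ((n + 1 : ℕ) : ℝ)) *
      volume (Metric.ball (0 : Euc (n + 1)) 1) * slabMass q g r := by
    rw [lintegral_prod_symm _ mT2.aemeasurable, ← hmass, ← lintegral_const_mul _ mF]
    refine lintegral_congr fun y => ?_
    have e1 : ∀ x, T2 (x, y) = {x | ‖reflectLast y - x‖ < r}.indicator (fun _ => F y) x := by
      intro x
      simp only [hT2, Set.indicator, Set.mem_ofPred_eq, norm_sub_rev (reflectLast y)]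
    simp only [e1]
    rw [lintegral_indicator (hS _), setLIntegral_const, hv, mul_comm]
  rw [i1, i2, two_mul]

/-- The weighted integral of the slab masses over all `r > ε`. -/
def slabNorm (σ q p : ℝ) (g : Euc (n + 1) → 𝕜) (ε : ℝ) : ℝ≥0∞ :=
  ∫⁻ r in Set.Ioi ε, ENNReal.ofReal (r ^ (-(σ * p) - 1)) * slabMass q g r ^ (p / q)

theorem averagedBesov_evenReflection_le {σ q p : ℝ} (hpq : 0 ≤ p / q) {g : Euc (n + 1) → 𝕜}
    (hg : Measurable g) :
    averagedBesov σ q p Set.univ (signedReflection 1 g) ≤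
      4 ^ (p / q) * averagedBesov σ q p (upperHalfSpace n) g := by
  have h4 : (4 : ℝ≥0∞) ^ (p / q) ≠ ⊤ := ENNReal.rpow_ne_top_of_nonneg hpq (by simp)
  unfold averagedBesov
  rw [← lintegral_const_mul' _ _ h4]
  refine lintegral_mono fun r => ?_
  calc _ ≤ ENNReal.ofReal (r ^ (-(σ * p + (n + 1 : ℕ) * (p / q)) - 1)) *
        (4 * localDiff q (upperHalfSpace n) g r) ^ (p / q) := by
        gcongr
        exact localDiff_evenReflection_le q hg r
    _ = _ := by rw [ENNReal.mul_rpow_of_nonneg _ _ hpq]; ring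

/-- The volume factor `r^(n + 1)`, raised to the power `p / q`, cancels the dimensional part of the
weight in `averagedBesov`, which leaves exactly the weight of `slabNorm`. -/
theorem exists_averagedBesov_oddReflection_le (n : ℕ) {σ q p : ℝ} (hq : 1 ≤ q) (hqp : q ≤ p) :
    ∃ C : ℝ≥0∞, C ≠ ⊤ ∧ ∀ g : Euc (n + 1) → 𝕜, Measurable g →
      averagedBesov σ q p Set.univ (signedReflection (-1) g) ≤
        C * (averagedBesov σ q p (upperHalfSpace n) g + slabNorm σ q p g 0) := by
  have hq0 : 0 < q := by linarith
  have hpq : 1 ≤ p / q := (one_le_div hq0).2 hqp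
  have hpq0 : 0 ≤ p / q := by linarith
  set c := volume (Metric.ball (0 : Euc (n + 1)) 1)
  have hc : c ≠ ⊤ := measure_ball_lt_top.ne
  have h2q : (2 : ℝ≥0∞) ^ q ≠ ⊤ := ENNReal.rpow_ne_top_of_nonneg (by linarith) (by simp)
  set M : ℝ≥0∞ := 2 + 2 * (2 ^ q * (2 * c)) with hM
  have hM' : M ≠ ⊤ := by finiteness
  set C : ℝ≥0∞ := 2 ^ (p / q) * M ^ (p / q) with hC
  have hC' : C ≠ ⊤ := ENNReal.mul_ne_top (ENNReal.rpow_ne_top_of_nonneg hpq0 (by simp))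
    (ENNReal.rpow_ne_top_of_nonneg hpq0 hM')
  refine ⟨C, hC', fun g hg => ?_⟩
  unfold averagedBesov slabNorm
  have hm : Measurable fun r : ℝ => ENNReal.ofReal
      (r ^ (-(σ * p + (n + 1 : ℕ) * (p / q)) - 1)) *
        localDiff q (upperHalfSpace n) g r ^ (p / q) :=
    (by fun_prop : Measurable fun r : ℝ => ENNReal.ofReal
      (r ^ (-(σ * p + (n + 1 : ℕ) * (p / q)) - 1))).mul
      ((measurable_localDiff q _ g).pow_const _)
  rw [← lintegral_add_left hm, ← lintegral_const_mul' _ _ hC']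
  refine setLIntegral_mono' measurableSet_Ioi fun r hr => ?_
  have hr : 0 < r := hr
  set D := localDiff q (upperHalfSpace n) g r
  set m := slabMass q g r
  have h1 : localDiff q Set.univ (signedReflection (-1) g) r ≤
      M * (D + ENNReal.ofReal (r ^ ((n + 1 : ℕ) : ℝ)) * m) := by
    refine (localDiff_oddReflection_le hq hg hr).trans ?_
    rw [hM, add_mul, mul_add, mul_add]
    calc _ = 2 * D + 2 * (2 ^ q * (2 * c)) * (ENNReal.ofReal (r ^ ((n + 1 : ℕ) : ℝ)) * m) := by ring
      _ ≤ _ := by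
        refine add_le_add le_self_add le_add_self
  calc _ ≤ ENNReal.ofReal (r ^ (-(σ * p + (n + 1 : ℕ) * (p / q)) - 1)) *
        (M * (D + ENNReal.ofReal (r ^ ((n + 1 : ℕ) : ℝ)) * m)) ^ (p / q) := by gcongr
    _ ≤ ENNReal.ofReal (r ^ (-(σ * p + (n + 1 : ℕ) * (p / q)) - 1)) * (M ^ (p / q) *
        (2 ^ (p / q) * (D ^ (p / q) + (ENNReal.ofReal (r ^ ((n + 1 : ℕ) : ℝ)) * m) ^ (p / q)))) := by
        rw [ENNReal.mul_rpow_of_nonneg _ _ hpq0]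
        gcongr
        exact add_rpow_le hpq _ _
    _ = C * (ENNReal.ofReal (r ^ (-(σ * p + (n + 1 : ℕ) * (p / q)) - 1)) * D ^ (p / q) +
        ENNReal.ofReal (r ^ (-(σ * p + (n + 1 : ℕ) * (p / q)) - 1)) *
          ENNReal.ofReal ((r ^ ((n + 1 : ℕ) : ℝ)) ^ (p / q)) * m ^ (p / q)) := by
        rw [ENNReal.mul_rpow_of_nonneg _ m hpq0, ENNReal.ofReal_rpow_of_nonneg (by positivity) hpq0,
          hC]
        ring
    _ = _ := by
        rw [← ENNReal.ofReal_mul (by positivity), ← Real.rpow_mul hr.le, ← Real.rpow_add hr]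
        congr 5
        ring

end ReflectionEstimates

/-! ### Comparing `|g|^q` on slabs of different heights. -/

section SlabComparison

variable {𝕜 : Type*} [RCLike 𝕜] {n : ℕ}

/-- The pairs of points in two slabs whose tangential coordinates differ by less than `ρ`. -/
def slabPairs (n : ℕ) (r t ρ : ℝ) : Set (Euc (n + 1) × Euc (n + 1)) :=
  {z | z.1 ∈ slab n r ∧ z.2 ∈ slab n t ∧ ∀ i : Fin n, |z.1 i.castSucc - z.2 i.castSucc| < ρ}

theorem measurableSet_slabPairs (r t ρ : ℝ) : MeasurableSet (slabPairs n r t ρ) := by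
  refine (measurable_fst (measurableSet_slab r)).inter
    ((measurable_snd (measurableSet_slab t)).inter ?_)
  have : {z : Euc (n + 1) × Euc (n + 1) | ∀ i : Fin n, |z.1 i.castSucc - z.2 i.castSucc| < ρ} =
      ⋂ i : Fin n, {z | |z.1 i.castSucc - z.2 i.castSucc| < ρ} := by
    ext; simp
  change MeasurableSet {z : Euc (n + 1) × Euc (n + 1) |
    ∀ i : Fin n, |z.1 i.castSucc - z.2 i.castSucc| < ρ}
  rw [this]
  refine MeasurableSet.iInter fun i => (isOpen_lt ?_ continuous_const).measurableSet
  exact (((continuous_coord i.castSucc).comp continuous_fst).sub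
    ((continuous_coord i.castSucc).comp continuous_snd)).abs

theorem volume_slabBox (x : Euc (n + 1)) (t : ℝ) {ρ : ℝ} (hρ : 0 < ρ) :
    volume {y : Euc (n + 1) | y ∈ slab n t ∧ ∀ i : Fin n, |x i.castSucc - y i.castSucc| < ρ} =
      ENNReal.ofReal ((2 * ρ) ^ n * t) := by
  have h1 : {y : Euc (n + 1) | y ∈ slab n t ∧ ∀ i : Fin n, |x i.castSucc - y i.castSucc| < ρ} =
      (MeasurableEquiv.toLp 2 (Fin (n + 1) → ℝ)).symm ⁻¹'
        (Set.univ.pi (Fin.snoc (α := fun _ => Set ℝ)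
          (fun i : Fin n => Set.Ioo (x i.castSucc - ρ) (x i.castSucc + ρ)) (Set.Ioo 0 t))) := by
    ext y
    simp only [Set.mem_preimage, Set.mem_univ_pi, Fin.forall_fin_succ', Fin.snoc_castSucc,
      Fin.snoc_last]
    change (0 < y (Fin.last n) ∧ y (Fin.last n) < t) ∧ _ ↔
      (∀ i : Fin n, x i.castSucc - ρ < y i.castSucc ∧ y i.castSucc < x i.castSucc + ρ) ∧
        (0 < y (Fin.last n) ∧ y (Fin.last n) < t)
    rw [and_comm]
    refine and_congr_left fun _ => forall_congr' fun i => ?_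
    rw [abs_lt]
    constructor <;> rintro ⟨h, h'⟩ <;> constructor <;> linarith
  rw [h1, (EuclideanSpace.volume_preserving_symm_measurableEquiv_toLp
    (Fin (n + 1))).measure_preimage_equiv, volume_pi_pi, Fin.prod_univ_castSucc]
  simp only [Fin.snoc_castSucc, Fin.snoc_last, Real.volume_Ioo, sub_zero]
  have : ∀ i : Fin n, x i.castSucc + ρ - (x i.castSucc - ρ) = 2 * ρ := fun i => by ring
  simp only [this, Finset.prod_const, Finset.card_univ, Fintype.card_fin]
  rw [← ENNReal.ofReal_pow (by positivity), ← ENNReal.ofReal_mul (by positivity)]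

theorem lintegral_slabPairs_fst {q : ℝ} {g : Euc (n + 1) → 𝕜} (hg : Measurable g) (r t : ℝ) {ρ : ℝ}
    (hρ : 0 < ρ) :
    ∫⁻ z in slabPairs n r t ρ, ‖g z.1‖ₑ ^ q ∂(volume.prod volume) =
      ENNReal.ofReal ((2 * ρ) ^ n * t) * slabMass q g r := by
  have m1 : Measurable ((slabPairs n r t ρ).indicator fun z => ‖g z.1‖ₑ ^ q) :=
    (((hg.comp measurable_fst).enorm).pow_const q).indicator (measurableSet_slabPairs r t ρ)
  rw [← lintegral_indicator (measurableSet_slabPairs r t ρ), lintegral_prod _ m1.aemeasurable,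
    slabMass, ← lintegral_const_mul _ (hg.enorm.pow_const q),
    ← lintegral_indicator (measurableSet_slab r)]
  refine lintegral_congr fun x => ?_
  by_cases hx : x ∈ slab n r
  · have hB : MeasurableSet {y : Euc (n + 1) | y ∈ slab n t ∧
        ∀ i : Fin n, |x i.castSucc - y i.castSucc| < ρ} := by
      have : {y : Euc (n + 1) | y ∈ slab n t ∧ ∀ i : Fin n, |x i.castSucc - y i.castSucc| < ρ} =
          Prod.mk x ⁻¹' slabPairs n r t ρ := by
        ext y; simp [slabPairs, hx]
      rw [this]
      exact measurable_prodMk_left (measurableSet_slabPairs r t ρ)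
    have e1 : ∀ y, (slabPairs n r t ρ).indicator (fun z => ‖g z.1‖ₑ ^ q) (x, y) =
        {y : Euc (n + 1) | y ∈ slab n t ∧ ∀ i : Fin n, |x i.castSucc - y i.castSucc| < ρ}.indicator
          (fun _ => ‖g x‖ₑ ^ q) y := by
      intro y
      have h : (x, y) ∈ slabPairs n r t ρ ↔
          y ∈ {y : Euc (n + 1) | y ∈ slab n t ∧ ∀ i : Fin n, |x i.castSucc - y i.castSucc| < ρ} := by
        simp [slabPairs, hx]
      by_cases hy : (x, y) ∈ slabPairs n r t ρ
      · rw [Set.indicator_of_mem hy, Set.indicator_of_mem (h.1 hy)]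
      · rw [Set.indicator_of_notMem hy, Set.indicator_of_notMem fun h' => hy (h.2 h')]
    simp only [e1]
    rw [lintegral_indicator hB, setLIntegral_const, volume_slabBox x t hρ,
      Set.indicator_of_mem hx, mul_comm]
  · rw [Set.indicator_of_notMem hx, lintegral_eq_zero_iff' (by fun_prop)]
    refine Eventually.of_forall fun y => ?_
    simp [Set.indicator, slabPairs, hx]

theorem lintegral_slabPairs_snd {q : ℝ} {g : Euc (n + 1) → 𝕜} (hg : Measurable g) (r t : ℝ) {ρ : ℝ}
    (hρ : 0 < ρ) :
    ∫⁻ z in slabPairs n r t ρ, ‖g z.2‖ₑ ^ q ∂(volume.prod volume) =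
      ENNReal.ofReal ((2 * ρ) ^ n * r) * slabMass q g t := by
  rw [← lintegral_slabPairs_fst hg t r hρ, ← lintegral_indicator (measurableSet_slabPairs _ _ _),
    ← lintegral_indicator (measurableSet_slabPairs _ _ _), ← lintegral_prod_swap]
  refine lintegral_congr fun z => ?_
  have : z.swap ∈ slabPairs n r t ρ ↔ z ∈ slabPairs n t r ρ := by
    simp only [slabPairs, Set.mem_ofPred_eq, Prod.fst_swap, Prod.snd_swap]
    simp only [abs_sub_comm]
    tauto
  by_cases hz : z ∈ slabPairs n t r ρ
  · rw [Set.indicator_of_mem hz, Set.indicator_of_mem (this.2 hz), Prod.snd_swap]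
  · rw [Set.indicator_of_notMem hz, Set.indicator_of_notMem fun h => hz (this.1 h)]

theorem norm_sub_lt_of_mem_slabPairs {r t ρ : ℝ} (hr : r ≤ ρ) (ht : t ≤ ρ)
    {z : Euc (n + 1) × Euc (n + 1)} (hz : z ∈ slabPairs n r t ρ) :
    ‖z.1 - z.2‖ < (n + 1) * ρ := by
  obtain ⟨⟨h1, h2⟩, ⟨h3, h4⟩, h5⟩ := hz
  have hρ : 0 < ρ := by linarith
  have hi : ∀ i : Fin (n + 1), ‖(z.1 - z.2) i‖ ^ 2 < ρ ^ 2 := by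
    intro i
    rw [Real.norm_eq_abs, sq_lt_sq, abs_abs, abs_of_pos hρ]
    induction i using Fin.lastCases with
    | last => rw [PiLp.sub_apply, abs_lt]; constructor <;> linarith
    | cast i => exact h5 i
  rw [EuclideanSpace.norm_eq, Real.sqrt_lt' (by positivity)]
  calc ∑ i, ‖(z.1 - z.2) i‖ ^ 2 < ∑ _i : Fin (n + 1), ρ ^ 2 :=
        Finset.sum_lt_sum_of_nonempty Finset.univ_nonempty fun i _ => hi i
    _ = (n + 1) * ρ ^ 2 := by simp
    -- A crude bound; the sharp factor `√(n + 1)` is not needed.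
    _ ≤ ((n + 1) * ρ) ^ 2 := by
        rw [mul_pow, sq ((n : ℝ) + 1)]
        have : (0 : ℝ) ≤ n := Nat.cast_nonneg n
        have : 0 ≤ n * ((n : ℝ) + 1) * ρ ^ 2 := by positivity
        nlinarith

/-- Comparison of the masses of two slabs. -/
theorem slabMass_rpow_le_add {q : ℝ} (hq : 1 ≤ q) {g : Euc (n + 1) → 𝕜} (hg : Measurable g)
    {r t ρ : ℝ} (hr : 0 < r) (ht : 0 < t) (hrρ : r ≤ ρ) (htρ : t ≤ ρ) :
    slabMass q g r ^ (1 / q) ≤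
      (ENNReal.ofReal ((2 * ρ) ^ n * t)⁻¹ *
        localDiff q (upperHalfSpace n) g ((n + 1) * ρ)) ^ (1 / q) +
      (ENNReal.ofReal (r / t) * slabMass q g t) ^ (1 / q) := by
  have hq0 : 0 < q := by linarith
  have hq1 : 0 ≤ 1 / q := by positivity
  have hρ : 0 < ρ := by linarith
  have hV : 0 < (2 * ρ) ^ n * t := by positivity
  set V := ENNReal.ofReal ((2 * ρ) ^ n * t) with hVd
  have hV0 : V ≠ 0 := (ENNReal.ofReal_pos.2 hV).ne'
  have hVt : V ≠ ⊤ := ENNReal.ofReal_ne_top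
  set μ := ((volume : Measure (Euc (n + 1))).prod (volume : Measure (Euc (n + 1)))).restrict
    (slabPairs n r t ρ)
  -- Minkowski's inequality for `g z.1 = (g z.1 - g z.2) + g z.2`. It has constant one, unlike
  -- `add_rpow_le`; a factor in front of the second term would destroy the contraction in Hardy's
  -- inequality.
  have mink := ENNReal.lintegral_Lp_add_le (μ := μ)
    (f := fun z : Euc (n + 1) × Euc (n + 1) => ‖g z.1 - g z.2‖ₑ) (g := fun z => ‖g z.2‖ₑ)
    (((hg.comp measurable_fst).sub (hg.comp measurable_snd)).enorm.aemeasurable)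
    ((hg.comp measurable_snd).enorm.aemeasurable) hq
  have hD : ∫⁻ z, ‖g z.1 - g z.2‖ₑ ^ q ∂μ ≤ localDiff q (upperHalfSpace n) g ((n + 1) * ρ) := by
    have hm : MeasurableSet {z : Euc (n + 1) × Euc (n + 1) | ‖z.1 - z.2‖ < (n + 1) * ρ} :=
      measurableSet_lt (measurable_fst.sub measurable_snd).norm measurable_const
    rw [localDiff_eq_lintegral_prod hg, Measure.prod_restrict, Measure.restrict_restrict hm]
    refine lintegral_mono_set fun z hz => ⟨norm_sub_lt_of_mem_slabPairs hrρ htρ hz, ?_⟩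
    exact ⟨hz.1.1, hz.2.1.1⟩
  have main : (V * slabMass q g r) ^ (1 / q) ≤
      localDiff q (upperHalfSpace n) g ((n + 1) * ρ) ^ (1 / q) +
        (ENNReal.ofReal ((2 * ρ) ^ n * r) * slabMass q g t) ^ (1 / q) := by
    rw [← lintegral_slabPairs_fst hg r t hρ, ← lintegral_slabPairs_snd hg r t hρ]
    refine le_trans ?_ (mink.trans (add_le_add_left (ENNReal.rpow_le_rpow hD hq1) _))
    refine ENNReal.rpow_le_rpow (lintegral_mono fun z => ?_) hq1
    refine ENNReal.rpow_le_rpow ?_ hq0.le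
    calc ‖g z.1‖ₑ = ‖(g z.1 - g z.2) + g z.2‖ₑ := by rw [sub_add_cancel]
      _ ≤ _ := enorm_add_le _ _
  have hmul : (V⁻¹) ^ (1 / q) * (V * slabMass q g r) ^ (1 / q) = slabMass q g r ^ (1 / q) := by
    rw [← ENNReal.mul_rpow_of_nonneg _ _ hq1, ← mul_assoc, ENNReal.inv_mul_cancel hV0 hVt, one_mul]
  rw [← hmul, ENNReal.ofReal_inv_of_pos hV]
  refine (mul_le_mul_right main _).trans (le_of_eq ?_)
  rw [mul_add, ← ENNReal.mul_rpow_of_nonneg _ _ hq1, ← ENNReal.mul_rpow_of_nonneg _ _ hq1,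
    ← mul_assoc, hVd, ← ENNReal.ofReal_inv_of_pos hV, ← ENNReal.ofReal_mul (by positivity)]
  have hrt : ((2 * ρ) ^ n * t)⁻¹ * ((2 * ρ) ^ n * r) = r / t := by field_simp
  rw [hrt]

end SlabComparison

/-! ### Hardy's inequality: the recursion and the case `σ < 1 / q`. -/

section Hardy

variable {𝕜 : Type*} [RCLike 𝕜] {n : ℕ}

/-- Minkowski's inequality for the measure with density `w`. -/
theorem lintegral_mul_rpow_add_le {α : Type*} [MeasurableSpace α] {μ : Measure α} {p : ℝ}
    (hp : 1 ≤ p) {w f g : α → ℝ≥0∞} (hw : Measurable w) (hf : Measurable f) (hg : Measurable g) :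
    (∫⁻ x, w x * (f x + g x) ^ p ∂μ) ^ (1 / p) ≤
      (∫⁻ x, w x * f x ^ p ∂μ) ^ (1 / p) + (∫⁻ x, w x * g x ^ p ∂μ) ^ (1 / p) := by
  have h := ENNReal.lintegral_Lp_add_le (μ := μ.withDensity w) hf.aemeasurable hg.aemeasurable hp
  rw [lintegral_withDensity_eq_lintegral_mul _ hw ((hf.add hg).pow_const p),
    lintegral_withDensity_eq_lintegral_mul _ hw (hf.pow_const p),
    lintegral_withDensity_eq_lintegral_mul _ hw (hg.pow_const p)] at h
  exact h

/-- The recursion for the weighted slab norms, the basis of Hardy's inequality. -/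
theorem exists_slabNorm_rpow_le_add (n : ℕ) {σ q p c : ℝ} (hq : 1 ≤ q) (hp : 1 ≤ p)
    (hc : 0 < c) (hc2 : c ≤ 2) : ∃ C : ℝ≥0∞, C ≠ ⊤ ∧ ∀ g : Euc (n + 1) → 𝕜, Measurable g →
      ∀ ε : ℝ, 0 ≤ ε → slabNorm σ q p g ε ^ (1 / p) ≤
        C * averagedBesov σ q p (upperHalfSpace n) g ^ (1 / p) +
          ENNReal.ofReal (c ^ (σ - 1 / q)) * slabNorm σ q p g (c * ε) ^ (1 / p) := by
  have hq0 : 0 < q := by linarith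
  have hp0 : 0 < p := by linarith
  have hpq : 0 ≤ p / q := by positivity
  have hp1 : 0 ≤ 1 / p := by positivity
  have hq1 : 0 ≤ 1 / q := by positivity
  have hqp : ∀ x : ℝ≥0∞, (x ^ (1 / q)) ^ p = x ^ (p / q) := fun x => by
    rw [← ENNReal.rpow_mul, one_div_mul_eq_div]
  -- The slabs of heights `r` and `c r` are compared with `ρ = 2 r`, which is admissible because `c
  -- ≤ 2`. The radius in `localDiff` is then `(n + 1) * (2 r) = b r`.
  set b : ℝ := (n + 1) * 2 with hb
  have hb0 : 0 < b := by positivity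
  set a : ℝ := σ * p + (n + 1 : ℕ) * (p / q) with ha
  set A : ℝ := (4 ^ n * c)⁻¹ with hA
  have hA0 : 0 ≤ A := by positivity
  set K : ℝ≥0∞ := ENNReal.ofReal (A ^ (p / q)) * ENNReal.ofReal (b ^ a) with hK
  have hK' : K ≠ ⊤ := ENNReal.mul_ne_top ENNReal.ofReal_ne_top ENNReal.ofReal_ne_top
  refine ⟨K ^ (1 / p), ENNReal.rpow_ne_top_of_nonneg hp1 hK', fun g hg ε hε => ?_⟩
  set w : ℝ → ℝ≥0∞ := fun r => ENNReal.ofReal (r ^ (-(σ * p) - 1)) with hwd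
  have hw : Measurable w := by fun_prop
  set F : ℝ → ℝ≥0∞ := fun r => (ENNReal.ofReal ((2 * (2 * r)) ^ n * (c * r))⁻¹ *
        localDiff q (upperHalfSpace n) g ((n + 1) * (2 * r))) ^ (1 / q) with hF
  set G : ℝ → ℝ≥0∞ := fun r => (ENNReal.ofReal (r / (c * r)) * slabMass q g (c * r)) ^ (1 / q)
    with hG
  have mF : Measurable F := by
    refine Measurable.pow_const (Measurable.mul (by fun_prop) ?_) _
    exact (measurable_localDiff q _ g).comp (by fun_prop)
  have mG : Measurable G := by
    refine Measurable.pow_const (Measurable.mul (by fun_prop) ?_) _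
    exact (measurable_slabMass q g).comp (by fun_prop)
  have h1 : slabNorm σ q p g ε ≤ ∫⁻ r in Set.Ioi ε, w r * (F r + G r) ^ p := by
    refine setLIntegral_mono' measurableSet_Ioi fun r hr => ?_
    have hr : 0 < r := lt_of_le_of_lt hε hr
    rw [← hqp]
    gcongr
    refine slabMass_rpow_le_add hq hg hr (by positivity) (by linarith) ?_
    gcongr
  have h2 : ∫⁻ r in Set.Ioi ε, w r * F r ^ p ≤ K * averagedBesov σ q p (upperHalfSpace n) g := by
    have e1 : ∀ r ∈ Set.Ioi ε, w r * F r ^ p = ENNReal.ofReal (A ^ (p / q)) *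
        (ENNReal.ofReal (r ^ (-a - 1)) *
          (fun r => localDiff q (upperHalfSpace n) g r ^ (p / q)) (b * r)) := by
      intro r hr
      have hr : 0 < r := lt_of_le_of_lt hε hr
      have e2 : ((2 * (2 * r)) ^ n * (c * r))⁻¹ = A * r ^ (-((n + 1 : ℕ) : ℝ)) := by
        rw [Real.rpow_neg hr.le, Real.rpow_natCast, hA]
        field_simp
        norm_num
        ring
      simp only [hF, hwd]
      rw [hqp, e2, ENNReal.mul_rpow_of_nonneg _ _ hpq, ENNReal.ofReal_rpow_of_nonneg (by positivity)
        hpq, Real.mul_rpow hA0 (by positivity), ENNReal.ofReal_mul (by positivity),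
        ← Real.rpow_mul hr.le]
      have e3 : r ^ (-a - 1) = r ^ (-(σ * p) - 1) * r ^ (-((n + 1 : ℕ) : ℝ) * (p / q)) := by
        rw [← Real.rpow_add hr, ha]
        congr 1
        ring
      rw [e3, ENNReal.ofReal_mul (by positivity), hb, mul_assoc ((n : ℝ) + 1)]
      ring
    rw [setLIntegral_congr_fun measurableSet_Ioi e1, lintegral_const_mul' _ _ ENNReal.ofReal_ne_top,
      hK, mul_assoc]
    refine mul_le_mul_right ?_ _
    refine (lintegral_mono_set (Set.Ioi_subset_Ioi hε)).trans (le_of_eq ?_)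
    rw [lintegral_Ioi_rpow_mul_comp_mul_left (fun r => localDiff q (upperHalfSpace n) g r ^ (p / q))
      hb0 le_rfl a, mul_zero]
    rfl
  -- The factor `c^(-p/q)` is the ratio of the slab heights, and substituting `c r` for `r` in the
  -- weight gives `c^(σ p)`. Their product, to the power `1 / p`, is `c^(σ - 1/q)`.
  have h3 : ∫⁻ r in Set.Ioi ε, w r * G r ^ p =
      ENNReal.ofReal (c ^ (σ * p - p / q)) * slabNorm σ q p g (c * ε) := by
    have e1 : ∀ r ∈ Set.Ioi ε, w r * G r ^ p = ENNReal.ofReal (c⁻¹ ^ (p / q)) *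
        (ENNReal.ofReal (r ^ (-(σ * p) - 1)) *
          (fun r => slabMass q g r ^ (p / q)) (c * r)) := by
      intro r hr
      have hr : 0 < r := lt_of_le_of_lt hε hr
      have e2 : r / (c * r) = c⁻¹ := by field_simp
      simp only [hG, hwd]
      rw [hqp, e2, ENNReal.mul_rpow_of_nonneg _ _ hpq, ENNReal.ofReal_rpow_of_nonneg (by positivity)
        hpq]
      ring
    rw [setLIntegral_congr_fun measurableSet_Ioi e1, lintegral_const_mul' _ _ ENNReal.ofReal_ne_top,
      lintegral_Ioi_rpow_mul_comp_mul_left (fun r => slabMass q g r ^ (p / q)) hc hε (σ * p),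
      ← mul_assoc,
      ← ENNReal.ofReal_mul (by positivity)]
    congr 2
    rw [sub_eq_add_neg, Real.rpow_add hc, Real.rpow_neg hc.le, Real.inv_rpow hc.le, mul_comm]
  calc slabNorm σ q p g ε ^ (1 / p)
      ≤ (∫⁻ r in Set.Ioi ε, w r * (F r + G r) ^ p) ^ (1 / p) := by gcongr
    _ ≤ (∫⁻ r in Set.Ioi ε, w r * F r ^ p) ^ (1 / p) +
        (∫⁻ r in Set.Ioi ε, w r * G r ^ p) ^ (1 / p) := lintegral_mul_rpow_add_le hp hw mF mG
    _ ≤ (K * averagedBesov σ q p (upperHalfSpace n) g) ^ (1 / p) +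
        (ENNReal.ofReal (c ^ (σ * p - p / q)) * slabNorm σ q p g (c * ε)) ^ (1 / p) := by
        rw [h3]; gcongr
    _ = _ := by
        have e : (σ * p - p / q) * (1 / p) = σ - 1 / q := by field_simp
        rw [ENNReal.mul_rpow_of_nonneg K _ hp1, ENNReal.mul_rpow_of_nonneg _ (slabNorm _ _ _ _ _) hp1,
          ENNReal.ofReal_rpow_of_nonneg (x := c ^ _) (by positivity) hp1, ← Real.rpow_mul hc.le, e]

theorem slabNorm_antitone (σ q p : ℝ) (g : Euc (n + 1) → 𝕜) : Antitone (slabNorm σ q p g) :=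
  fun _ _ h => lintegral_mono_set (Set.Ioi_subset_Ioi h)

/-- Away from `r = 0` the weight is integrable and the slab masses are at most the total mass. This
finiteness is what permits absorption. -/
theorem slabNorm_ne_top {σ q p : ℝ} (hσ : 0 < σ) (hq : 0 < q) (hp : 0 < p)
    {g : Euc (n + 1) → 𝕜} (hgq : ∫⁻ x in upperHalfSpace n, ‖g x‖ₑ ^ q ≠ ⊤) {ε : ℝ} (hε : 0 < ε) :
    slabNorm σ q p g ε ≠ ⊤ := by
  have hpq : 0 ≤ p / q := by positivity
  have h1 : slabNorm σ q p g ε ≤ ∫⁻ r in Set.Ioi ε, ENNReal.ofReal (r ^ (-(σ * p) - 1)) *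
      (∫⁻ x in upperHalfSpace n, ‖g x‖ₑ ^ q) ^ (p / q) := by
    refine lintegral_mono fun r => ?_
    gcongr
    exact lintegral_mono_set fun x hx => hx.1
  rw [lintegral_mul_const _ (by fun_prop), lintegral_Ioi_rpow hε (by positivity)] at h1
  exact ne_top_of_le_ne_top (ENNReal.mul_ne_top ENNReal.ofReal_ne_top
    (ENNReal.rpow_ne_top_of_nonneg hpq hgq)) h1

/-- Monotone convergence: bounds uniform in `ε` survive the limit `ε → 0`. -/
theorem lintegral_Ioi_zero_le {f : ℝ → ℝ≥0∞} {B : ℝ≥0∞}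
    (h : ∀ ε : ℝ, 0 < ε → ∫⁻ r in Set.Ioi ε, f r ≤ B) : ∫⁻ r in Set.Ioi 0, f r ≤ B := by
  have h1 : Set.Ioi (0 : ℝ) = ⋃ k : ℕ, Set.Ioi (1 / ((k : ℝ) + 1)) := by
    ext r
    simp only [Set.mem_Ioi, Set.mem_iUnion]
    exact ⟨fun hr => exists_nat_one_div_lt hr, fun ⟨k, hk⟩ => lt_trans (by positivity) hk⟩
  rw [h1, setLIntegral_iUnion_of_directed]
  · exact iSup_le fun k => h _ (by positivity)
  · refine Monotone.directed_le fun k l hkl => Set.Ioi_subset_Ioi ?_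
    exact one_div_le_one_div_of_le (by positivity) (by gcongr)

theorem le_of_le_add_mul_self {a b κ : ℝ≥0∞} (hκ : κ < 1) (ha : a ≠ ⊤) (h : a ≤ b + κ * a) :
    a ≤ (1 - κ)⁻¹ * b := by
  refine ennreal_le_inv_mul_of_mul_le (tsub_pos_of_lt hκ).ne'
    (ne_top_of_le_ne_top ENNReal.one_ne_top tsub_le_self) ?_
  rw [ENNReal.sub_mul fun _ _ => ha, one_mul]
  exact tsub_le_iff_right.2 h

/-- Hardy's inequality for `σ < 1 / q`. -/
theorem exists_slabNorm_le_of_lt (n : ℕ) {σ q p : ℝ} (hσ : 0 < σ) (hσq : σ < 1 / q) (hq : 1 ≤ q)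
    (hp : 1 ≤ p) : ∃ C : ℝ≥0∞, C ≠ ⊤ ∧ ∀ g : Euc (n + 1) → 𝕜, Measurable g →
      ∫⁻ x in upperHalfSpace n, ‖g x‖ₑ ^ q ≠ ⊤ →
        slabNorm σ q p g 0 ≤ C * averagedBesov σ q p (upperHalfSpace n) g := by
  obtain ⟨C, hC, h⟩ := exists_slabNorm_rpow_le_add (𝕜 := 𝕜) n (σ := σ) hq hp (c := 2)
    (by norm_num) le_rfl
  have hp0 : 0 < p := by linarith
  have hp1 : 0 ≤ 1 / p := by positivity
  set κ := ENNReal.ofReal ((2 : ℝ) ^ (σ - 1 / q)) with hκd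
  have hκ : κ < 1 := by
    rw [hκd, ENNReal.ofReal_lt_one]
    exact Real.rpow_lt_one_of_one_lt_of_neg (by norm_num) (by linarith)
  refine ⟨((1 - κ)⁻¹ * C) ^ p, ENNReal.rpow_ne_top_of_nonneg hp0.le (ENNReal.mul_ne_top
    (ENNReal.inv_ne_top.2 (tsub_pos_of_lt hκ).ne') hC), fun g hg hgq => ?_⟩
  refine lintegral_Ioi_zero_le fun ε hε => ?_
  change slabNorm σ q p g ε ≤ _
  have hfin := slabNorm_ne_top hσ (by linarith) hp0 hgq hε
  -- With `c = 2` the right side involves `2 ε ≥ ε`, hence a smaller norm; the recursion becomes `a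
  -- ≤ b + κ a` with `κ < 1`.
  have h1 := (h g hg ε hε.le).trans (add_le_add_right (mul_le_mul_right (ENNReal.rpow_le_rpow
    (slabNorm_antitone σ q p g (by linarith : ε ≤ 2 * ε)) hp1) κ) _)
  have h2 := le_of_le_add_mul_self hκ (ENNReal.rpow_ne_top_of_nonneg hp1 hfin) h1
  have h3 := ENNReal.rpow_le_rpow h2 hp0.le
  rw [← ENNReal.rpow_mul, one_div_mul_cancel hp0.ne', ENNReal.rpow_one, ← mul_assoc,
    ENNReal.mul_rpow_of_nonneg _ _ hp0.le, ← ENNReal.rpow_mul, one_div_mul_cancel hp0.ne',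
    ENNReal.rpow_one] at h3
  exact h3

end Hardy

/-! ### Triangle inequalities for the averaged seminorms. -/

section Minkowski

variable {𝕜 : Type*} [RCLike 𝕜] {d n : ℕ}

theorem localDiff_add_rpow_le {q : ℝ} (hq : 1 ≤ q) (Ω : Set (Euc d)) {f g : Euc d → 𝕜}
    (hf : Measurable f) (hg : Measurable g) (r : ℝ) :
    localDiff q Ω (f + g) r ^ (1 / q) ≤
      localDiff q Ω f r ^ (1 / q) + localDiff q Ω g r ^ (1 / q) := by
  have hq0 : 0 < q := by linarith
  rw [localDiff_eq_lintegral_prod (hf.add hg), localDiff_eq_lintegral_prod hf,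
    localDiff_eq_lintegral_prod hg]
  refine le_trans ?_ (ENNReal.lintegral_Lp_add_le
    (((hf.comp measurable_fst).sub (hf.comp measurable_snd)).enorm.aemeasurable)
    (((hg.comp measurable_fst).sub (hg.comp measurable_snd)).enorm.aemeasurable) hq)
  refine ENNReal.rpow_le_rpow (lintegral_mono fun z => ENNReal.rpow_le_rpow ?_ hq0.le)
    (by positivity)
  calc ‖(f + g) z.1 - (f + g) z.2‖ₑ = ‖(f z.1 - f z.2) + (g z.1 - g z.2)‖ₑ := by
        congr 1; simp only [Pi.add_apply]; abel
    _ ≤ _ := enorm_add_le _ _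

theorem slabMass_add_rpow_le {q : ℝ} (hq : 1 ≤ q) {f g : Euc (n + 1) → 𝕜}
    (hf : Measurable f) (hg : Measurable g) (r : ℝ) :
    slabMass q (f + g) r ^ (1 / q) ≤ slabMass q f r ^ (1 / q) + slabMass q g r ^ (1 / q) := by
  have hq0 : 0 < q := by linarith
  refine le_trans ?_ (ENNReal.lintegral_Lp_add_le hf.enorm.aemeasurable hg.enorm.aemeasurable hq)
  refine ENNReal.rpow_le_rpow (lintegral_mono fun x => ENNReal.rpow_le_rpow ?_ hq0.le)
    (by positivity)
  exact enorm_add_le _ _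

/-- The outer one of two triangle inequalities: the hypothesis is the inner one in `L_q` for each
radius, and this is Minkowski's inequality in `L_p` over the radii. -/
theorem lintegral_weight_rpow_le_add {p q : ℝ} (hp : 1 ≤ p) {S : Set ℝ}
    {w F₀ F₁ F₂ : ℝ → ℝ≥0∞} (hw : Measurable w) (h1 : Measurable F₁) (h2 : Measurable F₂)
    (h : ∀ r, F₀ r ^ (1 / q) ≤ F₁ r ^ (1 / q) + F₂ r ^ (1 / q)) :
    (∫⁻ r in S, w r * F₀ r ^ (p / q)) ^ (1 / p) ≤
      (∫⁻ r in S, w r * F₁ r ^ (p / q)) ^ (1 / p) + (∫⁻ r in S, w r * F₂ r ^ (p / q)) ^ (1 / p) := by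
  have hqp : ∀ x : ℝ≥0∞, x ^ (p / q) = (x ^ (1 / q)) ^ p := fun x => by
    rw [← ENNReal.rpow_mul, one_div_mul_eq_div]
  simp only [hqp]
  refine le_trans ?_ (lintegral_mul_rpow_add_le hp hw (h1.pow_const _) (h2.pow_const _))
  refine ENNReal.rpow_le_rpow (lintegral_mono fun r => ?_) (by positivity)
  exact mul_le_mul_right (ENNReal.rpow_le_rpow (h r) (by linarith)) _

theorem averagedBesov_add_rpow_le {σ q p : ℝ} (hq : 1 ≤ q) (hp : 1 ≤ p) (Ω : Set (Euc d))
    {f g : Euc d → 𝕜} (hf : Measurable f) (hg : Measurable g) :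
    averagedBesov σ q p Ω (f + g) ^ (1 / p) ≤
      averagedBesov σ q p Ω f ^ (1 / p) + averagedBesov σ q p Ω g ^ (1 / p) :=
  lintegral_weight_rpow_le_add hp (by fun_prop) (measurable_localDiff _ _ _)
    (measurable_localDiff _ _ _) fun r => localDiff_add_rpow_le hq Ω hf hg r

theorem slabNorm_add_rpow_le {σ q p : ℝ} (hq : 1 ≤ q) (hp : 1 ≤ p)
    {f g : Euc (n + 1) → 𝕜} (hf : Measurable f) (hg : Measurable g) (ε : ℝ) :
    slabNorm σ q p (f + g) ε ^ (1 / p) ≤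
      slabNorm σ q p f ε ^ (1 / p) + slabNorm σ q p g ε ^ (1 / p) :=
  lintegral_weight_rpow_le_add hp (by fun_prop) (measurable_slabMass _ _)
    (measurable_slabMass _ _) fun r => slabMass_add_rpow_le hq hf hg r

end Minkowski

/-! ### Hardy's inequality for `σ > 1 / q` and functions with zero trace. -/

section HardyWithTrace

variable {𝕜 : Type*} [RCLike 𝕜] {n : ℕ}

theorem slabMass_eq_lintegral_slice {q : ℝ} {g : Euc (n + 1) → 𝕜} (hg : Measurable g) (r : ℝ) :
    slabMass q g r = ∫⁻ t in Set.Ioo 0 r, ∫⁻ x' : Euc n, ‖g (slicePoint t x')‖ₑ ^ q := by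
  have m1 : Measurable ((slab n r).indicator fun x => ‖g x‖ₑ ^ q) :=
    (hg.enorm.pow_const q).indicator (measurableSet_slab r)
  have m2 : Measurable fun z : ℝ × Euc n =>
      (slab n r).indicator (fun x => ‖g x‖ₑ ^ q) (slicePoint z.1 z.2) :=
    m1.comp measurePreserving_slicePoint.measurable
  rw [slabMass, ← lintegral_indicator (measurableSet_slab r),
    ← measurePreserving_slicePoint.lintegral_comp m1, lintegral_prod _ m2.aemeasurable,
    ← lintegral_indicator measurableSet_Ioo]
  refine lintegral_congr fun t => ?_
  have h : ∀ x' : Euc n, slicePoint t x' ∈ slab n r ↔ t ∈ Set.Ioo 0 r := fun x' => by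
    simp [slab]
  by_cases ht : t ∈ Set.Ioo 0 r
  · rw [Set.indicator_of_mem ht]
    exact lintegral_congr fun x' => Set.indicator_of_mem ((h x').2 ht) _
  · rw [Set.indicator_of_notMem ht]
    have : ∀ x' : Euc n, (slab n r).indicator (fun x => ‖g x‖ₑ ^ q) (slicePoint t x') = 0 :=
      fun x' => Set.indicator_of_notMem (fun h' => ht ((h x').1 h')) _
    simp [this]

/-- For smooth functions, the mean of `|G|^q` over thin slabs is controlled by the trace. -/
theorem exists_slabMass_le_trace_add {q : ℝ} (hq : 1 ≤ q) {G : Euc (n + 1) → 𝕜}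
    (hG : ContDiff ℝ ∞ G) (hc : HasCompactSupport G) : ∃ L : ℝ≥0∞, L ≠ ⊤ ∧ ∀ r : ℝ, 0 < r →
      slabMass q G r ≤ ENNReal.ofReal r *
        (eLpNorm (fun x' => G (boundaryPoint x')) (ENNReal.ofReal q) volume +
          L * ENNReal.ofReal r) ^ q := by
  have hq0 : 0 < q := by linarith
  obtain ⟨K, hK⟩ := ContDiff.lipschitzWith_of_hasCompactSupport hc hG (by simp)
  obtain ⟨R, hR⟩ := hc.isCompact.isBounded.subset_closedBall (0 : Euc (n + 1))
  set L : ℝ≥0∞ := K * volume (Metric.closedBall (0 : Euc n) R) ^ (1 / q) with hL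
  have hq' : ENNReal.ofReal q ≠ 0 := by simpa using hq0
  have hLt : L ≠ ⊤ := ENNReal.mul_ne_top ENNReal.coe_ne_top
    (ENNReal.rpow_ne_top_of_nonneg (by positivity) measure_closedBall_lt_top.ne)
  refine ⟨L, hLt, fun r hr => ?_⟩
  set T := eLpNorm (fun x' : Euc n => G (boundaryPoint x')) (ENNReal.ofReal q) volume
  have hcont : ∀ t : ℝ, Continuous fun x' : Euc n => G (slicePoint t x') := fun t => by
    simp only [slicePoint_eq_add]
    exact hG.continuous.comp (isometry_boundaryPoint.continuous.add continuous_const)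
  have hslice : ∀ t ∈ Set.Ioo 0 r, ∫⁻ x' : Euc n, ‖G (slicePoint t x')‖ₑ ^ q ≤
      (T + L * ENNReal.ofReal r) ^ q := by
    intro t ht
    have h1 : ∫⁻ x' : Euc n, ‖G (slicePoint t x')‖ₑ ^ q =
        eLpNorm (fun x' => G (slicePoint t x')) (ENNReal.ofReal q) volume ^ q := by
      rw [eLpNorm_ofReal_eq hq0, ← ENNReal.rpow_mul, one_div_mul_cancel hq0.ne', ENNReal.rpow_one]
    rw [h1]
    refine ENNReal.rpow_le_rpow ?_ hq0.le
    have h2 : (fun x' : Euc n => G (slicePoint t x')) = (fun x' => G (boundaryPoint x')) +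
        fun x' => G (slicePoint t x') - G (boundaryPoint x') := by
      ext x'; simp
    rw [h2]
    refine (eLpNorm_add_le (hcont 0).aestronglyMeasurable
      ((hcont t).sub (hcont 0)).aestronglyMeasurable (by simpa using hq)).trans ?_
    refine add_le_add_right ?_ T
    -- The Lipschitz bound along the normal line; outside the ball containing the projected support,
    -- both values are zero.
    have h3 : ∀ x' : Euc n, ‖G (slicePoint t x') - G (boundaryPoint x')‖ ≤
        ‖(Metric.closedBall (0 : Euc n) R).indicator (fun _ => (K : ℝ) * t) x'‖ := by
      intro x'
      by_cases hx : x' ∈ Metric.closedBall (0 : Euc n) R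
      · rw [Set.indicator_of_mem hx, Real.norm_of_nonneg (mul_nonneg K.coe_nonneg ht.1.le), ← dist_eq_norm]
        refine (hK.dist_le_mul _ _).trans (le_of_eq ?_)
        rw [slicePoint_eq_add, dist_eq_norm, add_sub_cancel_left, norm_smul]
        simp [abs_of_pos ht.1]
      · have hz : ∀ s : ℝ, G (slicePoint s x') = 0 := by
          intro s
          refine image_eq_zero_of_notMem_tsupport fun hs => hx ?_
          have := hR hs
          rw [mem_closedBall_zero_iff] at this ⊢
          exact (norm_le_norm_slicePoint s x').trans this
        rw [← slicePoint_zero, hz, hz]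
        simp
    refine (eLpNorm_mono h3).trans ?_
    rw [eLpNorm_indicator_const (Metric.isClosed_closedBall (x := (0 : Euc n)) (ε := R)).measurableSet hq'
      ENNReal.ofReal_ne_top, ENNReal.toReal_ofReal hq0.le, hL]
    have h4 : ‖(K : ℝ) * t‖ₑ ≤ K * ENNReal.ofReal r := by
      rw [enorm_mul, Real.enorm_eq_ofReal ht.1.le, Real.enorm_eq_ofReal K.coe_nonneg,
        ENNReal.ofReal_coe_nnreal]
      gcongr
      exact ht.2.le
    calc _ ≤ K * ENNReal.ofReal r * volume (Metric.closedBall (0 : Euc n) R) ^ (1 / q) := by gcongr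
      _ = _ := by ring
  rw [slabMass_eq_lintegral_slice hG.continuous.measurable]
  refine (setLIntegral_mono' measurableSet_Ioo hslice).trans (le_of_eq ?_)
  rw [setLIntegral_const, Real.volume_Ioo, sub_zero, mul_comm]

/-- The slab mass is at most a multiple of `r` times the trace term plus `O(r^(1 + q))` for `r ≤ 1`,
and at most the total mass for `r > 1`. With `s = σ q - 1`, both errors are `O(r^(1 + s/2))`. The
intermediate exponent makes the error integrable at infinity and gives `δ^(-s/2)`, less singular
than the factor `δ^(-s)` of the trace. -/
theorem exists_slabNorm_le_trace {σ q : ℝ} (hq : 1 < q) (hσ : 1 / q < σ) (hσ1 : σ < 1)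
    {G : Euc (n + 1) → 𝕜} (hG : ContDiff ℝ ∞ G) (hc : HasCompactSupport G) :
    ∃ Y : ℝ≥0∞, Y ≠ ⊤ ∧ ∀ δ : ℝ, 0 < δ → slabNorm σ q q G δ ≤
      2 ^ q * (eLpNorm (fun x' => G (boundaryPoint x')) (ENNReal.ofReal q) volume ^ q *
        ENNReal.ofReal (δ ^ (-(σ * q - 1)) / (σ * q - 1))) +
      Y * ENNReal.ofReal (δ ^ (-((σ * q - 1) / 2))) := by
  have hq0 : 0 < q := by linarith
  have hs : 0 < σ * q - 1 := by
    rw [div_lt_iff₀ hq0] at hσ; linarith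
  have hsq : (σ * q - 1) / 2 ≤ q := by nlinarith
  set s := σ * q - 1 with hsd
  have h2q : (2 : ℝ≥0∞) ^ q ≠ ⊤ := ENNReal.rpow_ne_top_of_nonneg hq0.le (by simp)
  obtain ⟨L, hL, hLm⟩ := exists_slabMass_le_trace_add hq.le hG hc
  set T := eLpNorm (fun x' : Euc n => G (boundaryPoint x')) (ENNReal.ofReal q) volume
  set M := ∫⁻ x, ‖G x‖ₑ ^ q with hM
  have hM' : M ≠ ⊤ := by
    have h1 : eLpNorm G (ENNReal.ofReal q) volume ≠ ⊤ :=
      (hG.continuous.memLp_of_hasCompactSupport hc).eLpNorm_ne_top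
    rw [eLpNorm_ofReal_eq hq0] at h1
    intro h
    rw [← hM, h, ENNReal.top_rpow_of_pos (by positivity)] at h1
    exact h1 rfl
  set Z : ℝ≥0∞ := 2 ^ q * L ^ q + M with hZ
  have hZ' : Z ≠ ⊤ := ENNReal.add_ne_top.2
    ⟨ENNReal.mul_ne_top h2q (ENNReal.rpow_ne_top_of_nonneg hq0.le hL), hM'⟩
  have key : ∀ r : ℝ, 0 < r → slabMass q G r ≤
      2 ^ q * T ^ q * ENNReal.ofReal r + Z * ENNReal.ofReal (r ^ (1 + s / 2)) := by
    intro r hr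
    rcases le_or_gt r 1 with h1 | h1
    · calc slabMass q G r ≤ ENNReal.ofReal r * (T + L * ENNReal.ofReal r) ^ q := hLm r hr
        _ ≤ ENNReal.ofReal r * (2 ^ q * (T ^ q + (L * ENNReal.ofReal r) ^ q)) := by
            gcongr; exact add_rpow_le hq.le _ _
        _ = 2 ^ q * T ^ q * ENNReal.ofReal r + 2 ^ q * L ^ q * ENNReal.ofReal (r ^ (1 + q)) := by
            rw [ENNReal.mul_rpow_of_nonneg _ _ hq0.le, ENNReal.ofReal_rpow_of_nonneg hr.le hq0.le,
              Real.rpow_add hr, Real.rpow_one, ENNReal.ofReal_mul hr.le]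
            ring
        _ ≤ 2 ^ q * T ^ q * ENNReal.ofReal r + Z * ENNReal.ofReal (r ^ (1 + s / 2)) := by
            refine add_le_add_right (mul_le_mul' le_self_add (ENNReal.ofReal_le_ofReal ?_)) _
            exact Real.rpow_le_rpow_of_exponent_ge hr h1 (by linarith)
    · calc slabMass q G r ≤ M := setLIntegral_le_lintegral _ _
        _ ≤ Z * 1 := by rw [mul_one]; exact le_add_self
        _ ≤ Z * ENNReal.ofReal (r ^ (1 + s / 2)) := by
            gcongr
            rw [ENNReal.one_le_ofReal]
            exact Real.one_le_rpow h1.le (by positivity)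
        _ ≤ _ := le_add_self
  refine ⟨Z * ENNReal.ofReal (s / 2)⁻¹, ENNReal.mul_ne_top hZ' ENNReal.ofReal_ne_top,
    fun δ hδ => ?_⟩
  have step : slabNorm σ q q G δ ≤ ∫⁻ r in Set.Ioi δ, (2 ^ q * T ^ q *
      ENNReal.ofReal (r ^ (-s - 1)) + Z * ENNReal.ofReal (r ^ (-(s / 2) - 1))) := by
    refine setLIntegral_mono' measurableSet_Ioi fun r hr => ?_
    have hr : 0 < r := hδ.trans hr
    rw [div_self hq0.ne', ENNReal.rpow_one]
    refine (mul_le_mul_right (key r hr) _).trans (le_of_eq ?_)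
    have e1 : r ^ (-s - 1) = r ^ (-(σ * q) - 1) * r := by
      rw [← Real.rpow_add_one hr.ne']; congr 1; rw [hsd]; ring
    have e2 : r ^ (-(s / 2) - 1) = r ^ (-(σ * q) - 1) * r ^ (1 + s / 2) := by
      rw [← Real.rpow_add hr]; congr 1; rw [hsd]; ring
    rw [e1, e2, ENNReal.ofReal_mul (by positivity), ENNReal.ofReal_mul (by positivity)]
    ring
  refine step.trans ?_
  rw [lintegral_add_right _ (by fun_prop), lintegral_const_mul _ (by fun_prop),
    lintegral_const_mul _ (by fun_prop), lintegral_Ioi_rpow hδ hs,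
    lintegral_Ioi_rpow hδ (by positivity), div_eq_mul_inv _ (s / 2),
    ENNReal.ofReal_mul (by positivity)]
  refine le_of_eq ?_
  ring

/-- The partial geometric sums are bounded by `(1 - κ)⁻¹`, written as the fixed point identity `h1`.
No finiteness of `F` is needed, since nothing is absorbed. -/
theorem le_add_pow_mul_of_recursion {F : ℝ → ℝ≥0∞} {B κ : ℝ≥0∞} (hκ : κ < 1) {c : ℝ}
    (h : ∀ ε, 0 < ε → F ε ≤ B + κ * F (c * ε)) (hc : 0 < c) (k : ℕ) {ε : ℝ} (hε : 0 < ε) :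
    F ε ≤ (1 - κ)⁻¹ * B + κ ^ k * F (c ^ k * ε) := by
  have h1 : (1 : ℝ≥0∞) + κ * (1 - κ)⁻¹ = (1 - κ)⁻¹ := by
    have hne : (1 - κ) ≠ 0 := (tsub_pos_of_lt hκ).ne'
    have hnt : (1 - κ) ≠ ⊤ := ne_top_of_le_ne_top ENNReal.one_ne_top tsub_le_self
    calc (1 : ℝ≥0∞) + κ * (1 - κ)⁻¹ = (1 - κ) * (1 - κ)⁻¹ + κ * (1 - κ)⁻¹ := by
          rw [ENNReal.mul_inv_cancel hne hnt]
      _ = (1 - κ + κ) * (1 - κ)⁻¹ := by rw [add_mul]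
      _ = (1 - κ)⁻¹ := by rw [tsub_add_cancel_of_le hκ.le, one_mul]
  induction k generalizing ε with
  | zero => simp
  | succ k ih =>
    calc F ε ≤ B + κ * F (c * ε) := h ε hε
      _ ≤ B + κ * ((1 - κ)⁻¹ * B + κ ^ k * F (c ^ k * (c * ε))) := by
          gcongr; exact ih (by positivity)
      _ = (1 + κ * (1 - κ)⁻¹) * B + κ ^ (k + 1) * F (c ^ (k + 1) * ε) := by
          rw [pow_succ c, mul_assoc (c ^ k)]; ring
      _ = _ := by rw [h1]

/-- Hardy's inequality for `σ > 1 / q` and smooth functions, with the trace as an error term. -/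
theorem slabNorm_le_add_trace {σ q : ℝ} (hq : 1 < q) (hσ : 1 / q < σ) (hσ1 : σ < 1)
    {C : ℝ≥0∞} {G : Euc (n + 1) → 𝕜} (hG : ContDiff ℝ ∞ G) (hc : HasCompactSupport G)
    (h : ∀ ε : ℝ, 0 < ε → slabNorm σ q q G ε ^ (1 / q) ≤ C +
      ENNReal.ofReal ((1 / 2) ^ (σ - 1 / q)) * slabNorm σ q q G (1 / 2 * ε) ^ (1 / q))
    {ε : ℝ} (hε : 0 < ε) :
    slabNorm σ q q G ε ^ (1 / q) ≤ (1 - ENNReal.ofReal ((1 / 2) ^ (σ - 1 / q)))⁻¹ * C +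
      (2 ^ q * (eLpNorm (fun x' => G (boundaryPoint x')) (ENNReal.ofReal q) volume ^ q *
        ENNReal.ofReal (ε ^ (-(σ * q - 1)) / (σ * q - 1)))) ^ (1 / q) := by
  have hq0 : 0 < q := by linarith
  have hs : 0 < σ * q - 1 := by
    rw [div_lt_iff₀ hq0] at hσ; linarith
  set s := σ * q - 1 with hsd
  set κ := ENNReal.ofReal ((1 / 2 : ℝ) ^ (σ - 1 / q)) with hκd
  have hκ : κ < 1 := by
    rw [hκd, ENNReal.ofReal_lt_one]
    exact Real.rpow_lt_one (by norm_num) (by norm_num) (by linarith)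
  obtain ⟨Y, hY, hbd⟩ := exists_slabNorm_le_trace hq hσ hσ1 hG hc
  set T := eLpNorm (fun x' : Euc n => G (boundaryPoint x')) (ENNReal.ofReal q) volume
  set X := 2 ^ q * (T ^ q * ENNReal.ofReal (ε ^ (-s) / s)) with hX
  -- The factor by which the error term shrinks in each step of the iteration.
  set ν := ENNReal.ofReal ((1 / 2 : ℝ) ^ (s / 2)) with hνd
  have hν : ν < 1 := by
    rw [hνd, ENNReal.ofReal_lt_one]
    exact Real.rpow_lt_one (by norm_num) (by norm_num) (by linarith)
  have hiter : ∀ k : ℕ, slabNorm σ q q G ε ^ (1 / q) ≤ (1 - κ)⁻¹ * C +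
      (X + Y * ENNReal.ofReal (ε ^ (-(s / 2))) * ν ^ k) ^ (1 / q) := by
    intro k
    refine (le_add_pow_mul_of_recursion (F := fun ε => slabNorm σ q q G ε ^ (1 / q)) hκ h
      (by norm_num) k hε).trans ?_
    refine add_le_add_right ?_ _
    have e1 : κ ^ k = (ENNReal.ofReal (((1 / 2 : ℝ) ^ k) ^ s)) ^ (1 / q) := by
      rw [ENNReal.ofReal_rpow_of_nonneg (by positivity) (by positivity), hκd,
        ← ENNReal.ofReal_pow (by positivity), ← Real.rpow_natCast ((1 / 2 : ℝ) ^ (σ - 1 / q)),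
        ← Real.rpow_natCast (1 / 2 : ℝ), ← Real.rpow_mul (by norm_num),
        ← Real.rpow_mul (by norm_num), ← Real.rpow_mul (by norm_num)]
      congr 2
      rw [hsd]
      field_simp
    rw [e1, ← ENNReal.mul_rpow_of_nonneg _ _ (by positivity)]
    refine ENNReal.rpow_le_rpow ?_ (by positivity)
    set a : ℝ := (1 / 2 : ℝ) ^ k with had
    have ha : 0 < a := by positivity
    refine (mul_le_mul_right (hbd (a * ε) (by positivity)) _).trans (le_of_eq ?_)
    -- The factor `κ ^ k` and the singularity of the trace term at `a ε` cancel exactly, so that the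
    -- trace term is the same for all `k`; by `e3` the error term retains a factor `a^(s/2)` and
    -- disappears as `k → ∞`.
    have e2 : a ^ s * ((a * ε) ^ (-s) / s) = ε ^ (-s) / s := by
      rw [Real.mul_rpow ha.le hε.le, Real.rpow_neg ha.le]
      field_simp
    have e3 : a ^ s * (a * ε) ^ (-(s / 2)) = ε ^ (-(s / 2)) * a ^ (s / 2) := by
      rw [Real.mul_rpow ha.le hε.le, ← mul_assoc, ← Real.rpow_add ha, mul_comm]
      congr 2
      ring
    have e4 : ENNReal.ofReal (a ^ (s / 2)) = ν ^ k := by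
      rw [hνd, ← ENNReal.ofReal_pow (by positivity), had, ← Real.rpow_natCast, ← Real.rpow_natCast,
        ← Real.rpow_mul (by norm_num), ← Real.rpow_mul (by norm_num), mul_comm]
    calc ENNReal.ofReal (a ^ s) * (2 ^ q * (T ^ q * ENNReal.ofReal ((a * ε) ^ (-s) / s)) +
          Y * ENNReal.ofReal ((a * ε) ^ (-(s / 2))))
        = 2 ^ q * (T ^ q * (ENNReal.ofReal (a ^ s) * ENNReal.ofReal ((a * ε) ^ (-s) / s))) +
          Y * (ENNReal.ofReal (a ^ s) * ENNReal.ofReal ((a * ε) ^ (-(s / 2)))) := by ring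
      _ = _ := by
        rw [← ENNReal.ofReal_mul (by positivity), ← ENNReal.ofReal_mul (by positivity), e2, e3,
          ENNReal.ofReal_mul (by positivity), e4, hX]
        ring
  have hlim : Tendsto (fun k : ℕ => (1 - κ)⁻¹ * C +
      (X + Y * ENNReal.ofReal (ε ^ (-(s / 2))) * ν ^ k) ^ (1 / q)) atTop
      (𝓝 ((1 - κ)⁻¹ * C + X ^ (1 / q))) := by
    refine tendsto_const_nhds.add ?_
    have h1 : Tendsto (fun k : ℕ => Y * ENNReal.ofReal (ε ^ (-(s / 2))) * ν ^ k) atTop (𝓝 0) := by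
      have := ENNReal.Tendsto.const_mul (a := Y * ENNReal.ofReal (ε ^ (-(s / 2))))
        (ENNReal.tendsto_pow_atTop_nhds_zero_of_lt_one hν)
        (Or.inr (ENNReal.mul_ne_top hY ENNReal.ofReal_ne_top))
      simpa using this
    have h2 : Tendsto (fun k : ℕ => X + Y * ENNReal.ofReal (ε ^ (-(s / 2))) * ν ^ k) atTop (𝓝 X) := by
      simpa using tendsto_const_nhds.add h1
    exact (ENNReal.continuous_rpow_const.tendsto X).comp h2
  exact ge_of_tendsto' hlim hiter

/-- Hardy's inequality for `σ > 1 / q` and functions with vanishing trace. -/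
theorem exists_slabNorm_le_of_gt (n : ℕ) {σ q : ℝ} (hq : 1 < q) (hσ : 1 / q < σ) (hσ1 : σ < 1) :
    ∃ C : ℝ≥0∞, C ≠ ⊤ ∧ ∀ (g : Euc (n + 1) → 𝕜) (G : ℕ → Euc (n + 1) → 𝕜), Measurable g →
      (∀ j, ContDiff ℝ ∞ (G j)) → (∀ j, HasCompactSupport (G j)) →
      Tendsto (fun j => averagedBesov σ q q (upperHalfSpace n) (G j - g)) atTop (𝓝 0) →
      Tendsto (fun j => ∫⁻ x in upperHalfSpace n, ‖(G j - g) x‖ₑ ^ q) atTop (𝓝 0) →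
      Tendsto (fun j => eLpNorm (fun x' => G j (boundaryPoint x')) (ENNReal.ofReal q) volume)
        atTop (𝓝 0) →
      slabNorm σ q q g 0 ≤ C * averagedBesov σ q q (upperHalfSpace n) g := by
  have hq0 : 0 < q := by linarith
  have hq1 : 0 < 1 / q := by positivity
  have hσ0 : 0 < σ := hq1.trans hσ
  obtain ⟨C, hC, hrec⟩ := exists_slabNorm_rpow_le_add (𝕜 := 𝕜) n (σ := σ) hq.le hq.le (c := 1 / 2)
    (by norm_num) (by norm_num)
  set κ := ENNReal.ofReal ((1 / 2 : ℝ) ^ (σ - 1 / q)) with hκd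
  have hκ : κ < 1 := by
    rw [hκd, ENNReal.ofReal_lt_one]
    exact Real.rpow_lt_one (by norm_num) (by norm_num) (by linarith)
  set A : ℝ≥0∞ := (1 - κ)⁻¹ * C with hA
  have hA' : A ≠ ⊤ := ENNReal.mul_ne_top (ENNReal.inv_ne_top.2 (tsub_pos_of_lt hκ).ne') hC
  refine ⟨A ^ q, ENNReal.rpow_ne_top_of_nonneg hq0.le hA', fun g G hg hG hc hJ hI hT => ?_⟩
  refine lintegral_Ioi_zero_le fun ε hε => ?_
  change slabNorm σ q q g ε ≤ _
  have hGm : ∀ j, Measurable (G j) := fun j => (hG j).continuous.measurable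
  set J := fun j => averagedBesov σ q q (upperHalfSpace n) (G j - g)
  set I := fun j => ∫⁻ x in upperHalfSpace n, ‖(G j - g) x‖ₑ ^ q
  set T := fun j => eLpNorm (fun x' => G j (boundaryPoint x')) (ENNReal.ofReal q) volume
  set D := ENNReal.ofReal (ε ^ (-(σ * q - 1)) / (σ * q - 1))
  set W := ENNReal.ofReal (ε ^ (-(σ * q)) / (σ * q))
  -- The constants `D` and `W` blow up as `ε → 0`, but `ε` is fixed while `j → ∞`, and the limit no
  -- longer contains them.
  have main : ∀ j, slabNorm σ q q g ε ^ (1 / q) ≤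
      (A * (averagedBesov σ q q (upperHalfSpace n) g ^ (1 / q) + J j ^ (1 / q)) +
        (2 ^ q * (T j ^ q * D)) ^ (1 / q)) + (W * I j) ^ (1 / q) := by
    intro j
    have s1 : slabNorm σ q q g ε ^ (1 / q) ≤
        slabNorm σ q q (G j) ε ^ (1 / q) + slabNorm σ q q (g - G j) ε ^ (1 / q) := by
      have := slabNorm_add_rpow_le (σ := σ) hq.le hq.le (hGm j) (hg.sub (hGm j)) ε
      rwa [add_sub_cancel] at this
    have s2 : slabNorm σ q q (g - G j) ε ≤ W * I j := by
      have : ∀ r, slabMass q (g - G j) r ≤ I j := fun r => by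
        refine le_trans (lintegral_mono_set (fun x hx => hx.1)) (le_of_eq ?_)
        refine lintegral_congr fun x => ?_
        rw [← enorm_neg]; simp
      unfold slabNorm
      calc _ ≤ ∫⁻ r in Set.Ioi ε, ENNReal.ofReal (r ^ (-(σ * q) - 1)) * I j := by
            refine lintegral_mono fun r => ?_
            rw [div_self hq0.ne', ENNReal.rpow_one]
            exact mul_le_mul_right (this r) _
        _ = W * I j := by
            rw [lintegral_mul_const _ (by fun_prop), lintegral_Ioi_rpow hε (by positivity)]
    have s3 : averagedBesov σ q q (upperHalfSpace n) (G j) ^ (1 / q) ≤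
        averagedBesov σ q q (upperHalfSpace n) g ^ (1 / q) + J j ^ (1 / q) := by
      have := averagedBesov_add_rpow_le (σ := σ) hq.le hq.le (upperHalfSpace n) hg ((hGm j).sub hg)
      rwa [add_sub_cancel] at this
    have s4 := slabNorm_le_add_trace hq hσ hσ1 (hG j) (hc j)
      (fun ε hε => hrec (G j) (hGm j) ε hε.le) hε
    refine s1.trans (add_le_add (s4.trans (add_le_add_left ?_ _))
      (ENNReal.rpow_le_rpow s2 hq1.le))
    rw [← mul_assoc]
    exact mul_le_mul_right s3 _
  have hrp : ∀ {f : ℕ → ℝ≥0∞} {a : ℝ}, 0 < a → Tendsto f atTop (𝓝 0) →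
      Tendsto (fun j => f j ^ a) atTop (𝓝 0) := by
    intro f a ha hf
    have := (ENNReal.continuous_rpow_const (y := a)).tendsto 0
    rw [ENNReal.zero_rpow_of_pos ha] at this
    exact this.comp hf
  have hlim : Tendsto (fun j => (A * (averagedBesov σ q q (upperHalfSpace n) g ^ (1 / q) +
      J j ^ (1 / q)) + (2 ^ q * (T j ^ q * D)) ^ (1 / q)) + (W * I j) ^ (1 / q)) atTop
      (𝓝 (A * averagedBesov σ q q (upperHalfSpace n) g ^ (1 / q))) := by
    have l1 : Tendsto (fun j => A * (averagedBesov σ q q (upperHalfSpace n) g ^ (1 / q) +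
        J j ^ (1 / q))) atTop (𝓝 (A * averagedBesov σ q q (upperHalfSpace n) g ^ (1 / q))) := by
      refine ENNReal.Tendsto.const_mul ?_ (Or.inr hA')
      simpa using tendsto_const_nhds.add (hrp hq1 hJ)
    have l2 : Tendsto (fun j => (2 ^ q * (T j ^ q * D)) ^ (1 / q)) atTop (𝓝 0) := by
      refine hrp hq1 ?_
      have h1 : Tendsto (fun j => T j ^ q * D) atTop (𝓝 0) := by
        simpa using ENNReal.Tendsto.mul_const (hrp hq0 hT) (Or.inr (ENNReal.ofReal_ne_top))
      simpa using ENNReal.Tendsto.const_mul (a := (2 : ℝ≥0∞) ^ q) h1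
        (Or.inr (ENNReal.rpow_ne_top_of_nonneg hq0.le (by simp)))
    have l3 : Tendsto (fun j => (W * I j) ^ (1 / q)) atTop (𝓝 0) := by
      refine hrp hq1 ?_
      simpa using ENNReal.Tendsto.const_mul (a := W) hI (Or.inr ENNReal.ofReal_ne_top)
    simpa using (l1.add l2).add l3
  have h3 := ENNReal.rpow_le_rpow (ge_of_tendsto' hlim main) hq0.le
  rw [← ENNReal.rpow_mul, one_div_mul_cancel hq0.ne', ENNReal.rpow_one,
    ENNReal.mul_rpow_of_nonneg _ _ hq0.le, ← ENNReal.rpow_mul, one_div_mul_cancel hq0.ne',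
    ENNReal.rpow_one] at h3
  exact h3

end HardyWithTrace

/-! ### Independence of representatives. -/

section Congruence

variable {𝕜 : Type*} [RCLike 𝕜] {d n : ℕ}

theorem localDiff_congr_ae {Ω : Set (Euc d)} {g g' : Euc d → 𝕜}
    (h : g =ᵐ[volume.restrict Ω] g') (q r : ℝ) : localDiff q Ω g r = localDiff q Ω g' r := by
  refine lintegral_congr_ae ?_
  filter_upwards [h] with x hx
  refine lintegral_congr_ae ?_
  filter_upwards [h] with y hy
  rw [hx, hy]

theorem averagedBesov_congr_ae {σ q p : ℝ} {Ω : Set (Euc d)} {g g' : Euc d → 𝕜}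
    (h : g =ᵐ[volume.restrict Ω] g') : averagedBesov σ q p Ω g = averagedBesov σ q p Ω g' := by
  unfold averagedBesov
  simp only [localDiff_congr_ae h]

theorem slobodeckijSeminorm_congr_ae {σ q : ℝ} {g g' : Euc d → 𝕜} (h : g =ᵐ[volume] g') :
    slobodeckijSeminorm σ q g = slobodeckijSeminorm σ q g' := by
  unfold slobodeckijSeminorm
  congr 1
  refine lintegral_congr_ae ?_
  filter_upwards [h] with x hx
  refine lintegral_congr_ae ?_
  filter_upwards [h] with y hy
  rw [hx, hy]

theorem fwdDiff_iterate_congr_ae {g g' : Euc d → 𝕜} (h : g =ᵐ[volume] g') (v : Euc d) (k : ℕ) :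
    (fwdDiff v)^[k] g =ᵐ[volume] (fwdDiff v)^[k] g' := by
  induction k generalizing g g' with
  | zero => exact h
  | succ k ih =>
    rw [Function.iterate_succ_apply, Function.iterate_succ_apply]
    refine ih ?_
    have h1 : ∀ᵐ x : Euc d, g (x + v) = g' (x + v) :=
      (measurePreserving_add_right volume v).quasiMeasurePreserving.ae h
    filter_upwards [h, h1] with x hx hx1
    simp [fwdDiff, hx, hx1]

theorem besovSeminorm_congr_ae {σ q p : ℝ} {g g' : Euc d → 𝕜} (h : g =ᵐ[volume] g') :
    besovSeminorm σ q p g = besovSeminorm σ q p g' := by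
  unfold besovSeminorm
  congr 1
  refine lintegral_congr fun v => ?_
  rw [eLpNorm_congr_ae (fwdDiff_iterate_congr_ae h v _)]

end Congruence

/-! ### Bounds for the seminorms of reflections. -/

section SeminormBounds

variable {𝕜 : Type*} [RCLike 𝕜] {d n : ℕ}

theorem lintegral_rpow_ne_top_of_eLpNorm {q : ℝ} (hq : 0 < q) {g : Euc d → 𝕜}
    (h : eLpNorm g (ENNReal.ofReal q) volume ≠ ⊤) : ∫⁻ x, ‖g x‖ₑ ^ q ≠ ⊤ := by
  rw [eLpNorm_ofReal_eq hq] at h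
  intro h'
  rw [h', ENNReal.top_rpow_of_pos (by positivity)] at h
  exact h rfl

/-- For `σ < 1 / q`, Hardy's inequality holds without a boundary condition, so odd reflections are
as harmless as even ones. -/
theorem exists_averagedBesov_signedReflection_le (n : ℕ) {σ q p : ℝ} (hσ : 0 < σ)
    (hσq : σ < 1 / q) (hq : 1 ≤ q) (hqp : q ≤ p) :
    ∃ C : ℝ≥0∞, C ≠ ⊤ ∧ ∀ g : Euc (n + 1) → 𝕜, Measurable g →
      eLpNorm g (ENNReal.ofReal q) volume ≠ ⊤ → ∀ s : ℝ, s = 1 ∨ s = -1 →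
      averagedBesov σ q p Set.univ (signedReflection s g) ≤
        C * averagedBesov σ q p Set.univ g := by
  have hq0 : 0 < q := by linarith
  have hpq : 0 ≤ p / q := by have := hq0.trans_le hqp; positivity
  obtain ⟨C₁, hC₁, h₁⟩ := exists_averagedBesov_oddReflection_le (𝕜 := 𝕜) n (σ := σ) hq hqp
  obtain ⟨C₂, hC₂, h₂⟩ := exists_slabNorm_le_of_lt (𝕜 := 𝕜) n hσ hσq hq (hq.trans hqp)
  refine ⟨4 ^ (p / q) + C₁ * (1 + C₂), ENNReal.add_ne_top.2
    ⟨ENNReal.rpow_ne_top_of_nonneg hpq (by simp), ENNReal.mul_ne_top hC₁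
      (ENNReal.add_ne_top.2 ⟨ENNReal.one_ne_top, hC₂⟩)⟩, fun g hg hgq s hs => ?_⟩
  have hmono := averagedBesov_mono_set (σ := σ) hpq (Set.subset_univ (upperHalfSpace n)) g
  have hfin : ∫⁻ x in upperHalfSpace n, ‖g x‖ₑ ^ q ≠ ⊤ :=
    ne_top_of_le_ne_top (lintegral_rpow_ne_top_of_eLpNorm hq0 hgq)
      (setLIntegral_le_lintegral _ _)
  rcases hs with rfl | rfl
  · calc _ ≤ 4 ^ (p / q) * averagedBesov σ q p (upperHalfSpace n) g :=
          averagedBesov_evenReflection_le hpq hg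
      _ ≤ _ := mul_le_mul' le_self_add hmono
  · calc _ ≤ C₁ * (averagedBesov σ q p (upperHalfSpace n) g + slabNorm σ q p g 0) := h₁ g hg
      _ ≤ C₁ * (averagedBesov σ q p (upperHalfSpace n) g +
          C₂ * averagedBesov σ q p (upperHalfSpace n) g) := by gcongr; exact h₂ g hg hfin
      _ = C₁ * (1 + C₂) * averagedBesov σ q p (upperHalfSpace n) g := by ring
      _ ≤ _ := mul_le_mul' le_add_self hmono

theorem slobodeckijSeminorm_le_of_averagedBesov_le {σ q : ℝ} (hσ : 0 < σ) (hq : 0 < q)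
    {C : ℝ≥0∞} {f g : Euc d → 𝕜} (hf : Measurable f) (hg : Measurable g)
    (h : averagedBesov σ q q Set.univ f ≤ C * averagedBesov σ q q Set.univ g) :
    slobodeckijSeminorm σ q f ≤ C ^ (1 / q) * slobodeckijSeminorm σ q g := by
  rw [slobodeckijSeminorm_eq hσ hq hf, slobodeckijSeminorm_eq hσ hq hg,
    ← ENNReal.mul_rpow_of_nonneg _ _ (by positivity)]
  refine ENNReal.rpow_le_rpow ((mul_le_mul_right h _).trans (le_of_eq ?_)) (by positivity)
  ring

theorem exists_slobodeckijSeminorm_signedReflection_le (n : ℕ) {σ q : ℝ} (hσ : 0 < σ)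
    (hσq : σ < 1 / q) (hq : 1 ≤ q) :
    ∃ C : ℝ≥0∞, C ≠ ⊤ ∧ ∀ g : Euc (n + 1) → 𝕜, AEMeasurable g →
      eLpNorm g (ENNReal.ofReal q) volume ≠ ⊤ → ∀ s : ℝ, s = 1 ∨ s = -1 →
      slobodeckijSeminorm σ q (signedReflection s g) ≤ C * slobodeckijSeminorm σ q g := by
  have hq0 : 0 < q := by linarith
  obtain ⟨C, hC, h⟩ := exists_averagedBesov_signedReflection_le (𝕜 := 𝕜) n hσ hσq hq le_rfl
  refine ⟨C ^ (1 / q), ENNReal.rpow_ne_top_of_nonneg (by positivity) hC, fun g hg hgq s hs => ?_⟩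
  -- Weak derivatives are only almost everywhere measurable; the estimates are applied to a
  -- measurable representative.
  have hae := hg.ae_eq_mk
  rw [slobodeckijSeminorm_congr_ae (signedReflection_congr_ae s (ae_restrict_of_ae hae)),
    slobodeckijSeminorm_congr_ae hae]
  rw [eLpNorm_congr_ae hae] at hgq
  exact slobodeckijSeminorm_le_of_averagedBesov_le hσ hq0
    (measurable_signedReflection hg.measurable_mk s) hg.measurable_mk
    (h _ hg.measurable_mk hgq s hs)

theorem exists_slobodeckijSeminorm_evenReflection_le (n : ℕ) {σ q : ℝ} (hσ : 0 < σ) (hq : 0 < q) :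
    ∃ C : ℝ≥0∞, C ≠ ⊤ ∧ ∀ g : Euc (n + 1) → 𝕜, AEMeasurable g →
      slobodeckijSeminorm σ q (signedReflection 1 g) ≤ C * slobodeckijSeminorm σ q g := by
  have hqq : 0 ≤ q / q := by positivity
  refine ⟨(4 ^ (q / q)) ^ (1 / q), ENNReal.rpow_ne_top_of_nonneg (by positivity)
    (ENNReal.rpow_ne_top_of_nonneg hqq (by simp)), fun g hg => ?_⟩
  have hae := hg.ae_eq_mk
  rw [slobodeckijSeminorm_congr_ae (signedReflection_congr_ae 1 (ae_restrict_of_ae hae)),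
    slobodeckijSeminorm_congr_ae hae]
  exact slobodeckijSeminorm_le_of_averagedBesov_le hσ hq
    (measurable_signedReflection hg.measurable_mk 1) hg.measurable_mk
    ((averagedBesov_evenReflection_le hqq hg.measurable_mk).trans
      (mul_le_mul_right (averagedBesov_mono_set hqq (Set.subset_univ _) _) _))

/-- The Besov seminorm is exchanged for the averaged one, where reflections are understood, and
back. The two comparisons are `averagedBesov_univ_le` and `exists_lintegral_translationDiff_le`. -/
theorem exists_besovSeminorm_signedReflection_le (n : ℕ) {σ q p : ℝ} (hσ : 0 < σ)
    (hσ1 : σ < 1) (hσq : σ < 1 / q) (hq : 1 ≤ q) (hqp : q ≤ p) :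
    ∃ C : ℝ≥0∞, C ≠ ⊤ ∧ ∀ g : Euc (n + 1) → 𝕜, AEMeasurable g →
      eLpNorm g (ENNReal.ofReal q) volume ≠ ⊤ → ∀ s : ℝ, s = 1 ∨ s = -1 →
      besovSeminorm σ q p (signedReflection s g) ≤ C * besovSeminorm σ q p g := by
  have hq0 : 0 < q := by linarith
  have hp0 : 0 < p := by linarith
  have hpq : 1 ≤ p / q := (one_le_div hq0).2 hqp
  obtain ⟨C₁, hC₁, h₁⟩ := exists_averagedBesov_signedReflection_le (𝕜 := 𝕜) n hσ hσq hq hqp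
  obtain ⟨C₂, hC₂, h₂⟩ := exists_lintegral_translationDiff_le (𝕜 := 𝕜) (n + 1) hσ hq hp0
  set C₃ : ℝ≥0∞ := volume (Metric.ball (0 : Euc (n + 1)) 1) ^ (p / q - 1) *
    ENNReal.ofReal (σ * p + (n + 1 : ℕ))⁻¹ with hC₃d
  have hC₃ : C₃ ≠ ⊤ := ENNReal.mul_ne_top
    (ENNReal.rpow_ne_top_of_nonneg (by linarith) measure_ball_lt_top.ne) ENNReal.ofReal_ne_top
  refine ⟨(C₂ * (C₁ * C₃)) ^ (1 / p), ENNReal.rpow_ne_top_of_nonneg (by positivity)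
    (ENNReal.mul_ne_top hC₂ (ENNReal.mul_ne_top hC₁ hC₃)), fun g hg hgq s hs => ?_⟩
  have hae := hg.ae_eq_mk
  rw [besovSeminorm_congr_ae (signedReflection_congr_ae s (ae_restrict_of_ae hae)),
    besovSeminorm_congr_ae hae]
  rw [eLpNorm_congr_ae hae] at hgq
  have hm := hg.measurable_mk
  rw [besovSeminorm_eq hσ hσ1 hq0 hp0, besovSeminorm_eq hσ hσ1 hq0 hp0,
    ← ENNReal.mul_rpow_of_nonneg _ _ (by positivity)]
  refine ENNReal.rpow_le_rpow ?_ (by positivity)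
  refine (h₂ _ (measurable_signedReflection hm s)).trans ?_
  rw [mul_assoc, mul_assoc]
  exact mul_le_mul_right ((h₁ _ hm hgq s hs).trans
    (mul_le_mul_right (averagedBesov_univ_le hσ hq0 hqp hm) _)) _

end SeminormBounds

/-! ### Sobolev and Besov norms in a common form, and passage to the half space. -/

section Norms

variable {𝕜 : Type*} [RCLike 𝕜] {d n k : ℕ} {q : ℝ}

open Classical in
/-- The norm consisting of the `L_q` norms of all weak derivatives of order at most `k` and of the
seminorms `S` of those of order `k`. -/
def derivNorm (k : ℕ) (q : ℝ) (S : (Euc d → 𝕜) → ℝ≥0∞) (u : Euc d → 𝕜) : ℝ≥0∞ :=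
  if HasWeakDerivs k u then
    integerSobolevNorm k q u + ∑ ι : Fin k → Fin d, S (weakDeriv ι u)
  else ⊤

theorem sobolevNorm_eq_derivNorm {s : ℝ} (hk : ⌊s⌋₊ = k) :
    sobolevNorm s q = derivNorm (𝕜 := 𝕜) (d := d) k q
      (if Int.fract s = 0 then 0 else slobodeckijSeminorm (Int.fract s) q) := by
  subst hk
  ext u
  unfold sobolevNorm derivNorm
  by_cases h : Int.fract s = 0 <;> simp [h]

theorem sobolevNorm_natCast_add {σ : ℝ} (hσ : 0 < σ) (hσ1 : σ < 1) :
    sobolevNorm (k + σ) q = derivNorm (𝕜 := 𝕜) (d := d) k q (slobodeckijSeminorm σ q) := by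
  have hf : Int.fract ((k : ℝ) + σ) = σ := by
    rw [Int.fract_natCast_add, Int.fract_eq_self.2 ⟨hσ.le, hσ1⟩]
  rw [sobolevNorm_eq_derivNorm (k := k), hf, if_neg hσ.ne']
  rw [Nat.floor_eq_iff (by positivity)]
  constructor <;> linarith

theorem sobolevNorm_natCast : sobolevNorm (k : ℝ) q = derivNorm (𝕜 := 𝕜) (d := d) k q 0 := by
  rw [sobolevNorm_eq_derivNorm (Nat.floor_natCast k), if_pos (Int.fract_natCast k)]

open Classical in
theorem besovNorm_natCast_add {σ p : ℝ} (hσ : 0 < σ) (hσ1 : σ < 1) :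
    besovNorm (k + σ) q p = derivNorm (𝕜 := 𝕜) (d := d) k q (besovSeminorm σ q p) := by
  have hk : ⌈(k : ℝ) + σ⌉₊ - 1 = k := by
    have : ⌈(k : ℝ) + σ⌉₊ = k + 1 := by
      rw [Nat.ceil_eq_iff (by simp)]
      constructor
      · simpa using hσ
      · push_cast; linarith
    omega
  -- The index type `Fin m → Fin d` depends on the order, so the equality is substituted for a
  -- variable `m` instead of being rewritten.
  have key : ∀ m : ℕ, m = k → (fun u : Euc d → 𝕜 => if HasWeakDerivs m u then
      integerSobolevNorm m q u + ∑ ι : Fin m → Fin d,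
        besovSeminorm ((k : ℝ) + σ - (m : ℝ)) q p (weakDeriv ι u) else ⊤) =
      derivNorm (𝕜 := 𝕜) (d := d) k q (besovSeminorm σ q p) := by
    rintro m rfl
    ext u
    simp [derivNorm]
  exact key _ hk

theorem derivNorm_congr_ae {S : (Euc d → 𝕜) → ℝ≥0∞} {u u' : Euc d → 𝕜} (h : u =ᵐ[volume] u') :
    derivNorm k q S u = derivNorm k q S u' := by
  unfold derivNorm integerSobolevNorm
  simp only [weakDeriv_congr_ae h]
  congr 1
  exact propext (hasWeakDerivs_congr_ae h)

variable {S : (Euc d → 𝕜) → ℝ≥0∞} {u : Euc d → 𝕜}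

theorem hasWeakDerivs_of_derivNorm_lt_top (h : derivNorm k q S u < ⊤) : HasWeakDerivs k u := by
  by_contra hu
  simp [derivNorm, hu] at h

theorem HasWeakDerivs.derivNorm_eq (h : HasWeakDerivs k u) : derivNorm k q S u =
    integerSobolevNorm k q u + ∑ ι : Fin k → Fin d, S (weakDeriv ι u) :=
  if_pos h

theorem eLpNorm_weakDeriv_le_derivNorm {m : ℕ} (hm : m ≤ k) (ι : Fin m → Fin d) :
    eLpNorm (weakDeriv ι u) (ENNReal.ofReal q) volume ≤ derivNorm k q S u := by
  by_cases hu : HasWeakDerivs k u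
  · rw [hu.derivNorm_eq]
    refine le_trans ?_ le_self_add
    refine le_trans ?_ (Finset.single_le_sum (f := fun m => ∑ ι : Fin m → Fin d,
      eLpNorm (weakDeriv ι u) (ENNReal.ofReal q) volume) (fun _ _ => zero_le)
      (Finset.mem_range.2 (Nat.lt_succ_of_le hm)))
    exact Finset.single_le_sum (f := fun ι : Fin m → Fin d =>
      eLpNorm (weakDeriv ι u) (ENNReal.ofReal q) volume) (fun _ _ => zero_le)
      (Finset.mem_univ ι)
  · simp [derivNorm, hu]

theorem seminorm_weakDeriv_le_derivNorm (ι : Fin k → Fin d) :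
    S (weakDeriv ι u) ≤ derivNorm k q S u := by
  by_cases hu : HasWeakDerivs k u
  · rw [hu.derivNorm_eq]
    refine le_trans ?_ le_add_self
    exact Finset.single_le_sum (f := fun ι : Fin k → Fin d => S (weakDeriv ι u))
      (fun _ _ => zero_le) (Finset.mem_univ ι)
  · simp [derivNorm, hu]

/-- By `isWeakDeriv_evenReflection` all derivatives of the reflection are signed reflections: their
`L_q` norms at most double, and the top order seminorms are covered by `hC`. -/
theorem derivNorm_evenReflection_le {S : (Euc (n + 1) → 𝕜) → ℝ≥0∞} (hq : 1 ≤ q)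
    (hS : ∀ g g', g =ᵐ[volume] g' → S g = S g') {C : ℝ≥0∞} {u : Euc (n + 1) → 𝕜}
    (hu : HasWeakDerivs k u)
    (hv : ∀ m < k, ∀ ι : Fin m → Fin (n + 1), reflectionSign ι = -1 →
      VanishesOnBoundary (weakDeriv ι u)
        (weakDeriv (Fin.snoc ι (Fin.last n) : Fin (m + 1) → Fin (n + 1)) u))
    (hC : ∀ ι : Fin k → Fin (n + 1),
      S (signedReflection (reflectionSign ι) (weakDeriv ι u)) ≤ C * S (weakDeriv ι u)) :
    derivNorm k q S (evenReflection 𝕜 n u) ≤ (2 + C) * derivNorm k q S u := by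
  have hR : HasWeakDerivs k (evenReflection 𝕜 n u) := fun m hm ι =>
    ⟨_, isWeakDeriv_evenReflection hu hv hm ι⟩
  have hae : ∀ m ≤ k, ∀ ι : Fin m → Fin (n + 1), weakDeriv ι (evenReflection 𝕜 n u) =ᵐ[volume]
      signedReflection (reflectionSign ι) (weakDeriv ι u) := fun m hm ι =>
    (isWeakDeriv_evenReflection hu hv hm ι).weakDeriv_ae_eq
  rw [hu.derivNorm_eq, hR.derivNorm_eq, add_mul, mul_add, mul_add]
  have h1 : integerSobolevNorm k q (evenReflection 𝕜 n u) ≤ 2 * integerSobolevNorm k q u := by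
    unfold integerSobolevNorm
    rw [Finset.mul_sum]
    refine Finset.sum_le_sum fun m hm => ?_
    rw [Finset.mul_sum]
    refine Finset.sum_le_sum fun ι _ => ?_
    rw [eLpNorm_congr_ae (hae m (Nat.lt_succ_iff.1 (Finset.mem_range.1 hm)) ι)]
    exact eLpNorm_signedReflection_le (abs_reflectionSign ι) hq _
  have h2 : ∑ ι : Fin k → Fin (n + 1), S (weakDeriv ι (evenReflection 𝕜 n u)) ≤
      C * ∑ ι : Fin k → Fin (n + 1), S (weakDeriv ι u) := by
    rw [Finset.mul_sum]
    refine Finset.sum_le_sum fun ι _ => ?_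
    rw [hS _ _ (hae k le_rfl ι)]
    exact hC ι
  exact add_le_add (h1.trans le_self_add) (h2.trans le_add_self)

/-- A bound for the reflections of all functions on the whole space is a bound for the reflections
of functions on the half space. -/
theorem exists_bound_of_extension {N : (Euc (n + 1) → 𝕜) → ℝ≥0∞}
    (hN : ∀ u u', u =ᵐ[volume] u' → N u = N u') {P : (Euc (n + 1) → 𝕜) → Prop}
    {C : ℝ≥0∞} (hC : C ≠ ⊤)
    (h : ∀ u U, P u → U =ᵐ[volume.restrict (upperHalfSpace n)] u → N U < ⊤ →
      N (evenReflection 𝕜 n U) ≤ C * N U) :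
    ∃ C : ℝ≥0, ∀ u, normOn N (upperHalfSpace n) u < ⊤ → P u →
      N (evenReflection 𝕜 n u) < ⊤ ∧
      N (evenReflection 𝕜 n u) ≤ C * normOn N (upperHalfSpace n) u := by
  -- The added one makes the constant nonzero, so that one can divide by it and the bound is trivial
  -- for extensions of infinite norm even if `C = 0`.
  refine ⟨C.toNNReal + 1, fun u hu hP => ?_⟩
  have hD : ((C.toNNReal + 1 : ℝ≥0) : ℝ≥0∞) = C + 1 := by
    rw [ENNReal.coe_add, ENNReal.coe_toNNReal hC, ENNReal.coe_one]
  rw [hD]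
  have hle : N (evenReflection 𝕜 n u) ≤ (C + 1) * normOn N (upperHalfSpace n) u := by
    have h0 : C + 1 ≠ 0 := by simp
    have ht : C + 1 ≠ ⊤ := ENNReal.add_ne_top.2 ⟨hC, ENNReal.one_ne_top⟩
    rw [mul_comm, ← ENNReal.div_le_iff_le_mul (Or.inl h0) (Or.inl ht)]
    refine le_iInf₂ fun U hU => ?_
    rw [ENNReal.div_le_iff_le_mul (Or.inl h0) (Or.inl ht), mul_comm]
    rcases eq_or_ne (N U) ⊤ with hU' | hU'
    · rw [hU', ENNReal.mul_top h0]; exact le_top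
    have hae : evenReflection 𝕜 n u =ᵐ[volume] evenReflection 𝕜 n U := by
      rw [evenReflection_eq, evenReflection_eq]
      exact signedReflection_congr_ae 1 hU.symm
    rw [hN _ _ hae]
    exact (h u U hP hU hU'.lt_top).trans (mul_le_mul_left le_self_add _)
  exact ⟨hle.trans_lt (ENNReal.mul_lt_top (ENNReal.add_lt_top.2 ⟨hC.lt_top, ENNReal.one_lt_top⟩) hu),
    hle⟩

end Norms

/-! ### Consequences of a vanishing Neumann trace. -/

section Neumann

variable {𝕜 : Type*} [RCLike 𝕜] {n : ℕ} {q : ℝ}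

theorem reflectionSign_fin_zero (ι : Fin 0 → Fin (n + 1)) : reflectionSign ι = 1 := by
  simp [reflectionSign]

theorem reflectionSign_singleton (i : Fin (n + 1)) :
    reflectionSign ![i] = if i = Fin.last n then -1 else 1 := by
  simp [reflectionSign]

/-- If the normal derivative vanishes on the boundary, then so do all derivatives of order at most
two which contain exactly one normal derivative. -/
theorem VanishesOnBoundary.weakDeriv_of_reflectionSign {U : Euc (n + 1) → 𝕜}
    (hU : HasWeakDerivs 3 U)
    (h : VanishesOnBoundary (weakDeriv ![Fin.last n] U)
      (weakDeriv (Fin.snoc ![Fin.last n] (Fin.last n) : Fin 2 → Fin (n + 1)) U))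
    {m : ℕ} (hm : m < 3) (ι : Fin m → Fin (n + 1)) (hι : reflectionSign ι = -1) :
    VanishesOnBoundary (weakDeriv ι U)
      (weakDeriv (Fin.snoc ι (Fin.last n) : Fin (m + 1) → Fin (n + 1)) U) := by
  have d1 : ∀ i : Fin (n + 1), IsWeakDeriv ![i] U (weakDeriv ![i] U) := fun i =>
    hU.isWeakDeriv (by norm_num) _
  have d2 : ∀ i j : Fin (n + 1), IsWeakDeriv ![j] (weakDeriv ![i] U)
      (weakDeriv (Fin.snoc ![i] j : Fin 2 → Fin (n + 1)) U) := fun i j =>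
    (d1 i).snoc_iff.1 (hU.isWeakDeriv (by norm_num) _)
  have d3 : ∀ (i j l : Fin (n + 1)), IsWeakDeriv ![l]
      (weakDeriv (Fin.snoc ![i] j : Fin 2 → Fin (n + 1)) U)
      (weakDeriv (Fin.snoc (Fin.snoc ![i] j : Fin 2 → Fin (n + 1)) l : Fin 3 → Fin (n + 1)) U) :=
    fun i j l => (hU.isWeakDeriv (by norm_num) _).snoc_iff.1 (hU.isWeakDeriv le_rfl _)
  interval_cases m
  · rw [reflectionSign_fin_zero] at hι
    norm_num at hι
  · obtain ⟨i, rfl⟩ : ∃ i, ι = ![i] := ⟨ι 0, by ext j; fin_cases j; rfl⟩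
    rw [reflectionSign_singleton] at hι
    by_cases hi : i = Fin.last n
    · rw [hi]; exact h
    · rw [if_neg hi] at hι; norm_num at hι
  · obtain ⟨i, j, rfl⟩ : ∃ i j, ι = (Fin.snoc ![i] j : Fin 2 → Fin (n + 1)) :=
      ⟨ι 0, ι 1, by ext l; fin_cases l <;> rfl⟩
    rw [reflectionSign_snoc, reflectionSign_singleton] at hι
    by_cases hi : i = Fin.last n <;> by_cases hj : j = Fin.last n
    -- Only tuples with exactly one normal direction have sign `-1`. If it comes first, the
    -- derivative is a tangential derivative of `∂_n U` as it stands; if it comes second, the weak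
    -- derivatives are commuted.
    · rw [if_pos hj, if_pos hi] at hι; norm_num at hι
    · subst hi
      exact h.tangential hj (d2 _ j) ((d2 _ j).comm (d2 _ _) (d3 _ j _))
    · subst hj
      have e : IsWeakDeriv ![i] (weakDeriv ![Fin.last n] U)
          (weakDeriv (Fin.snoc ![i] (Fin.last n) : Fin 2 → Fin (n + 1)) U) :=
        (d1 i).comm (d1 _) (d2 i _)
      exact h.tangential hi e (e.comm (d2 _ _) (d3 i _ _))
    · rw [if_neg hj, if_neg hi] at hι; norm_num at hι

/-- For `k ≥ 2` convergence in norm includes convergence of the second derivatives in `L_q`, which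
is what passing to the limit in the integration by parts requires. -/
theorem HasNeumannTrace.vanishesOnBoundary {S : (Euc (n + 1) → 𝕜) → ℝ≥0∞} (hq : 1 < q)
    {k : ℕ} (hk : 2 ≤ k) {u U : Euc (n + 1) → 𝕜} (hu : HasNeumannTrace (derivNorm k q S) q u 0)
    (hUu : U =ᵐ[volume.restrict (upperHalfSpace n)] u) (hU : HasWeakDerivs k U) :
    VanishesOnBoundary (weakDeriv ![Fin.last n] U)
      (weakDeriv (Fin.snoc ![Fin.last n] (Fin.last n) : Fin 2 → Fin (n + 1)) U) := by
  obtain ⟨φ, V, hφ, hc, hV, hVN, hV0, htr⟩ := hu.exists_seq hUu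
  refine vanishesOnBoundary_of_tendsto hq hφ hc hV (fun m hm => hU m (hm.trans hk))
    (fun j m hm => hasWeakDerivs_of_derivNorm_lt_top (hVN j) m (hm.trans hk)) (fun m hm ι => ?_) htr
  exact tendsto_of_tendsto_of_tendsto_of_le_of_le tendsto_const_nhds hV0 (fun _ => zero_le)
    fun j => eLpNorm_weakDeriv_le_derivNorm (hm.trans hk) ι

/-- The odd reflection of the normal derivative, for functions of order between `1 + 1 / q` and `2`
with vanishing Neumann trace. -/
theorem exists_slobodeckijSeminorm_oddReflection_le (n : ℕ) {σ : ℝ} (hq : 1 < q)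
    (hσ : 1 / q < σ) (hσ1 : σ < 1) :
    ∃ C : ℝ≥0∞, C ≠ ⊤ ∧ ∀ u U : Euc (n + 1) → 𝕜,
      HasNeumannTrace (derivNorm 1 q (slobodeckijSeminorm σ q)) q u 0 →
      U =ᵐ[volume.restrict (upperHalfSpace n)] u → HasWeakDerivs 1 U →
      slobodeckijSeminorm σ q (signedReflection (-1) (weakDeriv ![Fin.last n] U)) ≤
        C * slobodeckijSeminorm σ q (weakDeriv ![Fin.last n] U) := by
  have hq0 : 0 < q := by linarith
  have hσ0 : 0 < σ := lt_trans (by positivity) hσ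
  have hqq : 0 ≤ q / q := by positivity
  obtain ⟨C₁, hC₁, h₁⟩ := exists_averagedBesov_oddReflection_le (𝕜 := 𝕜) n (σ := σ) hq.le le_rfl
  obtain ⟨C₂, hC₂, h₂⟩ := exists_slabNorm_le_of_gt (𝕜 := 𝕜) n hq hσ hσ1
  refine ⟨(C₁ * (1 + C₂)) ^ (1 / q), ENNReal.rpow_ne_top_of_nonneg (by positivity)
    (ENNReal.mul_ne_top hC₁ (ENNReal.add_ne_top.2 ⟨ENNReal.one_ne_top, hC₂⟩)),
    fun u U hu hUu hU => ?_⟩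
  obtain ⟨φ, V, hφ, hc, hV, hVN, hV0, htr⟩ := hu.exists_seq hUu
  have dU : IsWeakDeriv ![Fin.last n] U (weakDeriv ![Fin.last n] U) := hU.isWeakDeriv le_rfl _
  have dV : ∀ j, IsWeakDeriv ![Fin.last n] (V j) (weakDeriv ![Fin.last n] (V j)) := fun j =>
    (hasWeakDerivs_of_derivNorm_lt_top (hVN j)).isWeakDeriv le_rfl _
  have hgU : AEMeasurable (weakDeriv ![Fin.last n] U) := dU.2.1.aestronglyMeasurable.aemeasurable
  have hgV : ∀ j, AEMeasurable (weakDeriv ![Fin.last n] (V j)) := fun j =>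
    (dV j).2.1.aestronglyMeasurable.aemeasurable
  set g := hgU.mk _ with hgd
  have hg : Measurable g := hgU.measurable_mk
  have hae : weakDeriv ![Fin.last n] U =ᵐ[volume] g := hgU.ae_eq_mk
  -- On the half space this difference is the normal derivative of the extension `V j`, so its
  -- seminorm and `L_q` norm there are bounded by the norm of `V j` on the whole space, which tends
  -- to zero.
  have hdiff : ∀ j, partialDeriv (Fin.last n) (φ j) - g =ᵐ[volume.restrict (upperHalfSpace n)]
      (hgV j).mk _ := by
    intro j
    have e := ((isWeakDeriv_partialDeriv (hφ j) (hc j) (Fin.last n)).sub dU).ae_eq_of_isOpen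
      isOpen_upperHalfSpace (dV j) (hV j).symm
    filter_upwards [e, ae_restrict_of_ae hae, ae_restrict_of_ae (hgV j).ae_eq_mk] with x h1 h2 h3
    rw [← h3, ← h1, Pi.sub_apply, Pi.sub_apply, h2]
  have hne : ENNReal.ofReal ((n + 1 : ℕ) + σ * q) ≠ 0 :=
    (ENNReal.ofReal_pos.2 (by positivity)).ne'
  have hsob : ∀ j, averagedBesov σ q q (upperHalfSpace n) (partialDeriv (Fin.last n) (φ j) - g) ≤
      (ENNReal.ofReal ((n + 1 : ℕ) + σ * q))⁻¹ *
        derivNorm 1 q (slobodeckijSeminorm σ q) (V j) ^ q := by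
    intro j
    rw [averagedBesov_congr_ae (hdiff j)]
    refine (averagedBesov_mono_set hqq (Set.subset_univ _) _).trans ?_
    refine ennreal_le_inv_mul_of_mul_le hne ENNReal.ofReal_ne_top ?_
    refine le_trans ?_ (ENNReal.rpow_le_rpow
      (seminorm_weakDeriv_le_derivNorm (q := q) (S := slobodeckijSeminorm σ q) (u := V j)
        ![Fin.last n]) hq0.le)
    rw [slobodeckijSeminorm_congr_ae (hgV j).ae_eq_mk,
      slobodeckijSeminorm_eq hσ0 hq0 (hgV j).measurable_mk, ← ENNReal.rpow_mul,
      one_div_mul_cancel hq0.ne', ENNReal.rpow_one]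
  have hLq : ∀ j, ∫⁻ x in upperHalfSpace n, ‖(partialDeriv (Fin.last n) (φ j) - g) x‖ₑ ^ q ≤
      derivNorm 1 q (slobodeckijSeminorm σ q) (V j) ^ q := by
    intro j
    refine le_trans ?_ (ENNReal.rpow_le_rpow
      (eLpNorm_weakDeriv_le_derivNorm (k := 1) (q := q) (S := slobodeckijSeminorm σ q) (u := V j)
        le_rfl ![Fin.last n]) hq0.le)
    rw [eLpNorm_congr_ae (hgV j).ae_eq_mk, eLpNorm_ofReal_eq hq0, ← ENNReal.rpow_mul,
      one_div_mul_cancel hq0.ne', ENNReal.rpow_one]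
    refine le_trans (le_of_eq ?_) (setLIntegral_le_lintegral (upperHalfSpace n) _)
    refine lintegral_congr_ae ((hdiff j).mono fun x hx => ?_)
    simp only [hx]
  have hVq : Tendsto (fun j => derivNorm 1 q (slobodeckijSeminorm σ q) (V j) ^ q) atTop (𝓝 0) := by
    have := (ENNReal.continuous_rpow_const (y := q)).tendsto 0
    rw [ENNReal.zero_rpow_of_pos hq0] at this
    exact this.comp hV0
  have hVq' : Tendsto (fun j => (ENNReal.ofReal ((n + 1 : ℕ) + σ * q))⁻¹ *
      derivNorm 1 q (slobodeckijSeminorm σ q) (V j) ^ q) atTop (𝓝 0) := by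
    have := ENNReal.Tendsto.const_mul hVq (Or.inr (ENNReal.inv_ne_top.2 hne))
    rwa [mul_zero] at this
  have hslab := h₂ g (fun j => partialDeriv (Fin.last n) (φ j)) hg
    (fun j => (hφ j).partialDeriv _) (fun j => (hc j).partialDeriv _)
    (tendsto_of_tendsto_of_tendsto_of_le_of_le tendsto_const_nhds hVq' (fun _ => zero_le) hsob)
    (tendsto_of_tendsto_of_tendsto_of_le_of_le tendsto_const_nhds hVq (fun _ => zero_le) hLq) htr
  rw [slobodeckijSeminorm_congr_ae (signedReflection_congr_ae (-1) (ae_restrict_of_ae hae)),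
    slobodeckijSeminorm_congr_ae hae]
  refine slobodeckijSeminorm_le_of_averagedBesov_le hσ0 hq0 (measurable_signedReflection hg (-1))
    hg ?_
  calc _ ≤ C₁ * (averagedBesov σ q q (upperHalfSpace n) g + slabNorm σ q q g 0) := h₁ g hg
    _ ≤ C₁ * (averagedBesov σ q q (upperHalfSpace n) g +
        C₂ * averagedBesov σ q q (upperHalfSpace n) g) := by gcongr
    _ = C₁ * (1 + C₂) * averagedBesov σ q q (upperHalfSpace n) g := by ring
    _ ≤ _ := mul_le_mul_right (averagedBesov_mono_set hqq (Set.subset_univ _) _) _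

end Neumann

/-! ### Boundedness for spaces of order one and of order three plus a fraction. -/

section Operators

variable {𝕜 : Type*} [RCLike 𝕜] {n : ℕ} {q : ℝ}

/-- Seminorms for which even and odd reflection are bounded on `L_q`. -/
def BoundedOnReflections (q : ℝ) (S : (Euc (n + 1) → 𝕜) → ℝ≥0∞) (C : ℝ≥0∞) : Prop :=
  ∀ g : Euc (n + 1) → 𝕜, AEMeasurable g → eLpNorm g (ENNReal.ofReal q) volume ≠ ⊤ →
    ∀ s : ℝ, s = 1 ∨ s = -1 → S (signedReflection s g) ≤ C * S g

theorem BoundedOnReflections.apply_weakDeriv {k : ℕ} {S : (Euc (n + 1) → 𝕜) → ℝ≥0∞} {C : ℝ≥0∞}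
    (h : BoundedOnReflections q S C) {U : Euc (n + 1) → 𝕜} (hU : derivNorm k q S U < ⊤)
    (ι : Fin k → Fin (n + 1)) :
    S (signedReflection (reflectionSign ι) (weakDeriv ι U)) ≤ C * S (weakDeriv ι U) :=
  h _ ((hasWeakDerivs_of_derivNorm_lt_top hU).isWeakDeriv le_rfl
      ι).2.1.aestronglyMeasurable.aemeasurable
    ((eLpNorm_weakDeriv_le_derivNorm le_rfl ι).trans_lt hU).ne _ (reflectionSign_eq_or ι)

/-- Only the function itself has to be differentiated, and it is reflected evenly, so the weak
derivatives need no boundary condition. The property `P` serves to make a trace condition available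
for the seminorm estimate alone. -/
theorem exists_bound_derivNorm_one {S : (Euc (n + 1) → 𝕜) → ℝ≥0∞} (hq : 1 ≤ q)
    (hS : ∀ g g', g =ᵐ[volume] g' → S g = S g') {C : ℝ≥0∞} (hC : C ≠ ⊤)
    {P : (Euc (n + 1) → 𝕜) → Prop}
    (h : ∀ u U, P u → U =ᵐ[volume.restrict (upperHalfSpace n)] u → derivNorm 1 q S U < ⊤ →
      ∀ ι : Fin 1 → Fin (n + 1),
        S (signedReflection (reflectionSign ι) (weakDeriv ι U)) ≤ C * S (weakDeriv ι U)) :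
    ∃ C : ℝ≥0, ∀ u, normOn (derivNorm 1 q S) (upperHalfSpace n) u < ⊤ → P u →
      derivNorm 1 q S (evenReflection 𝕜 n u) < ⊤ ∧
      derivNorm 1 q S (evenReflection 𝕜 n u) ≤
        C * normOn (derivNorm 1 q S) (upperHalfSpace n) u := by
  refine exists_bound_of_extension (fun _ _ => derivNorm_congr_ae)
    (ENNReal.add_ne_top.2 ⟨ENNReal.ofNat_ne_top (n := 2), hC⟩) fun u U hP hUu hU => ?_
  refine derivNorm_evenReflection_le hq hS (hasWeakDerivs_of_derivNorm_lt_top hU)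
    (fun m hm ι hι => ?_) (h u U hP hUu hU)
  obtain rfl : m = 0 := by omega
  rw [reflectionSign_fin_zero] at hι
  norm_num at hι

/-- Here the trace condition acts only through the identification of the weak derivatives; it does
not enter the constant, because the top order seminorm tolerates odd reflections of arbitrary
functions. -/
theorem exists_bound_derivNorm_three {S : (Euc (n + 1) → 𝕜) → ℝ≥0∞} (hq : 1 < q)
    (hS : ∀ g g', g =ᵐ[volume] g' → S g = S g') {C : ℝ≥0∞} (hC : C ≠ ⊤)
    (h : BoundedOnReflections q S C) :
    ∃ C : ℝ≥0, ∀ u, normOn (derivNorm 3 q S) (upperHalfSpace n) u < ⊤ →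
      HasNeumannTrace (derivNorm 3 q S) q u 0 →
      derivNorm 3 q S (evenReflection 𝕜 n u) < ⊤ ∧
      derivNorm 3 q S (evenReflection 𝕜 n u) ≤
        C * normOn (derivNorm 3 q S) (upperHalfSpace n) u := by
  refine exists_bound_of_extension (fun _ _ => derivNorm_congr_ae)
    (ENNReal.add_ne_top.2 ⟨ENNReal.ofNat_ne_top (n := 2), hC⟩) fun u U hP hUu hU => ?_
  have hU3 := hasWeakDerivs_of_derivNorm_lt_top hU
  exact derivNorm_evenReflection_le hq.le hS hU3
    (fun m hm ι hι => (hP.vanishesOnBoundary hq (by norm_num) hUu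
      hU3).weakDeriv_of_reflectionSign hU3 hm ι hι) (h.apply_weakDeriv hU)

end Operators

end

/-! ### The theorem. -/

theorem theorem456745645 (𝕜 : Type*) [RCLike 𝕜] (n : ℕ) (q : ℝ) (hq : 1 < q) :
    -- `R` is well defined on classes of functions modulo equality almost everywhere
    (∀ u v : EuclideanSpace ℝ (Fin (n + 1)) → 𝕜,
      u =ᵐ[volume.restrict (upperHalfSpace n)] v →
        evenReflection 𝕜 n u =ᵐ[volume] evenReflection 𝕜 n v) ∧
    -- `W^{1+α}_q`, `0 ≤ α < 1/q`
    (∀ α : ℝ, 0 ≤ α → α < 1 / q →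
      ∃ C : ℝ≥0, ∀ u : EuclideanSpace ℝ (Fin (n + 1)) → 𝕜,
        normOn (sobolevNorm (1 + α) q) (upperHalfSpace n) u < ⊤ →
          sobolevNorm (1 + α) q (evenReflection 𝕜 n u) < ⊤ ∧
          sobolevNorm (1 + α) q (evenReflection 𝕜 n u)
            ≤ C * normOn (sobolevNorm (1 + α) q) (upperHalfSpace n) u) ∧
    -- `W^{1+β}_q`, `1/q < β < 1`, vanishing Neumann trace
    (∀ β : ℝ, 1 / q < β → β < 1 →
      ∃ C : ℝ≥0, ∀ u : EuclideanSpace ℝ (Fin (n + 1)) → 𝕜,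
        normOn (sobolevNorm (1 + β) q) (upperHalfSpace n) u < ⊤ →
        HasNeumannTrace (sobolevNorm (1 + β) q) q u 0 →
          sobolevNorm (1 + β) q (evenReflection 𝕜 n u) < ⊤ ∧
          sobolevNorm (1 + β) q (evenReflection 𝕜 n u)
            ≤ C * normOn (sobolevNorm (1 + β) q) (upperHalfSpace n) u) ∧
    -- `W^{3+α}_q`, `0 < α < 1/q`, vanishing Neumann trace
    (3 / 2 < q → q < 2 → ∀ α : ℝ, 0 < α → α < 1 / q →
      ∃ C : ℝ≥0, ∀ u : EuclideanSpace ℝ (Fin (n + 1)) → 𝕜,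
        normOn (sobolevNorm (3 + α) q) (upperHalfSpace n) u < ⊤ →
        HasNeumannTrace (sobolevNorm (3 + α) q) q u 0 →
          sobolevNorm (3 + α) q (evenReflection 𝕜 n u) < ⊤ ∧
          sobolevNorm (3 + α) q (evenReflection 𝕜 n u)
            ≤ C * normOn (sobolevNorm (3 + α) q) (upperHalfSpace n) u) ∧
    -- `B^{4-1/q-3/p}_{qp}`, vanishing Neumann trace
    (3 / 2 < q → q < 2 → ∀ p : ℝ, 3 / (2 - 3 / q) < p →
      ∃ C : ℝ≥0, ∀ u : EuclideanSpace ℝ (Fin (n + 1)) → 𝕜,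
        normOn (besovNorm (4 - 1 / q - 3 / p) q p) (upperHalfSpace n) u < ⊤ →
        HasNeumannTrace (besovNorm (4 - 1 / q - 3 / p) q p) q u 0 →
          besovNorm (4 - 1 / q - 3 / p) q p (evenReflection 𝕜 n u) < ⊤ ∧
          besovNorm (4 - 1 / q - 3 / p) q p (evenReflection 𝕜 n u)
            ≤ C * normOn (besovNorm (4 - 1 / q - 3 / p) q p) (upperHalfSpace n) u) := by
  refine ⟨fun u v h => ?_, fun α hα hαq => ?_, fun β hβq hβ1 => ?_,
    fun _ _ α hα hαq => ?_, fun hq1 hq2 p hp => ?_⟩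
  · rw [evenReflection_eq, evenReflection_eq]
    exact signedReflection_congr_ae 1 h
  · rcases hα.eq_or_lt with rfl | hα
    -- For `α = 0` the norm has no fractional part, and the zero seminorm takes its place.
    · have hN : sobolevNorm (1 + 0) q = derivNorm (𝕜 := 𝕜) (d := n + 1) 1 q 0 := by
        have := sobolevNorm_natCast (𝕜 := 𝕜) (d := n + 1) (k := 1) (q := q)
        rwa [Nat.cast_one, ← add_zero (1 : ℝ)] at this
      rw [hN]
      obtain ⟨C, hC⟩ := exists_bound_derivNorm_one (𝕜 := 𝕜) (n := n) (S := 0) hq.le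
        (fun _ _ _ => rfl) ENNReal.zero_ne_top (P := fun _ => True)
        (fun _ _ _ _ _ _ => by simp)
      exact ⟨C, fun u hu => hC u hu trivial⟩
    · have hq0 : 0 < q := by linarith
      have hα1 : α < 1 := hαq.trans ((div_lt_one hq0).2 hq)
      have hN : sobolevNorm (1 + α) q =
          derivNorm (𝕜 := 𝕜) (d := n + 1) 1 q (slobodeckijSeminorm α q) := by
        have := sobolevNorm_natCast_add (𝕜 := 𝕜) (d := n + 1) (k := 1) (q := q) hα hα1
        rwa [Nat.cast_one] at this
      rw [hN]
      obtain ⟨C₁, hC₁, h₁⟩ := exists_slobodeckijSeminorm_signedReflection_le (𝕜 := 𝕜) n hα hαq hq.le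
      have hS : BoundedOnReflections q (slobodeckijSeminorm (𝕜 := 𝕜) (d := n + 1) α q) C₁ := h₁
      obtain ⟨C, hC⟩ := exists_bound_derivNorm_one hq.le
        (fun _ _ => slobodeckijSeminorm_congr_ae) hC₁ (P := fun _ => True)
        (fun _ _ _ _ hU => hS.apply_weakDeriv hU)
      exact ⟨C, fun u hu => hC u hu trivial⟩
  · have hq0 : 0 < q := by linarith
    have hβ : 0 < β := lt_trans (by positivity) hβq
    have hN : sobolevNorm (1 + β) q =
        derivNorm (𝕜 := 𝕜) (d := n + 1) 1 q (slobodeckijSeminorm β q) := by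
      have := sobolevNorm_natCast_add (𝕜 := 𝕜) (d := n + 1) (k := 1) (q := q) hβ hβ1
      rwa [Nat.cast_one] at this
    rw [hN]
    -- Tangential derivatives are reflected evenly, at no condition on `β`; only the normal
    -- derivative is reflected oddly and uses its zero trace.
    obtain ⟨C₁, hC₁, h₁⟩ := exists_slobodeckijSeminorm_evenReflection_le (𝕜 := 𝕜) n hβ hq0
    obtain ⟨C₂, hC₂, h₂⟩ := exists_slobodeckijSeminorm_oddReflection_le (𝕜 := 𝕜) n hq hβq hβ1
    refine exists_bound_derivNorm_one hq.le (fun _ _ => slobodeckijSeminorm_congr_ae)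
      (ENNReal.add_ne_top.2 ⟨hC₁, hC₂⟩) fun u U hu hUu hU ι => ?_
    have hU1 := hasWeakDerivs_of_derivNorm_lt_top hU
    obtain ⟨i, rfl⟩ : ∃ i, ι = ![i] := ⟨ι 0, by ext j; fin_cases j; rfl⟩
    rw [reflectionSign_singleton]
    split_ifs with hi
    · subst hi
      exact (h₂ u U hu hUu hU1).trans (mul_le_mul_left le_add_self _)
    · exact (h₁ _ (hU1.isWeakDeriv le_rfl _).2.1.aestronglyMeasurable.aemeasurable).trans
        (mul_le_mul_left le_self_add _)
  · have hq0 : 0 < q := by linarith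
    have hα1 : α < 1 := hαq.trans ((div_lt_one hq0).2 hq)
    have hN : sobolevNorm (3 + α) q =
        derivNorm (𝕜 := 𝕜) (d := n + 1) 3 q (slobodeckijSeminorm α q) := by
      have := sobolevNorm_natCast_add (𝕜 := 𝕜) (d := n + 1) (k := 3) (q := q) hα hα1
      rwa [Nat.cast_ofNat] at this
    rw [hN]
    obtain ⟨C₁, hC₁, h₁⟩ := exists_slobodeckijSeminorm_signedReflection_le (𝕜 := 𝕜) n hα hαq hq.le
    exact exists_bound_derivNorm_three hq (fun _ _ => slobodeckijSeminorm_congr_ae) hC₁ h₁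
  · have hq0 : 0 < q := by linarith
    have h3q : 3 / q < 2 := by rw [div_lt_iff₀ hq0]; linarith
    have h1q : 1 / 2 < 1 / q := by
      rw [div_lt_div_iff₀ (by norm_num) hq0]; linarith
    have e3 : 3 / q = 3 * (1 / q) := by ring
    -- From `3/2 < q < 2` one has `0 < 2 - 3/q < 1/2`, so `p > 6`; in particular `q ≤ p`, as the
    -- Besov estimate requires.
    have hp6 : 6 < p := by
      refine lt_of_le_of_lt ?_ hp
      rw [le_div_iff₀ (by linarith)]
      linarith
    have hp0 : 0 < p := by linarith
    have h3p : 3 / p < 2 - 3 / q := by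
      rw [div_lt_iff₀ (by linarith)] at hp
      rw [div_lt_iff₀ hp0]
      linarith
    have h3p0 : 0 < 3 / p := by positivity
    -- The order is `3 + σ`. The condition on `p` gives `σ > 2/q - 1 > 0`, and `q < 2` gives `σ < 1
    -- - 1/q < 1/q`, so this is again the case without a trace condition on the third derivatives.
    obtain ⟨σ, hσd⟩ : ∃ σ : ℝ, σ = 1 - 1 / q - 3 / p := ⟨_, rfl⟩
    have hσ : 0 < σ := by linarith
    have hσq : σ < 1 / q := by linarith
    have hσ1 : σ < 1 := by linarith [one_div_pos.2 hq0]
    have hN : besovNorm (4 - 1 / q - 3 / p) q p =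
        derivNorm (𝕜 := 𝕜) (d := n + 1) 3 q (besovSeminorm σ q p) := by
      have := besovNorm_natCast_add (𝕜 := 𝕜) (d := n + 1) (k := 3) (q := q) (p := p) hσ hσ1
      rw [Nat.cast_ofNat] at this
      rw [← this]
      congr 1
      rw [hσd]
      ring
    rw [hN]
    obtain ⟨C₁, hC₁, h₁⟩ := exists_besovSeminorm_signedReflection_le (𝕜 := 𝕜) n (p := p) hσ hσ1 hσq
      hq.le (by linarith)
    exact exists_bound_derivNorm_three hq (fun _ _ => besovSeminorm_congr_ae) hC₁ h₁
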